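/- **Definitions.** All maps and manifolds are smooth ($C^\infty$). An *orbifold chart* of dimension $m$ on a Hausdorff space $M$ is $(\tilde U,\Gamma,U,\pi)$, where $\Gamma$ is a finite group acting smoothly and effectively on an open set $\tilde U\subset\mathbb R^m$ (no $\gamma\neq 1$ acts as the identity on a nonempty open subset of $\tilde U$; for connected $\tilde U$ this means that the action is faithful) and $\pi:\tilde U\to M$ induces a homeomorphism of $\tilde U/\Gamma$ onto an open set $U\subset M$. A *change of charts* is a diffeomorphism $h$ between open subsets of $\tilde U$ and $\tilde U'$ with $\pi' h=\pi$; two charts are *compatible* if for all $y\in\tilde U$, $y'\in\tilde U'$ with $\pi(y)=\pi'(y')$ there is a change of charts defined near $y$ and taking $y$ to $y'$. An *orbifold* is a Hausdorff space with a maximal atlas of compatible charts; a *diffeomorphism* of orbifolds is a homeomorphism that, with its inverse, takes charts to charts. A *metric* on $M$ is a family of Riemannian metrics, one on $\tilde U$ for each chart, for which all changes of charts (in particular the elements of $\Gamma$) are isometric. Let $V$ be a finite-dimensional real or complex vector space. A *vector orbibundle* $p:E\to M$ over an orbifold $M$, with fibre $V$, is a continuous map from a Hausdorff space $E$ with a maximal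 atlas of compatible charts $(\tilde U,V,\Gamma,U,\Pi,\pi)$. Here $(\tilde U,\Gamma,U,\pi)$ is an orbifold chart of $M$, $\Gamma$ acts on $\tilde U\times V$ by vector bundle isomorphisms over its action on $\tilde U$, and $\Pi:\tilde U\times V\to E$ induces a homeomorphism $(\tilde U\times V)/\Gamma\to p^{-1}(U)$ with $p\,\Pi=\pi\circ\mathrm{pr}_1$; compatibility is by local vector bundle diffeomorphisms $(H,h)$ with $\pi'h=\pi$, $\Pi'H=\Pi$. An *isomorphism* is a pair of homeomorphisms $(\Phi,\phi)$ commuting with the projections which, with its inverse, takes charts to charts. Let a Lie group $G$ act smoothly on a manifold $\tilde M$ with finite isotropy groups, and let $\tilde E\to\tilde M$ be a $G$-vector bundle with fibre $V$. The *orbifold of $G$-orbits* $\tilde M/G$ has as charts all those compatible with every chart whose $\pi$ is of the form $\tilde U\xrightarrow{\,s\,}\tilde M\to\tilde M/G$ with $G\times\tilde U\to\tilde M$, $(g,y)\mapsto g\,s(y)$, a local diffeomorphism. The *vector orbibundle of $G$-orbits* $\tilde E/G\to\tilde M/G$ has as charts all those compatible with every chart whose $(\Pi,\pi)$ is induced by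 such an $s$ and a smooth, fibrewise isomorphic vector bundle map $\tilde U\times V\to\tilde E$ over $s$. **Theorem.** Let $M$ be a paracompact $m$-dimensional orbifold. Then $M$ has a metric. For every metric $\mu$ on $M$ let $\mathcal F(M)$ be the orthonormal frame bundle, that is, the space obtained from the spaces $\mathcal F(\tilde U)$ of $\mu$-orthonormal frames of all charts by identifying frames that correspond to each other under the differentials of changes of charts; $O(m)$ acts on it by right translation. Then: 1. The group $G=O(m)$ is a compact Lie group, and $\tilde M=\mathcal F(M)$ is a Hausdorff paracompact smooth manifold (second countable if $M$ is) of dimension $m+\dim O(m)$, for which the maps $\mathcal F(\tilde U)\to\mathcal F(M)$ are local diffeomorphisms. The action of $O(m)$ on it is smooth and has finite isotropy groups. 2. $\tilde M/O(m)$ is an orbifold, and the projection $\mathcal F(M)\to M$ induces a diffeomorphism of $\tilde M/O(m)$ with $M$. In particular every paracompact orbifold is the orbit space of a manifold under a compact Lie group acting with finite isotropy groups. 3. For every vector orbibundle $E\to M$ (with a real or complex finite-dimensional fibre $V$) there is an $O(m)$-vector bundle $\tilde E\to\tilde M$ with fibre $V$ such that $\tilde E/O(m)\to\tilde M/O(m)$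 is a vector orbibundle, isomorphic to $E\to M$ over the diffeomorphism of 2. -/

import Mathlib

open Set Filter TopologicalSpace
open scoped Manifold ContDiff Topology

universe u v w x

noncomputable section

/-! ### Orbifolds -/

/-- An orbifold chart `(Ũ, Γ, U, π)` of dimension `m` on `M`: a finite group `Γ` acting smoothly and
effectively on an open set `Ũ ⊆ ℝᵐ`, and a map `π : Ũ → M` that induces a homeomorphism of the orbit
space `Ũ / Γ` onto an open set `U` of `M`. Here `U` is the range of `π`, and the condition on `π` is
spelled out as: `π` is continuous and open, and its fibres are the `Γ`-orbits. -/
structure OrbifoldChart (m : ℕ) (M : Type u) [TopologicalSpace M] where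
  U : Opens (EuclideanSpace ℝ (Fin m))
  Γ : Type
  [group : Group Γ]
  [finite : Finite Γ]
  [action : MulAction Γ U]
  contMDiff_smul : ∀ γ : Γ, ContMDiff (𝓡 m) (𝓡 m) ∞ (fun y : U => γ • y)
  /-- The action is effective near every point. If `Ũ` is connected this says that the action is
  faithful. -/
  effective : ∀ (γ : Γ) (y : U), (∀ᶠ z in 𝓝 y, γ • z = z) → γ = 1
  proj : U → M
  continuous_proj : Continuous proj
  isOpenMap_proj : IsOpenMap proj
  proj_eq_iff : ∀ y z : U, proj y = proj z ↔ ∃ γ : Γ, γ • y = z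

attribute [instance] OrbifoldChart.group OrbifoldChart.finite OrbifoldChart.action

namespace OrbifoldChart

variable {m : ℕ} {M : Type u} [TopologicalSpace M] {N : Type v} [TopologicalSpace N]

/-- Local diffeomorphisms from (an open part of) the domain of one chart to that of another. -/
abbrev LocalDiffeo (c c' : OrbifoldChart m M) : Type :=
  PartialDiffeomorph (𝓡 m) (𝓡 m) c.U c'.U ∞

/-- `h` is a change of charts: `π' ∘ h = π` wherever `h` is defined. -/
def IsTransition (c c' : OrbifoldChart m M) (h : LocalDiffeo c c') : Prop :=
  ∀ y ∈ h.source, c'.proj (h y) = c.proj y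

/-- The differential of `h` at `y`; the tangent spaces of `Ũ` and `Ũ'` are `ℝᵐ`. -/
def differential {c c' : OrbifoldChart m M} (h : LocalDiffeo c c') (y : c.U) :
    EuclideanSpace ℝ (Fin m) →L[ℝ] EuclideanSpace ℝ (Fin m) :=
  mfderiv (𝓡 m) (𝓡 m) h y

/-- Compatibility of orbifold charts. -/
def Compatible (c c' : OrbifoldChart m M) : Prop :=
  ∀ (y : c.U) (y' : c'.U), c.proj y = c'.proj y' →
    ∃ h : LocalDiffeo c c', c.IsTransition c' h ∧ y ∈ h.source ∧ h y = y'

/-- Transport of a chart along a homeomorphism `φ`: the chart `(Ũ, Γ, φ(U), φ ∘ π)`. -/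
abbrev map (c : OrbifoldChart m M) (φ : M ≃ₜ N) : OrbifoldChart m N where
  U := c.U
  Γ := c.Γ
  contMDiff_smul := c.contMDiff_smul
  effective := c.effective
  proj := φ ∘ c.proj
  continuous_proj := φ.continuous.comp c.continuous_proj
  isOpenMap_proj := φ.isOpenMap.comp c.isOpenMap_proj
  proj_eq_iff y z := by simpa using c.proj_eq_iff y z

end OrbifoldChart

/-- An orbifold structure of dimension `m` on `M`: `M` is Hausdorff and carries a maximal atlas of
orbifold charts. -/
structure Orbifold (m : ℕ) (M : Type u) [TopologicalSpace M] where
  t2 : T2Space M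
  charts : Set (OrbifoldChart m M)
  compatible : ∀ c ∈ charts, ∀ c' ∈ charts, c.Compatible c'
  cover : ∀ q : M, ∃ c ∈ charts, q ∈ range c.proj
  maximal : ∀ c : OrbifoldChart m M, (∀ c' ∈ charts, c.Compatible c') → c ∈ charts

namespace Orbifold

variable {m : ℕ} {M : Type u} [TopologicalSpace M] {N : Type v} [TopologicalSpace N]

/-- Orbifold diffeomorphisms: homeomorphisms which, together with their inverses, carry charts to
charts. -/
structure Diffeo (𝓜 : Orbifold m M) (𝓝' : Orbifold m N) where
  toHomeo : M ≃ₜ N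
  map_mem : ∀ c ∈ 𝓜.charts, c.map toHomeo ∈ 𝓝'.charts
  symm_map_mem : ∀ c ∈ 𝓝'.charts, c.map toHomeo.symm ∈ 𝓜.charts

/-- A (Riemannian) metric on an orbifold: a smooth metric on every `Ũ`, such that all changes of
charts are isometric. The case of two equal charts and `h = γ` gives the invariance under `Γ`. -/
structure Metric (𝓜 : Orbifold m M) where
  inner : ∀ c : 𝓜.charts,
    c.1.U → EuclideanSpace ℝ (Fin m) →L[ℝ] EuclideanSpace ℝ (Fin m) →L[ℝ] ℝ
  contMDiff : ∀ c : 𝓜.charts, ContMDiff (𝓡 m)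
    𝓘(ℝ, EuclideanSpace ℝ (Fin m) →L[ℝ] EuclideanSpace ℝ (Fin m) →L[ℝ] ℝ) ∞ (inner c)
  symm : ∀ (c : 𝓜.charts) (y : c.1.U) (a b : EuclideanSpace ℝ (Fin m)),
    inner c y a b = inner c y b a
  pos : ∀ (c : 𝓜.charts) (y : c.1.U) (a : EuclideanSpace ℝ (Fin m)), a ≠ 0 → 0 < inner c y a a
  isometric : ∀ (c c' : 𝓜.charts) (h : c.1.LocalDiffeo c'.1), c.1.IsTransition c'.1 h →
    ∀ y ∈ h.source, ∀ a b : EuclideanSpace ℝ (Fin m),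
      inner c' (h y) (OrbifoldChart.differential h y a) (OrbifoldChart.differential h y b) =
        inner c y a b

/-! ### The orthonormal frame bundle of a Riemannian orbifold -/

/-- The space of orthonormal frames of `Ũ`, as a subspace of `Ũ × (ℝᵐ)ᵐ`. -/
def ChartFrame {𝓜 : Orbifold m M} (μ : 𝓜.Metric) (c : 𝓜.charts) : Type :=
  {z : c.1.U × (Fin m → EuclideanSpace ℝ (Fin m)) //
    ∀ i j, μ.inner c z.1 (z.2 i) (z.2 j) = if i = j then 1 else 0}

instance {𝓜 : Orbifold m M} (μ : 𝓜.Metric) (c : 𝓜.charts) : TopologicalSpace (ChartFrame μ c) :=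
  inferInstanceAs (TopologicalSpace {_z : c.1.U × (Fin m → EuclideanSpace ℝ (Fin m)) // _})

/-- Two frames in two charts are identified if the differential of a change of charts takes one to
the other. -/
def FrameRel {𝓜 : Orbifold m M} (μ : 𝓜.Metric) (a b : Σ c : 𝓜.charts, ChartFrame μ c) : Prop :=
  ∃ h : a.1.1.LocalDiffeo b.1.1, a.1.1.IsTransition b.1.1 h ∧
    a.2.1.1 ∈ h.source ∧ h a.2.1.1 = b.2.1.1 ∧
    ∀ i, OrbifoldChart.differential h a.2.1.1 (a.2.1.2 i) = b.2.1.2 i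

/-- The orthonormal frame bundle `F(M)` of a Riemannian orbifold, as a topological space: the spaces
of orthonormal frames of all charts, glued along the changes of charts. -/
def FrameBundle {𝓜 : Orbifold m M} (μ : 𝓜.Metric) : Type (max 1 u) := Quot (FrameRel μ)

instance {𝓜 : Orbifold m M} (μ : 𝓜.Metric) : TopologicalSpace (FrameBundle μ) :=
  inferInstanceAs (TopologicalSpace (Quot (FrameRel μ)))

/-- The right translation of frames by `O(m)`, written as a left action: `g • X = X g⁻¹`, that is
`(g • X)ⱼ = ∑ᵢ Xᵢ (g⁻¹)ᵢⱼ = ∑ᵢ gⱼᵢ Xᵢ`. -/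
def ChartFrame.rotate {𝓜 : Orbifold m M} {μ : 𝓜.Metric} {c : 𝓜.charts}
    (g : Matrix.orthogonalGroup (Fin m) ℝ) (z : ChartFrame μ c) : ChartFrame μ c :=
  ⟨(z.1.1, fun j => ∑ i, g.1 j i • z.1.2 i), by
    intro i j
    have h := (Matrix.mem_unitaryGroup_iff (A := g.1)).1 g.2
    have h' := congrFun (congrFun h i) j
    rw [Matrix.mul_apply, Matrix.one_apply] at h'
    rw [← h']
    simp [z.2, mul_comm]
    ⟩

namespace FrameBundle

variable {𝓜 : Orbifold m M} {μ : 𝓜.Metric}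

/-- The element of `F(M)` given by a frame in a chart. -/
def mk (c : 𝓜.charts) (z : ChartFrame μ c) : FrameBundle μ := Quot.mk _ ⟨c, z⟩

/-- The canonical projection `F(M) → M`. -/
def base : FrameBundle μ → M :=
  Quot.lift (fun a => a.1.1.proj a.2.1.1) (by
    rintro a b ⟨h, hh, hs, hb, -⟩
    rw [← hb, hh _ hs])

instance : MulAction (Matrix.orthogonalGroup (Fin m) ℝ) (FrameBundle μ) where
  smul g := Quot.map (fun a => ⟨a.1, a.2.rotate g⟩) (by
    rintro a b ⟨h, hh, hs, hb, hd⟩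
    refine ⟨h, hh, hs, hb, fun i => ?_⟩
    simp only [ChartFrame.rotate]
    rw [← funext hd]
    simp only [map_sum, map_smul])
  one_smul := by
    rintro ⟨a⟩
    refine congrArg (Quot.mk _) (Sigma.ext rfl (heq_of_eq (Subtype.ext (Prod.ext rfl ?_))))
    funext j
    simp [ChartFrame.rotate, Matrix.one_apply]
  mul_smul := by
    rintro g h ⟨a⟩
    refine congrArg (Quot.mk _) (Sigma.ext rfl (heq_of_eq (Subtype.ext (Prod.ext rfl ?_))))
    funext j
    simp only [ChartFrame.rotate, Submonoid.coe_mul, Matrix.mul_apply, Finset.sum_smul,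
      Finset.smul_sum, mul_smul]
    exact Finset.sum_comm

end FrameBundle

end Orbifold

/-! ### Vector orbibundles -/

/-- A vector orbibundle chart `(Ũ, V, Γ, U, Π, π)` for `p : E → M`: an orbifold chart
`(Ũ, Γ, U, π)` of `M`, an action `γ (y, a) = (γ y, fib γ y a)` of `Γ` on `Ũ × V` by vector bundle
isomorphisms, and a map `Π : Ũ × V → E` over `π` that induces a homeomorphism of `(Ũ × V) / Γ` onto
`p⁻¹(U)`. (Since the action of `Γ` on `Ũ` is effective, so is the one on `Ũ × V`.) -/
structure VectorOrbibundleChart (m : ℕ) (𝕜 : Type x) [RCLike 𝕜] (V : Type w)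
    [NormedAddCommGroup V] [NormedSpace 𝕜 V] [NormedSpace ℝ V]
    {E : Type v} {M : Type u} [TopologicalSpace E] [TopologicalSpace M] (p : E → M) where
  base : OrbifoldChart m M
  fib : base.Γ → base.U → V →ₗ[𝕜] V
  fib_one : ∀ y, fib 1 y = LinearMap.id
  fib_mul : ∀ γ δ y, fib (γ * δ) y = fib γ (δ • y) ∘ₗ fib δ y
  contMDiff_fib : ∀ γ, ContMDiff ((𝓡 m).prod 𝓘(ℝ, V)) 𝓘(ℝ, V) ∞
    (fun z : base.U × V => fib γ z.1 z.2)
  totalMap : base.U × V → E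
  continuous_totalMap : Continuous totalMap
  isOpenMap_totalMap : IsOpenMap totalMap
  totalMap_eq_iff : ∀ z z' : base.U × V, totalMap z = totalMap z' ↔ ∃ γ : base.Γ, (γ • z.1, fib γ z.1 z.2) = z'
  range_totalMap : range totalMap = p ⁻¹' range base.proj
  proj_totalMap : ∀ z, p (totalMap z) = base.proj z.1

namespace VectorOrbibundleChart

variable {m : ℕ} {𝕜 : Type x} [RCLike 𝕜] {V : Type w} [NormedAddCommGroup V] [NormedSpace 𝕜 V]
  [NormedSpace ℝ V] {E : Type v} {M : Type u} [TopologicalSpace E] [TopologicalSpace M] {p : E → M}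

/-- Compatibility of vector orbibundle charts. The vector bundle diffeomorphism `(H, h)` is written
as `H (z, a) = (h z, L z a)`, where only the values of `L` on the source of `h` matter. -/
def Compatible (c c' : VectorOrbibundleChart m 𝕜 V p) : Prop :=
  ∀ (y : c.base.U) (y' : c'.base.U), c.base.proj y = c'.base.proj y' →
    ∃ (h : c.base.LocalDiffeo c'.base) (L : c.base.U → V ≃ₗ[𝕜] V),
      c.base.IsTransition c'.base h ∧ y ∈ h.source ∧ h y = y' ∧
      ContMDiffOn ((𝓡 m).prod 𝓘(ℝ, V)) 𝓘(ℝ, V) ∞ (fun z : c.base.U × V => L z.1 z.2)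
        (h.source ×ˢ univ) ∧
      ∀ z ∈ h.source, ∀ a : V, c'.totalMap (h z, L z a) = c.totalMap (z, a)

/-- Transport of a chart along a pair of homeomorphisms: the chart
`(Ũ, V, Γ, φ(U), Φ ∘ Π, φ ∘ π)`. -/
def map {E' M' : Type*} [TopologicalSpace E'] [TopologicalSpace M'] {p' : E' → M'}
    (c : VectorOrbibundleChart m 𝕜 V p) (Φ : E ≃ₜ E') (φ : M ≃ₜ M')
    (h : ∀ e, p' (Φ e) = φ (p e)) : VectorOrbibundleChart m 𝕜 V p' where
  base := c.base.map φ
  fib := c.fib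
  fib_one := c.fib_one
  fib_mul := c.fib_mul
  contMDiff_fib := c.contMDiff_fib
  totalMap := Φ ∘ c.totalMap
  continuous_totalMap := Φ.continuous.comp c.continuous_totalMap
  isOpenMap_totalMap := Φ.isOpenMap.comp c.isOpenMap_totalMap
  totalMap_eq_iff z z' := by
    rw [Function.comp_apply, Function.comp_apply, Φ.injective.eq_iff]
    exact c.totalMap_eq_iff z z'
  range_totalMap := by
    ext e
    have h' : p' e = φ (p (Φ.symm e)) := by rw [← h, Φ.apply_symm_apply]
    have key : Φ.symm e ∈ range c.totalMap ↔ p (Φ.symm e) ∈ range c.base.proj := by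
      rw [c.range_totalMap]; rfl
    constructor
    · rintro ⟨z, rfl⟩
      exact ⟨z.1, by simp [OrbifoldChart.map, h, c.proj_totalMap]⟩
    · rintro ⟨y, hy⟩
      have hy' : c.base.proj y = p (Φ.symm e) := φ.injective (by rw [← h']; exact hy)
      obtain ⟨z, hz⟩ := key.2 ⟨y, hy'⟩
      exact ⟨z, by simp [hz]⟩
  proj_totalMap z := by
    rw [Function.comp_apply, h, c.proj_totalMap]
    rfl

end VectorOrbibundleChart

/-- A vector orbibundle `p : E → M` with fibre `V` over the orbifold `M`: `E` is Hausdorff, and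
`p : E → M` carries a maximal atlas of vector orbibundle charts over orbifold charts of `M`. The
orbifold structure of `E` is not separate data: it is the one for which the charts
`(Ũ × V, Γ, p⁻¹(U), Π)` form an atlas. -/
structure VectorOrbibundle {m : ℕ} (𝕜 : Type x) [RCLike 𝕜] (V : Type w)
    [NormedAddCommGroup V] [NormedSpace 𝕜 V] [NormedSpace ℝ V]
    {E : Type v} {M : Type u} [TopologicalSpace E] [TopologicalSpace M]
    (𝓜 : Orbifold m M) (p : E → M) where
  t2 : T2Space E
  continuous : Continuous p
  charts : Set (VectorOrbibundleChart m 𝕜 V p)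
  base_mem : ∀ c ∈ charts, c.base ∈ 𝓜.charts
  compatible : ∀ c ∈ charts, ∀ c' ∈ charts, c.Compatible c'
  cover : ∀ q : M, ∃ c ∈ charts, q ∈ range c.base.proj
  maximal : ∀ c : VectorOrbibundleChart m 𝕜 V p, (∀ c' ∈ charts, c.Compatible c') → c ∈ charts

/-- A vector orbibundle isomorphism `(Φ, φ)` over a given orbifold diffeomorphism `φ`: a
homeomorphism `Φ` of the total spaces over `φ` such that `(Φ, φ)` and its inverse carry vector
orbibundle charts to vector orbibundle charts. (Such a `Φ` is a diffeomorphism of the orbifold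
structures of the total spaces.) -/
structure VectorOrbibundle.Iso {m : ℕ} {𝕜 : Type x} [RCLike 𝕜] {V : Type w}
    [NormedAddCommGroup V] [NormedSpace 𝕜 V] [NormedSpace ℝ V]
    {E M E' M' : Type*} [TopologicalSpace E] [TopologicalSpace M] [TopologicalSpace E']
    [TopologicalSpace M'] {𝓜 : Orbifold m M} {𝓜' : Orbifold m M'} {p : E → M} {p' : E' → M'}
    (𝓑 : VectorOrbibundle 𝕜 V 𝓜 p) (𝓑' : VectorOrbibundle 𝕜 V 𝓜' p') (φ : 𝓜.Diffeo 𝓜') where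
  toHomeo : E ≃ₜ E'
  proj_comm : ∀ e, p' (toHomeo e) = φ.toHomeo (p e)
  proj_comm_symm : ∀ e', p (toHomeo.symm e') = φ.toHomeo.symm (p' e')
  map_mem : ∀ c ∈ 𝓑.charts, c.map toHomeo φ.toHomeo proj_comm ∈ 𝓑'.charts
  symm_map_mem : ∀ c ∈ 𝓑'.charts, c.map toHomeo.symm φ.toHomeo.symm proj_comm_symm ∈ 𝓑.charts

/-! ### `G`-manifolds, `G`-vector bundles and their orbit spaces -/

section Orbits

variable {d n m : ℕ} (G : Type v) [Group G] [TopologicalSpace G]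
  [ChartedSpace (EuclideanSpace ℝ (Fin d)) G]
  (X : Type u) [TopologicalSpace X] [ChartedSpace (EuclideanSpace ℝ (Fin n)) X] [MulAction G X]

/-- A map `s : Ũ → X` is a slice for the action of the Lie group `G` on the manifold `X` if
`G × Ũ → X`, `(g, y) ↦ g • s y`, is a local diffeomorphism; for a smooth action with finite isotropy
groups this says that `s` is an immersion everywhere transversal, and of complementary dimension, to
the orbits. -/
def IsSlice {G : Type v} [Group G] [TopologicalSpace G]
    [ChartedSpace (EuclideanSpace ℝ (Fin d)) G] {X : Type u} [TopologicalSpace X]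
    [ChartedSpace (EuclideanSpace ℝ (Fin n)) X] [MulAction G X]
    {U : Opens (EuclideanSpace ℝ (Fin m))} (s : U → X) : Prop :=
  IsLocalDiffeomorph ((𝓡 d).prod (𝓡 m)) (𝓡 n) ∞ (fun z : G × U => z.1 • s z.2)

/-- A chart of the orbit space `X / G` is a slice chart if its map `π : Ũ → X / G` is a slice
`Ũ → X` followed by the quotient map. -/
def OrbifoldChart.IsSliceChart (c : OrbifoldChart m (MulAction.orbitRel.Quotient G X)) : Prop :=
  ∃ s : c.U → X, IsSlice (d := d) (n := n) (G := G) s ∧ ∀ y, c.proj y = Quotient.mk _ (s y)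

/-- `𝓞` is the canonical orbifold structure of the orbit space `X / G`: its maximal atlas consists of
the charts that are compatible with all slice charts. -/
def Orbifold.IsOrbitSpace (𝓞 : Orbifold m (MulAction.orbitRel.Quotient G X)) : Prop :=
  𝓞.charts = {c | ∀ c' : OrbifoldChart m (MulAction.orbitRel.Quotient G X),
    c'.IsSliceChart (d := d) (n := n) G X → c.Compatible c'}

/-- A smooth `G`-vector bundle over the `G`-manifold `X`: a smooth (real or complex) vector bundle
with fibre `V` and a smooth action of `G` on its total space that takes the fibre over `q` linearly
to the fibre over `g • q`. For `𝕜 = ℂ` the fields over `ℝ` express that the underlying real vector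
bundle, with the same local trivializations, is smooth. -/
structure GVectorBundle (𝕜 : Type x) [RCLike 𝕜] (V : Type w) [NormedAddCommGroup V]
    [NormedSpace 𝕜 V] [NormedSpace ℝ V] where
  Fiber : X → Type w
  [addCommGroup : ∀ q, AddCommGroup (Fiber q)]
  [module : ∀ q, Module 𝕜 (Fiber q)]
  [realModule : ∀ q, Module ℝ (Fiber q)]
  [isScalarTower : ∀ q, IsScalarTower ℝ 𝕜 (Fiber q)]
  [topFiber : ∀ q, TopologicalSpace (Fiber q)]
  [topTotal : TopologicalSpace (Bundle.TotalSpace V Fiber)]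
  [fiberBundle : FiberBundle V Fiber]
  [vectorBundle : VectorBundle 𝕜 V Fiber]
  [realVectorBundle : VectorBundle ℝ V Fiber]
  [smoothBundle : ContMDiffVectorBundle ∞ V Fiber (𝓡 n)]
  [action : MulAction G (Bundle.TotalSpace V Fiber)]
  smul_linear : ∀ (g : G) (q : X), ∃ L : Fiber q →ₗ[𝕜] Fiber (g • q),
    ∀ a : Fiber q, g • (⟨q, a⟩ : Bundle.TotalSpace V Fiber) = ⟨g • q, L a⟩
  contMDiff_smul : ContMDiff ((𝓡 d).prod ((𝓡 n).prod 𝓘(ℝ, V))) ((𝓡 n).prod 𝓘(ℝ, V)) ∞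
    (fun z : G × Bundle.TotalSpace V Fiber => z.1 • z.2)

attribute [instance] GVectorBundle.addCommGroup GVectorBundle.module GVectorBundle.realModule
  GVectorBundle.isScalarTower GVectorBundle.topFiber GVectorBundle.topTotal
  GVectorBundle.fiberBundle GVectorBundle.vectorBundle GVectorBundle.realVectorBundle
  GVectorBundle.smoothBundle GVectorBundle.action

namespace GVectorBundle

variable {G X} {𝕜 : Type x} [RCLike 𝕜] {V : Type w} [NormedAddCommGroup V]
  [NormedSpace 𝕜 V] [NormedSpace ℝ V] (B : GVectorBundle (d := d) (n := n) G X 𝕜 V)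

/-- The total space. -/
abbrev Total : Type (max u w) := Bundle.TotalSpace V B.Fiber

theorem proj_smul (g : G) (e : B.Total) : (g • e).proj = g • e.proj := by
  obtain ⟨L, hL⟩ := B.smul_linear g e.proj
  exact congrArg Bundle.TotalSpace.proj (hL e.2)

/-- The map `Ẽ / G → X / G` induced by the projection of the bundle. -/
def orbitProj :
    MulAction.orbitRel.Quotient G B.Total → MulAction.orbitRel.Quotient G X :=
  Quotient.map Bundle.TotalSpace.proj (by
    rintro e e' ⟨g, rfl⟩
    exact ⟨g, (B.proj_smul g e').symm⟩)

/-- A vector orbibundle chart of `Ẽ / G → X / G` is a slice chart if `(Π, π)` is the composition of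
a smooth vector bundle map `(S, s) : (Ũ × V → Ũ) → (Ẽ → X)`, with `S` isomorphic on fibres and `s` a
slice, with the quotient maps. -/
def IsSliceChart (c : VectorOrbibundleChart m 𝕜 V B.orbitProj) : Prop :=
  ∃ (s : c.base.U → X) (S : ∀ y, V ≃ₗ[𝕜] B.Fiber (s y)),
    IsSlice (d := d) (n := n) (G := G) s ∧
    ContMDiff ((𝓡 m).prod 𝓘(ℝ, V)) ((𝓡 n).prod 𝓘(ℝ, V)) ∞
      (fun z : c.base.U × V => (⟨s z.1, S z.1 z.2⟩ : B.Total)) ∧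
    (∀ y, c.base.proj y = Quotient.mk _ (s y)) ∧
    ∀ y a, c.totalMap (y, a) = Quotient.mk _ (⟨s y, S y a⟩ : B.Total)

/-- `𝓥` is the canonical vector orbibundle structure of `Ẽ / G → X / G`: its maximal atlas consists
of the charts that are compatible with all slice charts. -/
def IsOrbitBundle {𝓞 : Orbifold m (MulAction.orbitRel.Quotient G X)}
    (𝓥 : VectorOrbibundle 𝕜 V 𝓞 B.orbitProj) : Prop :=
  𝓥.charts = {c | ∀ c' : VectorOrbibundleChart m 𝕜 V B.orbitProj,
    B.IsSliceChart c' → c.Compatible c'}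

end GVectorBundle

end Orbits

end

/-!
Paracompact orbifolds are orbit spaces of their orthonormal frame bundles, and vector orbibundles
over them are orbit spaces of equivariant vector bundles.

*Rigidity.* Everything rests on the fact that a change of orbifold charts is determined near a point
by its first jet there (`OrbifoldChart.IsTransition.eventually_eq`). A group element `γ` that fixes
a point to first order is trivial (`OrbifoldChart.eq_one_of_opensDeriv_eq_id`): the average of its
powers is a `γ`-invariant map that is injective near the point. Since the group is finite, it
follows that a smooth map of a chart to itself over `M` is locally given by a group element
(`OrbifoldChart.eventually_eq_smul`), so two changes of charts at the same point differ by one.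

*Metrics.* A semidefinite form on one chart that is invariant under the group and vanishes outside a
closed set extends by zero to the whole orbifold. Averages of bump functions times the Euclidean
inner product are forms of this kind, and a locally finite sum of them is a metric
(`Orbifold.nonempty_metric`).

*The frame bundle.* By rigidity, the group of a chart acts freely on the orthonormal frames of the
chart, so the map from these frames to `F(M)` is open and locally injective. A smooth frame field,
obtained by the Gram–Schmidt process, turns the frames of the chart into `O(m) × Ũ`. The resulting
maps `O(m) × Ũ → F(M)` are local homeomorphisms with smooth transition maps, and
`exists_isManifold_of_isLocalHomeomorph` makes `F(M)` a manifold; the same gluing lemma, applied to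
translated Cayley transforms, makes `O(m)` a Lie group. The isotropy group of a frame injects into
the finite group of a chart. The projection to `M` is open and closed and has compact fibres, which
are the orbits; this gives paracompactness and a homeomorphism of `M` with `F(M) / O(m)`.

*Orbit spaces.* Two slices that meet the same orbit are related by a diffeomorphism along the orbits
(`IsSlice.exists_transition`), so slice charts are mutually compatible. Hence an atlas on an orbit
space that consists of slice charts is the canonical one. Under the homeomorphism of `M` with
`F(M) / O(m)`, every chart of `M` becomes a slice chart, with a frame field as the slice.

*Bundles.* Two frames in bundle charts that represent the same element of `F(M)` are related by a
bundle transition, and its linear part at the base point does not depend on the choice: by rigidity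
the underlying change of charts is unique near the point, and over a point with trivial isotropy, of
which there is a dense set, the linear part is unique as well
(`VectorOrbibundleChart.Transition.lin_eq`). This transport of vectors along frames is a smooth
cocycle on `F(M)` that is compatible with the rotation of frames (`VectorOrbibundle.frameCore`), and
defines an `O(m)`-vector bundle. Its elements are pairs of a frame and a vector up to transport.
Forgetting the frame identifies the space of orbits with `E`
(`VectorOrbibundle.exists_homeomorph_orbits`), and by means of frame fields the charts of `E` become
slice charts.
-/

noncomputable section

/-! ### Calculus on open subsets of a normed space -/

section OpensCalculus

variable {E : Type*} [NormedAddCommGroup E] [NormedSpace ℝ E] {U U' : Opens E}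
  {F : Type*} [NormedAddCommGroup F] [NormedSpace ℝ F]

/-- The model chart of an open subset `U` of `E` is the inclusion, so the identification of the
tangent spaces of `U` with `E` is the obvious one. -/
theorem hasMFDerivAt_opens_val (y : U) :
    HasMFDerivAt 𝓘(ℝ, E) 𝓘(ℝ, E) (Subtype.val : U → E) y (ContinuousLinearMap.id ℝ E) := by
  refine ⟨continuous_subtype_val.continuousAt, ?_⟩
  have h : writtenInExtChartAt 𝓘(ℝ, E) 𝓘(ℝ, E) y (Subtype.val : U → E) =ᶠ[𝓝 (y : E)] id := by
    filter_upwards [U.isOpen.mem_nhds y.2] with z hz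
    have : z ∈ ((chartAt E (y : E)).subtypeRestr ⟨y⟩).target := by
      simpa [OpenPartialHomeomorph.subtypeRestr_def, chartAt_self_eq] using hz
    have h2 := ((chartAt E (y : E)).subtypeRestr ⟨y⟩).right_inv this
    simpa [writtenInExtChartAt, extChartAt, Opens.chartAt_eq, chartAt_self_eq] using h2
  have h3 : HasFDerivAt (id : E → E) (ContinuousLinearMap.id ℝ E) (y : E) := hasFDerivAt_id _
  have h4 := h3.congr_of_eventuallyEq h
  have h5 : extChartAt 𝓘(ℝ, E) y y = (y : E) := by
    simp [extChartAt, Opens.chartAt_eq, chartAt_self_eq]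
  rw [h5]
  exact h4.hasFDerivWithinAt

theorem mfderiv_opens_val (y : U) :
    mfderiv 𝓘(ℝ, E) 𝓘(ℝ, E) (Subtype.val : U → E) y = ContinuousLinearMap.id ℝ E :=
  (hasMFDerivAt_opens_val y).mfderiv

/-- The extension by zero of a map defined on an open set; it gives access to the calculus of
`fderiv` on the ambient space. -/
def extendZero (f : U → F) (z : E) : F := by
  classical exact if hz : z ∈ U then f ⟨z, hz⟩ else 0

omit [NormedSpace ℝ E] [NormedSpace ℝ F] in
theorem extendZero_coe (f : U → F) (y : U) : extendZero f y = f y := by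
  simp [extendZero]

theorem contMDiffAt_iff_extendZero {f : U → F} {y : U} :
    ContMDiffAt 𝓘(ℝ, E) 𝓘(ℝ, F) ∞ f y ↔ ContDiffAt ℝ ∞ (extendZero f) (y : E) := by
  rw [← contMDiffAt_iff_contDiffAt, ← contMDiffAt_subtype_iff (U := U)]
  simp only [extendZero_coe]

theorem mfderiv_eq_fderiv_extendZero {f : U → F} {y : U}
    (hf : ContMDiffAt 𝓘(ℝ, E) 𝓘(ℝ, F) ∞ f y) :
    mfderiv 𝓘(ℝ, E) 𝓘(ℝ, F) f y = fderiv ℝ (extendZero f) (y : E) := by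
  have h1 : f = extendZero f ∘ (Subtype.val : U → E) := funext fun z => (extendZero_coe f z).symm
  have h2 := (contMDiffAt_iff_extendZero.1 hf).differentiableAt (by simp)
  conv_lhs => rw [h1]
  rw [mfderiv_comp y h2.mdifferentiableAt (hasMFDerivAt_opens_val y).mdifferentiableAt,
    mfderiv_opens_val, mfderiv_eq_fderiv]
  exact ContinuousLinearMap.comp_id _

theorem mfderiv_opens_coe {f : U → U'} {y : U} (hf : ContMDiffAt 𝓘(ℝ, E) 𝓘(ℝ, E) ∞ f y) :
    mfderiv 𝓘(ℝ, E) 𝓘(ℝ, E) (fun z => (f z : E)) y = mfderiv 𝓘(ℝ, E) 𝓘(ℝ, E) f y := by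
  have := mfderiv_comp y (hasMFDerivAt_opens_val (f y)).mdifferentiableAt
    (hf.mdifferentiableAt (by simp))
  rw [mfderiv_opens_val] at this
  exact this

theorem ContMDiffAt.opens_coe {f : U → U'} {y : U} (hf : ContMDiffAt 𝓘(ℝ, E) 𝓘(ℝ, E) ∞ f y) :
    ContMDiffAt 𝓘(ℝ, E) 𝓘(ℝ, E) ∞ (fun z => (f z : E)) y :=
  (ContMDiffAt.subtypeVal_comp_iff U' f y).2 hf

/-- The differential of a map between open sets, as an endomorphism of the ambient space. Giving it
the fixed type `E →L[ℝ] E` makes it possible to speak of its continuity and smoothness in the point.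
-/
def opensDeriv (f : U → U') (y : U) : E →L[ℝ] E := mfderiv 𝓘(ℝ, E) 𝓘(ℝ, E) f y

/-- The differential of a smooth map between open sets depends smoothly on the point. -/
theorem contMDiffAt_opensDeriv {f : U → U'} {y : U}
    (hf : ∀ᶠ z in 𝓝 y, ContMDiffAt 𝓘(ℝ, E) 𝓘(ℝ, E) ∞ f z) :
    ContMDiffAt 𝓘(ℝ, E) 𝓘(ℝ, E →L[ℝ] E) ∞ (opensDeriv f) y := by
  have h1 := contMDiffAt_iff_extendZero.1 hf.self_of_nhds.opens_coe
  have h2 : ContDiffAt ℝ ∞ (fderiv ℝ (extendZero fun z => (f z : E))) (y : E) :=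
    h1.fderiv_right (by simp)
  have h3 : ContMDiffAt 𝓘(ℝ, E) 𝓘(ℝ, E →L[ℝ] E) ∞
      (fun z : U => fderiv ℝ (extendZero fun z => (f z : E)) (z : E)) y :=
    contMDiffAt_subtype_iff.2 (contMDiffAt_iff_contDiffAt.2 h2)
  refine h3.congr_of_eventuallyEq ?_
  filter_upwards [hf] with z hz
  rw [opensDeriv, ← mfderiv_opens_coe hz, mfderiv_eq_fderiv_extendZero hz.opens_coe]

variable {U'' : Opens E}

theorem opensDeriv_id (y : U) : opensDeriv (fun z : U => z) y = ContinuousLinearMap.id ℝ E :=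
  mfderiv_id

theorem opensDeriv_comp {g : U' → U''} {f : U → U'} {y : U}
    (hg : ContMDiffAt 𝓘(ℝ, E) 𝓘(ℝ, E) ∞ g (f y)) (hf : ContMDiffAt 𝓘(ℝ, E) 𝓘(ℝ, E) ∞ f y) :
    opensDeriv (fun z => g (f z)) y = opensDeriv g (f y) ∘L opensDeriv f y :=
  mfderiv_comp y (hg.mdifferentiableAt (by simp)) (hf.mdifferentiableAt (by simp))

theorem opensDeriv_congr {f g : U → U'} {y : U} (h : f =ᶠ[𝓝 y] g) :
    opensDeriv f y = opensDeriv g y := by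
  have h1 := h.mfderiv_eq (I := 𝓘(ℝ, E)) (I' := 𝓘(ℝ, E))
  exact h1

end OpensCalculus

/-! ### Partial diffeomorphisms -/

namespace PartialDiffeomorph

variable {E H E' H' : Type*} [NormedAddCommGroup E] [NormedSpace ℝ E] [TopologicalSpace H]
  [NormedAddCommGroup E'] [NormedSpace ℝ E'] [TopologicalSpace H']
  {I : ModelWithCorners ℝ E H} {J : ModelWithCorners ℝ E' H'}
  {X Y : Type*} [TopologicalSpace X] [ChartedSpace H X] [TopologicalSpace Y] [ChartedSpace H' Y]

theorem contMDiffAt (Φ : PartialDiffeomorph I J X Y ∞) {x : X} (hx : x ∈ Φ.source) :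
    ContMDiffAt I J ∞ Φ x :=
  (Φ.contMDiffOn x hx).contMDiffAt (Φ.open_source.mem_nhds hx)

theorem contMDiffAt_symm (Φ : PartialDiffeomorph I J X Y ∞) {y : Y} (hy : y ∈ Φ.target) :
    ContMDiffAt J I ∞ Φ.symm y :=
  Φ.symm.contMDiffAt hy

theorem symm_apply_apply (Φ : PartialDiffeomorph I J X Y ∞) {x : X} (hx : x ∈ Φ.source) :
    Φ.symm (Φ x) = x := Φ.toPartialEquiv.left_inv hx

theorem apply_symm_apply (Φ : PartialDiffeomorph I J X Y ∞) {y : Y} (hy : y ∈ Φ.target) :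
    Φ (Φ.symm y) = y := Φ.toPartialEquiv.right_inv hy

theorem apply_mem_target (Φ : PartialDiffeomorph I J X Y ∞) {x : X} (hx : x ∈ Φ.source) :
    Φ x ∈ Φ.target := Φ.toPartialEquiv.map_source hx

theorem symm_apply_mem_source (Φ : PartialDiffeomorph I J X Y ∞) {y : Y} (hy : y ∈ Φ.target) :
    Φ.symm y ∈ Φ.source := Φ.toPartialEquiv.map_target hy

/-- Smooth maps that are inverse to each other near two corresponding points give a partial
diffeomorphism, with source in a prescribed neighbourhood. -/
theorem exists_of_local_inverses {f : X → Y} {g : Y → X} {x : X} {A : Set X} {B : Set Y}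
    (hA : IsOpen A) (hB : IsOpen B) (hxA : x ∈ A) (hxB : f x ∈ B)
    (hf : ContMDiffOn I J ∞ f A) (hg : ContMDiffOn J I ∞ g B)
    (hgf : ∀ z ∈ A, f z ∈ B → g (f z) = z) (hfg : ∀ z ∈ B, g z ∈ A → f (g z) = z) :
    ∃ Φ : PartialDiffeomorph I J X Y ∞, x ∈ Φ.source ∧ Φ.source ⊆ A ∧ ∀ z, Φ z = f z :=
  ⟨{ toFun := f
     invFun := g
     source := A ∩ f ⁻¹' B
     target := B ∩ g ⁻¹' A
     map_source' := fun z hz => ⟨hz.2, by simpa [hgf z hz.1 hz.2] using hz.1⟩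
     map_target' := fun z hz => ⟨hz.2, by simpa [hfg z hz.1 hz.2] using hz.1⟩
     left_inv' := fun z hz => hgf z hz.1 hz.2
     right_inv' := fun z hz => hfg z hz.1 hz.2
     open_source := hf.continuousOn.isOpen_inter_preimage hA hB
     open_target := hg.continuousOn.isOpen_inter_preimage hB hA
     contMDiffOn_toFun := hf.mono inter_subset_left
     contMDiffOn_invFun := hg.mono inter_subset_left }, ⟨hxA, hxB⟩, inter_subset_left,
    fun _ => rfl⟩

/-- A global diffeomorphism given by two smooth inverse maps. -/
def ofInverse (f : X → Y) (g : Y → X) (hf : ContMDiff I J ∞ f) (hg : ContMDiff J I ∞ g)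
    (hgf : ∀ x, g (f x) = x) (hfg : ∀ y, f (g y) = y) : PartialDiffeomorph I J X Y ∞ where
  toFun := f
  invFun := g
  source := univ
  target := univ
  map_source' _ _ := mem_univ _
  map_target' _ _ := mem_univ _
  left_inv' x _ := hgf x
  right_inv' y _ := hfg y
  open_source := isOpen_univ
  open_target := isOpen_univ
  contMDiffOn_toFun := hf.contMDiffOn
  contMDiffOn_invFun := hg.contMDiffOn

end PartialDiffeomorph

/-! ### Rigidity of changes of orbifold charts -/

/-- If a nonempty open set is covered by finitely many sets that are closed in it, then one of them
contains a nonempty open subset of it. -/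
theorem exists_open_subset_of_finite_cover {X ι : Type*} [TopologicalSpace X] (s : Finset ι)
    (C : ι → Set X) {O : Set X} (hO : IsOpen O) (hne : O.Nonempty)
    (hC : ∀ i ∈ s, ∀ O' ⊆ O, IsOpen O' → IsOpen (O' \ C i)) (hcov : ∀ z ∈ O, ∃ i ∈ s, z ∈ C i) :
    ∃ i ∈ s, ∃ O' ⊆ O, IsOpen O' ∧ O'.Nonempty ∧ O' ⊆ C i := by
  classical
  induction s using Finset.induction_on generalizing O with
  | empty =>
    obtain ⟨z, hz⟩ := hne
    obtain ⟨i, hi, -⟩ := hcov z hz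
    simp at hi
  | insert i s his ih =>
    rcases (O \ C i).eq_empty_or_nonempty with h | h
    · exact ⟨i, Finset.mem_insert_self _ _, O, Subset.rfl, hO, hne, sdiff_eq_empty.1 h⟩
    -- the set `O \ C i` is open and nonempty, and it is covered by the remaining sets
    · obtain ⟨j, hj, O', h1, h2⟩ := ih (hC i (Finset.mem_insert_self _ _) O Subset.rfl hO) h
        (fun j hj O' hO' => hC j (Finset.mem_insert_of_mem hj) O' (hO'.trans sdiff_subset))
        (fun z hz => by
          obtain ⟨j, hj, hzj⟩ := hcov z hz.1
          rcases Finset.mem_insert.1 hj with rfl | hj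
          · exact absurd hzj hz.2
          · exact ⟨j, hj, hzj⟩)
      exact ⟨j, Finset.mem_insert_of_mem hj, O', h1.trans sdiff_subset, h2⟩

namespace OrbifoldChart

variable {m : ℕ} {M : Type u} [TopologicalSpace M] (c c' : OrbifoldChart m M)

theorem continuous_smul (γ : c.Γ) : Continuous (fun y : c.U => γ • y) :=
  (c.contMDiff_smul γ).continuous

theorem proj_smul (γ : c.Γ) (y : c.U) : c.proj (γ • y) = c.proj y :=
  ((c.proj_eq_iff _ _).2 ⟨γ, rfl⟩).symm

theorem opensDeriv_mul_smul (γ δ : c.Γ) (y : c.U) :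
    opensDeriv (fun z : c.U => (γ * δ) • z) y =
      opensDeriv (fun z : c.U => γ • z) (δ • y) ∘L opensDeriv (fun z : c.U => δ • z) y := by
  simp only [mul_smul]
  exact opensDeriv_comp (c.contMDiff_smul γ _) (c.contMDiff_smul δ _)

theorem opensDeriv_one_smul (y : c.U) :
    opensDeriv (fun z : c.U => (1 : c.Γ) • z) y = ContinuousLinearMap.id ℝ _ := by
  simp only [one_smul]
  exact opensDeriv_id y

/-- An element of the group of a chart that fixes a point to first order is trivial: the average
`φ` of the iterates of `γ` satisfies `φ ∘ γ = φ` and has the identity as differential at the point.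
Hence it is injective near the point, and `γ` is the identity there. -/
theorem eq_one_of_opensDeriv_eq_id {γ : c.Γ} {y : c.U} (hy : γ • y = y)
    (hd : opensDeriv (fun z : c.U => γ • z) y = ContinuousLinearMap.id ℝ _) : γ = 1 := by
  set k := orderOf γ with hk
  have hkpos : (0 : ℝ) < k := by exact_mod_cast orderOf_pos γ
  have hpow : ∀ i : ℕ, γ ^ i • y = y ∧
      opensDeriv (fun z : c.U => γ ^ i • z) y = ContinuousLinearMap.id ℝ _ := by
    intro i
    induction i with
    | zero => simpa using c.opensDeriv_one_smul y
    | succ i ih =>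
      refine ⟨by rw [pow_succ, mul_smul, hy, ih.1], ?_⟩
      rw [pow_succ, opensDeriv_mul_smul, hy, hd, ih.2]
      rfl
  let φ : c.U → EuclideanSpace ℝ (Fin m) :=
    fun z => (k : ℝ)⁻¹ • ∑ i ∈ Finset.range k, ((γ ^ i • z : c.U) : EuclideanSpace ℝ (Fin m))
  -- the sum over a period of `γ` is invariant, as its first and its last term agree
  have hφγ : ∀ z, φ (γ • z) = φ z := by
    intro z
    have h1 : ∀ i, γ ^ i • γ • z = γ ^ (i + 1) • z := fun i => by rw [pow_succ, mul_smul]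
    have h2 := Finset.sum_range_succ (fun i => ((γ ^ i • z : c.U) : EuclideanSpace ℝ (Fin m))) k
    have h3 := Finset.sum_range_succ' (fun i => ((γ ^ i • z : c.U) : EuclideanSpace ℝ (Fin m))) k
    rw [h2, pow_orderOf_eq_one, pow_zero] at h3
    simp only [φ, h1]
    rw [add_right_cancel h3]
  have hsm : ∀ i, ContMDiffAt (𝓡 m) (𝓡 m) ∞
      (fun z : c.U => ((γ ^ i • z : c.U) : EuclideanSpace ℝ (Fin m))) y :=
    fun i => (c.contMDiff_smul (γ ^ i) y).opens_coe
  have hsum : ContMDiffAt (𝓡 m) (𝓡 m) ∞ φ y :=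
    ContMDiffAt.smul (f := fun _ : c.U => (k : ℝ)⁻¹)
      (g := fun z : c.U => ∑ i ∈ Finset.range k, ((γ ^ i • z : c.U) : EuclideanSpace ℝ (Fin m)))
      (contMDiffAt_const (I' := 𝓘(ℝ, ℝ))) (ContMDiffAt.sum fun i _ => hsm i)
  -- all iterates of `γ` have the identity as differential at `y`, hence so does their average
  have hder : HasFDerivAt (extendZero φ)
      (ContinuousLinearMap.id ℝ (EuclideanSpace ℝ (Fin m))) (y : EuclideanSpace ℝ (Fin m)) := by
    have h1 : ∀ i, HasFDerivAt (extendZero fun z : c.U => ((γ ^ i • z : c.U) :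
        EuclideanSpace ℝ (Fin m))) (ContinuousLinearMap.id ℝ _) (y : EuclideanSpace ℝ (Fin m)) := by
      intro i
      have h2 := ((contMDiffAt_iff_extendZero.1 (hsm i)).differentiableAt (by simp)).hasFDerivAt
      rw [← mfderiv_eq_fderiv_extendZero (hsm i), mfderiv_opens_coe (c.contMDiff_smul _ y)] at h2
      have h3 := (hpow i).2
      rw [opensDeriv] at h3
      rwa [h3] at h2
    have h4 := (HasFDerivAt.fun_sum (u := Finset.range k) fun i _ => h1 i).const_smul (k : ℝ)⁻¹
    have h5 : (k : ℝ)⁻¹ • ∑ i ∈ Finset.range k,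
        ContinuousLinearMap.id ℝ (EuclideanSpace ℝ (Fin m)) = ContinuousLinearMap.id ℝ _ := by
      ext1 v
      simp [← Nat.cast_smul_eq_nsmul ℝ, smul_smul, inv_mul_cancel₀ hkpos.ne']
    rw [h5] at h4
    refine h4.congr_of_eventuallyEq ?_
    filter_upwards [c.U.isOpen.mem_nhds y.2] with z hz
    simp [extendZero, φ]
  -- the inverse function theorem gives a local left inverse of `φ`
  have hstrict := (contMDiffAt_iff_extendZero.1 hsum).hasStrictFDerivAt (by simp)
  rw [hder.fderiv] at hstrict
  have hstrict' : HasStrictFDerivAt (extendZero φ)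
    ((ContinuousLinearEquiv.refl ℝ (EuclideanSpace ℝ (Fin m)) :
      EuclideanSpace ℝ (Fin m) →L[ℝ] EuclideanSpace ℝ (Fin m))) (y : EuclideanSpace ℝ (Fin m)) :=
    hstrict
  have hinv := continuous_subtype_val.continuousAt.eventually hstrict'.eventually_left_inverse
  have hinv' : ∀ᶠ z in 𝓝 y, hstrict'.localInverse _ _ _ (φ z) = (z : EuclideanSpace ℝ (Fin m)) := by
    filter_upwards [hinv] with z hz
    rwa [extendZero_coe] at hz
  have hγ : Tendsto (fun z : c.U => γ • z) (𝓝 y) (𝓝 y) := by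
    simpa [hy] using (c.continuous_smul γ).tendsto y
  refine c.effective γ y ?_
  filter_upwards [hinv', hγ.eventually hinv'] with z hz hz'
  rw [hφγ, hz] at hz'
  exact (Subtype.ext hz').symm

/-- The action of the group of a chart on first jets is free. -/
theorem eq_of_opensDeriv_eq {γ δ : c.Γ} {y : c.U} (hy : γ • y = δ • y)
    (hd : opensDeriv (fun z : c.U => γ • z) y = opensDeriv (fun z : c.U => δ • z) y) : γ = δ := by
  have h1 : (δ⁻¹ * γ) • y = y := by rw [mul_smul, hy, inv_smul_smul]
  have h2 := c.opensDeriv_mul_smul δ⁻¹ γ y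
  rw [hd, hy, ← c.opensDeriv_mul_smul, inv_mul_cancel, opensDeriv_one_smul] at h2
  exact (inv_mul_eq_one.1 (c.eq_one_of_opensDeriv_eq_id h1 h2)).symm

theorem isClosed_fixedBy (γ : c.Γ) : IsClosed {y : c.U | γ • y = y} :=
  isClosed_eq (c.continuous_smul γ) continuous_id

/-- The points with trivial isotropy group are dense: otherwise finitely many fixed point sets would
cover a nonempty open set, and one of them would have interior points, against effectiveness. -/
theorem dense_regular : Dense {y : c.U | ∀ γ : c.Γ, γ • y = y → γ = 1} := by
  classical
  have := Fintype.ofFinite c.Γ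
  rw [dense_iff_inter_open]
  intro O hO hne
  by_contra hemp
  rw [not_nonempty_iff_eq_empty] at hemp
  obtain ⟨γ, hγ, O', -, hO', ⟨z, hz⟩, hsub⟩ := exists_open_subset_of_finite_cover
    (Finset.univ.erase (1 : c.Γ)) (fun γ => {y : c.U | γ • y = y}) hO hne
    (fun γ _ O' _ hO' => hO'.sdiff (c.isClosed_fixedBy γ)) (fun z hz => by
      have : z ∉ {y : c.U | ∀ γ : c.Γ, γ • y = y → γ = 1} := fun h => by
        have : z ∈ (∅ : Set c.U) := hemp ▸ ⟨hz, h⟩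
        exact this
      simp only [mem_ofPred_eq, not_forall] at this
      obtain ⟨γ, h1, h2⟩ := this
      exact ⟨γ, by simpa using h2, h1⟩)
  refine (Finset.mem_erase.1 hγ).1 (c.effective γ z ?_)
  filter_upwards [hO'.mem_nhds hz] with w hw using hsub hw

/-- A smooth map over `M` is locally given by an element of the group. The group elements `γ` for
which `f` agrees with `γ` on open sets that accumulate at `y` all have the same first jet as `f` at
`y`, so there is only one of them, and the sets where `f` agrees with it fill a neighbourhood. -/
theorem eventually_eq_smul {f : c.U → c.U} {y : c.U}
    (hf : ∀ᶠ z in 𝓝 y, ContMDiffAt (𝓡 m) (𝓡 m) ∞ f z)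
    (hp : ∀ᶠ z in 𝓝 y, c.proj (f z) = c.proj z) : ∃ γ : c.Γ, ∀ᶠ z in 𝓝 y, f z = γ • z := by
  classical
  have := Fintype.ofFinite c.Γ
  obtain ⟨N, hN, hNo, hyN⟩ := eventually_nhds_iff.1 (hf.and hp)
  have hfc : ContinuousOn f N := fun z hz => (hN z hz).1.continuousAt.continuousWithinAt
  let A : c.Γ → Set c.U := fun γ => {z | f z = γ • z}
  have hcov : ∀ z ∈ N, ∃ γ : c.Γ, z ∈ A γ := fun z hz => by
    obtain ⟨γ, h⟩ := (c.proj_eq_iff _ _).1 (hN z hz).2.symm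
    exact ⟨γ, h.symm⟩
  -- the sets `A γ` are closed in `N`
  have hrel : ∀ γ : c.Γ, ∀ O' ⊆ N, IsOpen O' → IsOpen (O' \ A γ) := by
    intro γ O' hO' ho
    rw [isOpen_iff_mem_nhds]
    rintro z ⟨hz, hzA⟩
    have hc : ContinuousAt f z := hfc.continuousAt (hNo.mem_nhds (hO' hz))
    have hne := (hc.prodMk (c.continuous_smul γ).continuousAt).eventually
      ((isClosed_diagonal (X := c.U)).isOpen_compl.mem_nhds hzA)
    filter_upwards [ho.mem_nhds hz, hne] with w hw hw' using ⟨hw, hw'⟩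
  let good : c.Γ → Prop := fun γ => y ∈ closure (interior (A γ))
  have hfo : ContMDiffAt (𝓡 m) 𝓘(ℝ, _ →L[ℝ] _) ∞ (opensDeriv f) y := contMDiffAt_opensDeriv hf
  -- by continuity, a good `γ` has the same first jet at `y` as `f`
  have hgood : ∀ γ, good γ → f y = γ • y ∧
      opensDeriv f y = opensDeriv (fun z : c.U => γ • z) y := by
    intro γ hγ
    have hne : (𝓝[interior (A γ)] y).NeBot := mem_closure_iff_nhdsWithin_neBot.1 hγ
    have hc : ContinuousAt f y := hfc.continuousAt (hNo.mem_nhds hyN)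
    constructor
    · refine tendsto_nhds_unique_of_eventuallyEq (l := 𝓝[interior (A γ)] y)
        (hc.tendsto.mono_left nhdsWithin_le_nhds)
        (((c.continuous_smul γ).tendsto y).mono_left nhdsWithin_le_nhds) ?_
      filter_upwards [self_mem_nhdsWithin] with z hz
      exact (interior_subset hz : z ∈ A γ)
    · have hd : ContMDiffAt (𝓡 m) 𝓘(ℝ, _ →L[ℝ] _) ∞ (opensDeriv fun z : c.U => γ • z) y :=
        contMDiffAt_opensDeriv (Eventually.of_forall (c.contMDiff_smul γ))
      refine tendsto_nhds_unique_of_eventuallyEq (l := 𝓝[interior (A γ)] y)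
        (hfo.continuousAt.tendsto.mono_left nhdsWithin_le_nhds)
        (hd.continuousAt.tendsto.mono_left nhdsWithin_le_nhds) ?_
      filter_upwards [self_mem_nhdsWithin] with z hz
      refine opensDeriv_congr ?_
      filter_upwards [isOpen_interior.mem_nhds hz] with w hw
      exact (interior_subset hw : w ∈ A γ)
  -- a neighbourhood of `y` that does not meet the interior of `A γ` unless `γ` is good
  let S : Set c.U := N ∩ ⋂ γ ∈ {γ : c.Γ | ¬ good γ}, (closure (interior (A γ)))ᶜ
  have hSo : IsOpen S := hNo.inter
    ((toFinite _).isOpen_biInter fun γ _ => isClosed_closure.isOpen_compl)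
  have hyS : y ∈ S := ⟨hyN, by simp [good]⟩
  -- otherwise a nonempty open set of points where `f` agrees with no good element would be covered
  -- by finitely many closed sets, whence `f` agrees with one `γ` on an open subset of it; this `γ`
  -- can be neither good nor bad
  have key : ∀ z ∈ S, ∃ γ, good γ ∧ f z = γ • z := by
    by_contra! hcon
    obtain ⟨z, hzS, hz⟩ := hcon
    let O : Set c.U := S ∩ ⋂ γ ∈ {γ : c.Γ | good γ}, (N \ A γ)
    have hO : IsOpen O := hSo.inter
      ((toFinite _).isOpen_biInter fun γ _ => hrel γ N Subset.rfl hNo)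
    have hzO : z ∈ O := ⟨hzS, by
      simp only [mem_iInter]
      exact fun γ hγ => ⟨hzS.1, hz γ hγ⟩⟩
    have hON : O ⊆ N := fun z hz => hz.1.1
    obtain ⟨γ, -, O', hO'O, hO', ⟨w, hw⟩, hsub⟩ := exists_open_subset_of_finite_cover
      (Finset.univ : Finset c.Γ) A hO ⟨z, hzO⟩ (fun γ _ O' hO' => hrel γ O' (hO'.trans hON))
      (fun z hz => by
        obtain ⟨γ, h⟩ := hcov z (hON hz)
        exact ⟨γ, Finset.mem_univ _, h⟩)
    have hwI : w ∈ interior (A γ) := mem_interior.2 ⟨O', hsub, hO', hw⟩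
    by_cases hγ : good γ
    · have := (hO'O hw).2
      simp only [mem_iInter] at this
      exact (this γ hγ).2 (interior_subset hwI)
    · have := (hO'O hw).1.2
      simp only [mem_iInter] at this
      exact this γ hγ (subset_closure hwI)
  obtain ⟨γ, hγ, -⟩ := key y hyS
  refine ⟨γ, ?_⟩
  filter_upwards [hSo.mem_nhds hyS] with z hz
  obtain ⟨δ, hδ, h⟩ := key z hz
  rwa [c.eq_of_opensDeriv_eq ((hgood γ hγ).1.symm.trans (hgood δ hδ).1)
    ((hgood γ hγ).2.symm.trans (hgood δ hδ).2)]

variable {c c'}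

theorem differential_eq (h : LocalDiffeo c c') (y : c.U) : differential h y = opensDeriv h y := rfl

theorem differential_smul_comp (h : LocalDiffeo c c') {y : c.U} (hy : y ∈ h.source) (γ : c'.Γ) :
    opensDeriv (fun z => γ • h z) y =
      opensDeriv (fun z : c'.U => γ • z) (h y) ∘L differential h y :=
  opensDeriv_comp (c'.contMDiff_smul γ _) (h.contMDiffAt hy)

theorem isTransition_symm {h : LocalDiffeo c c'} (hh : c.IsTransition c' h) :
    c'.IsTransition c h.symm := fun y hy => by
  have h1 := hh (h.symm y) (h.symm_apply_mem_source hy)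
  rw [h.apply_symm_apply hy] at h1
  exact h1.symm

/-- Two changes of charts defined at the same point differ by an element of the group. -/
theorem IsTransition.eventually_eq_smul {h h' : LocalDiffeo c c'} (hh : c.IsTransition c' h)
    (hh' : c.IsTransition c' h') {y : c.U} (hy : y ∈ h.source) (hy' : y ∈ h'.source) :
    ∃ γ : c'.Γ, ∀ᶠ z in 𝓝 y, h' z = γ • h z := by
  -- apply the local statement to the self-map `h' ∘ h⁻¹` of the second chart
  let k : LocalDiffeo c' c' := h.symm.trans h'
  have hks : h y ∈ k.source := ⟨h.apply_mem_target hy, by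
    change h.symm (h y) ∈ h'.source
    rwa [h.symm_apply_apply hy]⟩
  have hk : c'.IsTransition c' k := fun z hz => by
    have h1 : c'.proj (h' (h.symm z)) = c.proj (h.symm z) := hh' _ hz.2
    exact h1.trans (isTransition_symm hh z hz.1)
  obtain ⟨γ, hγ⟩ := c'.eventually_eq_smul (f := k) (y := h y)
    (by filter_upwards [k.open_source.mem_nhds hks] with z hz using k.contMDiffAt hz)
    (by filter_upwards [k.open_source.mem_nhds hks] with z hz using hk z hz)
  refine ⟨γ, ?_⟩
  filter_upwards [(h.contMDiffAt hy).continuousAt.eventually hγ, h.open_source.mem_nhds hy]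
    with z hz hzs
  rw [← hz]
  change _ = h' (h.symm (h z))
  rw [h.symm_apply_apply hzs]

/-- A change of charts is determined near a point by its first jet there. -/
theorem IsTransition.eventually_eq {h h' : LocalDiffeo c c'} (hh : c.IsTransition c' h)
    (hh' : c.IsTransition c' h') {y : c.U} (hy : y ∈ h.source) (hy' : y ∈ h'.source)
    (h0 : h y = h' y) (hd : differential h y = differential h' y) : ∀ᶠ z in 𝓝 y, h z = h' z := by
  obtain ⟨γ, hγ⟩ := hh.eventually_eq_smul hh' hy hy'
  have h1 : γ • h y = h y := by rw [← hγ.self_of_nhds, h0]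
  have h2 : opensDeriv h' y = _ := opensDeriv_congr hγ
  rw [differential_smul_comp h hy, ← differential_eq, ← hd] at h2
  -- the differential of `γ` at `h y` is the identity, as that of `h` can be cancelled
  have h3 : γ = 1 := by
    refine c'.eq_one_of_opensDeriv_eq_id h1 ?_
    have h5 : differential h.symm (h y) = _ := rfl
    have h4 : differential h y ∘L opensDeriv h.symm (h y) = ContinuousLinearMap.id ℝ _ := by
      have h6 : h y ∈ h.target := h.apply_mem_target hy
      have h7 := opensDeriv_comp (g := h) (f := h.symm) (y := h y)
        (by rw [h.symm_apply_apply hy]; exact h.contMDiffAt hy) (h.contMDiffAt_symm h6)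
      rw [h.symm_apply_apply hy] at h7
      rw [differential_eq, ← h7, ← opensDeriv_id (h y)]
      refine opensDeriv_congr ?_
      filter_upwards [h.open_target.mem_nhds h6] with z hz using h.apply_symm_apply hz
    have h8 := congrArg (fun A => A ∘L opensDeriv h.symm (h y)) h2
    simp only [ContinuousLinearMap.comp_assoc, h4] at h8
    rw [ContinuousLinearMap.comp_id] at h8
    exact h8.symm
  filter_upwards [hγ] with z hz
  rw [hz, h3, one_smul]

end OrbifoldChart

/-! ### Composition of changes of charts -/

namespace OrbifoldChart

variable {m : ℕ} {M : Type u} [TopologicalSpace M] {c c' c'' : OrbifoldChart m M}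

theorem symm_differential_comp (h : LocalDiffeo c c') {y : c.U} (hy : y ∈ h.source) :
    differential h.symm (h y) ∘L differential h y = ContinuousLinearMap.id ℝ _ := by
  have h1 := opensDeriv_comp (g := h.symm) (f := h) (y := y)
    (h.contMDiffAt_symm (h.apply_mem_target hy)) (h.contMDiffAt hy)
  rw [differential_eq, differential_eq, ← h1, ← opensDeriv_id y]
  refine opensDeriv_congr ?_
  filter_upwards [h.open_source.mem_nhds hy] with z hz using h.symm_apply_apply hz

theorem differential_injective (h : LocalDiffeo c c') {y : c.U} (hy : y ∈ h.source) :
    Function.Injective (differential h y) :=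
  Function.LeftInverse.injective (g := differential h.symm (h y)) fun a =>
    congrArg (fun A => A a) (symm_differential_comp h hy)

theorem mem_trans_source {h : LocalDiffeo c c'} {h' : LocalDiffeo c' c''} {y : c.U} :
    y ∈ (h.trans h').source ↔ y ∈ h.source ∧ h y ∈ h'.source := Iff.rfl

theorem IsTransition.trans {h : LocalDiffeo c c'} {h' : LocalDiffeo c' c''}
    (hh : c.IsTransition c' h) (hh' : c'.IsTransition c'' h') :
    c.IsTransition c'' (h.trans h') :=
  fun y hy => (hh' _ hy.2).trans (hh y hy.1)

theorem differential_trans (h : LocalDiffeo c c') (h' : LocalDiffeo c' c'') {y : c.U}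
    (hy : y ∈ h.source) (hy' : h y ∈ h'.source) :
    differential (h.trans h') y = differential h' (h y) ∘L differential h y :=
  opensDeriv_comp (h'.contMDiffAt hy') (h.contMDiffAt hy)

theorem contMDiffAt_differential (h : LocalDiffeo c c') {y : c.U} (hy : y ∈ h.source) :
    ContMDiffAt (𝓡 m) 𝓘(ℝ, EuclideanSpace ℝ (Fin m) →L[ℝ] EuclideanSpace ℝ (Fin m)) ∞
      (differential h) y :=
  contMDiffAt_opensDeriv (f := h)
    (by filter_upwards [h.open_source.mem_nhds hy] with z hz using h.contMDiffAt hz)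

variable (c) in
/-- The identity of a chart as a change of charts. -/
def reflDiffeo : LocalDiffeo c c :=
  .ofInverse id id contMDiff_id contMDiff_id (fun _ => rfl) (fun _ => rfl)

theorem isTransition_refl : c.IsTransition c c.reflDiffeo := fun _ _ => rfl

variable (c) in
/-- An element of the group of a chart as a change of charts. -/
def smulDiffeo (γ : c.Γ) : LocalDiffeo c c :=
  .ofInverse (fun y => γ • y) (fun y => γ⁻¹ • y) (c.contMDiff_smul γ) (c.contMDiff_smul γ⁻¹)
    (fun y => inv_smul_smul γ y) (fun y => smul_inv_smul γ y)

theorem isTransition_smulDiffeo (γ : c.Γ) : c.IsTransition c (c.smulDiffeo γ) :=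
  fun y _ => c.proj_smul γ y

end OrbifoldChart

/-! ### Existence of metrics -/

section Forms

variable {E : Type*} [NormedAddCommGroup E] [NormedSpace ℝ E]

/-- The pullback of a bilinear form under a linear map. -/
def pullForm (A : E →L[ℝ] E) (T : E →L[ℝ] E →L[ℝ] ℝ) : E →L[ℝ] E →L[ℝ] ℝ :=
  (ContinuousLinearMap.compL ℝ E E ℝ).flip A ∘L (T ∘L A)

theorem pullForm_apply (A : E →L[ℝ] E) (T : E →L[ℝ] E →L[ℝ] ℝ) (a b : E) :
    pullForm A T a b = T (A a) (A b) := rfl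

theorem pullForm_comp (A B : E →L[ℝ] E) (T : E →L[ℝ] E →L[ℝ] ℝ) :
    pullForm (A ∘L B) T = pullForm B (pullForm A T) := rfl

variable {F H X : Type*} [NormedAddCommGroup F] [NormedSpace ℝ F] [TopologicalSpace H]
  {I : ModelWithCorners ℝ F H} [TopologicalSpace X] [ChartedSpace H X]

theorem ContMDiffAt.pullForm {A : X → E →L[ℝ] E} {T : X → E →L[ℝ] E →L[ℝ] ℝ} {x : X}
    (hA : ContMDiffAt I 𝓘(ℝ, E →L[ℝ] E) ∞ A x)
    (hT : ContMDiffAt I 𝓘(ℝ, E →L[ℝ] E →L[ℝ] ℝ) ∞ T x) :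
    ContMDiffAt I 𝓘(ℝ, E →L[ℝ] E →L[ℝ] ℝ) ∞ (fun z => _root_.pullForm (A z) (T z)) x :=
  (contMDiffAt_const.clm_apply hA).clm_comp (hT.clm_comp hA)

end Forms

namespace Orbifold

variable {m : ℕ} {M : Type u} [TopologicalSpace M]

/-- A smooth field of positive semidefinite symmetric bilinear forms on an orbifold. -/
structure Premetric (𝓜 : Orbifold m M) where
  inner : ∀ c : 𝓜.charts,
    c.1.U → EuclideanSpace ℝ (Fin m) →L[ℝ] EuclideanSpace ℝ (Fin m) →L[ℝ] ℝ
  contMDiff : ∀ c : 𝓜.charts, ContMDiff (𝓡 m)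
    𝓘(ℝ, EuclideanSpace ℝ (Fin m) →L[ℝ] EuclideanSpace ℝ (Fin m) →L[ℝ] ℝ) ∞ (inner c)
  symm : ∀ (c : 𝓜.charts) (y : c.1.U) (a b : EuclideanSpace ℝ (Fin m)),
    inner c y a b = inner c y b a
  nonneg : ∀ (c : 𝓜.charts) (y : c.1.U) (a : EuclideanSpace ℝ (Fin m)), 0 ≤ inner c y a a
  isometric : ∀ (c c' : 𝓜.charts) (h : c.1.LocalDiffeo c'.1), c.1.IsTransition c'.1 h →
    ∀ y ∈ h.source, inner c y = pullForm (OrbifoldChart.differential h y) (inner c' (h y))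

namespace Premetric

variable {𝓜 : Orbifold m M}

/-- The form is positive definite over the point `q`. -/
def PosAt (T : 𝓜.Premetric) (q : M) : Prop :=
  ∀ (c : 𝓜.charts) (y : c.1.U), c.1.proj y = q → ∀ a, a ≠ 0 → 0 < T.inner c y a a

/-- The form vanishes outside the set `K`. -/
def ZeroOff (T : 𝓜.Premetric) (K : Set M) : Prop :=
  ∀ (c : 𝓜.charts) (y : c.1.U), c.1.proj y ∉ K → T.inner c y = 0

instance : Zero 𝓜.Premetric where
  zero :=
    { inner := fun _ _ => 0
      contMDiff := fun _ => contMDiff_const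
      symm := fun _ _ _ _ => rfl
      nonneg := fun _ _ _ => le_rfl
      isometric := fun _ _ _ _ _ _ => by ext; simp [pullForm_apply] }

instance : Add 𝓜.Premetric where
  add S T :=
    { inner := fun c y => S.inner c y + T.inner c y
      contMDiff := fun c => (S.contMDiff c).add (T.contMDiff c)
      symm := fun c y a b => by simp [S.symm c y a b, T.symm c y a b]
      nonneg := fun c y a => add_nonneg (S.nonneg c y a) (T.nonneg c y a)
      isometric := fun c c' h hh y hy => by
        rw [S.isometric c c' h hh y hy, T.isometric c c' h hh y hy]
        rfl }

theorem add_inner (S T : 𝓜.Premetric) (c : 𝓜.charts) (y : c.1.U) :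
    (S + T).inner c y = S.inner c y + T.inner c y := rfl

end Premetric

section OfChart

variable {𝓜 : Orbifold m M} (c₀ : 𝓜.charts)
  (T₀ : c₀.1.U → EuclideanSpace ℝ (Fin m) →L[ℝ] EuclideanSpace ℝ (Fin m) →L[ℝ] ℝ)

open OrbifoldChart in
open scoped Classical in
/-- The extension by zero to all charts of an invariant form in the chart `c₀`. -/
def extendForm (c : 𝓜.charts) (y : c.1.U) :
    EuclideanSpace ℝ (Fin m) →L[ℝ] EuclideanSpace ℝ (Fin m) →L[ℝ] ℝ :=
  if h : ∃ h : c.1.LocalDiffeo c₀.1, c.1.IsTransition c₀.1 h ∧ y ∈ h.source then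
    pullForm (differential h.choose y) (T₀ (h.choose y)) else 0

variable {c₀ T₀}

open OrbifoldChart

/-- The extension does not depend on the chosen change of charts, since the form is invariant under
the group of the chart. -/
theorem extendForm_eq
    (hT₀ : ∀ (γ : c₀.1.Γ) z, T₀ z = pullForm (opensDeriv (fun w : c₀.1.U => γ • w) z) (T₀ (γ • z)))
    {c : 𝓜.charts} {y : c.1.U} {h : c.1.LocalDiffeo c₀.1} (hh : c.1.IsTransition c₀.1 h)
    (hy : y ∈ h.source) : extendForm c₀ T₀ c y = pullForm (differential h y) (T₀ (h y)) := by
  have hex : ∃ h : c.1.LocalDiffeo c₀.1, c.1.IsTransition c₀.1 h ∧ y ∈ h.source := ⟨h, hh, hy⟩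
  rw [extendForm, dif_pos hex]
  obtain ⟨γ, hγ⟩ := hh.eventually_eq_smul hex.choose_spec.1 hy hex.choose_spec.2
  rw [hγ.self_of_nhds, differential_eq, opensDeriv_congr hγ, differential_smul_comp h hy,
    pullForm_comp, ← hT₀]

/-- An invariant form in one chart that vanishes outside the preimage of a closed subset `K` of `M`,
where `K` lies in the image of the chart, extends by zero to the orbifold. -/
def Premetric.ofChart
    (hT₀ : ∀ (γ : c₀.1.Γ) z, T₀ z = pullForm (opensDeriv (fun w : c₀.1.U => γ • w) z) (T₀ (γ • z)))
    (hsm : ContMDiff (𝓡 m)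
      𝓘(ℝ, EuclideanSpace ℝ (Fin m) →L[ℝ] EuclideanSpace ℝ (Fin m) →L[ℝ] ℝ) ∞ T₀)
    (hsymm : ∀ z a b, T₀ z a b = T₀ z b a) (hnn : ∀ z a, 0 ≤ T₀ z a a) {K : Set M}
    (hK : IsClosed K) (hKc : K ⊆ range c₀.1.proj) (hKT : ∀ z, c₀.1.proj z ∉ K → T₀ z = 0) :
    𝓜.Premetric where
  inner := extendForm c₀ T₀
  contMDiff c y := by
    by_cases hex : ∃ h : c.1.LocalDiffeo c₀.1, c.1.IsTransition c₀.1 h ∧ y ∈ h.source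
    · obtain ⟨h, hh, hy⟩ := hex
      refine ((contMDiffAt_differential h hy).pullForm
        (ContMDiffAt.comp y (hsm (h y)) (h.contMDiffAt hy))).congr_of_eventuallyEq ?_
      filter_upwards [h.open_source.mem_nhds hy] with z hz using extendForm_eq hT₀ hh hz
    -- a point over `K` is related to a point of `c₀`, so near `y` the extension is zero
    · have hyK : c.1.proj y ∉ K := fun hy => by
        obtain ⟨z, hz⟩ := hKc hy
        obtain ⟨h, hh, hys, -⟩ := 𝓜.compatible c c.2 c₀ c₀.2 y z hz.symm
        exact hex ⟨h, hh, hys⟩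
      refine contMDiffAt_const (c := 0) |>.congr_of_eventuallyEq ?_
      filter_upwards [c.1.continuous_proj.continuousAt.eventually (hK.isOpen_compl.mem_nhds hyK)]
        with z hz
      rw [extendForm]
      split_ifs with h
      · rw [hKT _ (by rw [h.choose_spec.1 _ h.choose_spec.2]; exact hz)]
        ext; simp [pullForm_apply]
      · rfl
  symm c y a b := by
    rw [extendForm]
    split_ifs
    · exact hsymm _ _ _
    · rfl
  nonneg c y a := by
    rw [extendForm]
    split_ifs
    · exact hnn _ _
    · exact le_rfl
  isometric c c' k hk y hy := by
    by_cases hex : ∃ h : c'.1.LocalDiffeo c₀.1, c'.1.IsTransition c₀.1 h ∧ k y ∈ h.source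
    · obtain ⟨h, hh, hky⟩ := hex
      rw [extendForm_eq hT₀ hh hky, ← pullForm_comp, ← differential_trans k h hy hky]
      exact extendForm_eq hT₀ (hk.trans hh) ⟨hy, hky⟩
    · rw [extendForm, extendForm, dif_neg hex, dif_neg]
      · ext; simp [pullForm_apply]
      · rintro ⟨h, hh, hyh⟩
        refine hex ⟨k.symm.trans h, (isTransition_symm hk).trans hh, k.apply_mem_target hy, ?_⟩
        change k.symm (k y) ∈ h.source
        rwa [k.symm_apply_apply hy]

end OfChart

open OrbifoldChart

variable {𝓜 : Orbifold m M}

/-- In a chart around `q`, multiply the Euclidean inner product by a bump function and sum over the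
pullbacks under all elements of the group. -/
theorem Premetric.exists_posAt_near (q : M) {W : Set M} (hW : W ∈ 𝓝 q) :
    ∃ (T : 𝓜.Premetric) (K : Set M), (∀ᶠ q' in 𝓝 q, T.PosAt q') ∧ IsCompact K ∧ K ⊆ W ∧
      T.ZeroOff K := by
  classical
  have := 𝓜.t2
  obtain ⟨c₀, hc₀, y₀, rfl⟩ := 𝓜.cover q
  have := Fintype.ofFinite c₀.Γ
  have hs : Subtype.val '' (c₀.proj ⁻¹' W) ∈ 𝓝 (y₀ : EuclideanSpace ℝ (Fin m)) :=
    c₀.U.isOpen.isOpenMap_subtype_val.image_mem_nhds (c₀.continuous_proj.continuousAt hW)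
  obtain ⟨β, hβs, hβc, hβ, hβr, hβ1⟩ := exists_contDiff_tsupport_subset (n := ⊤) hs
  have hβ0 : ∀ z, 0 ≤ β z := fun z => (hβr ⟨z, rfl⟩).1
  let D : c₀.Γ → c₀.U → EuclideanSpace ℝ (Fin m) →L[ℝ] EuclideanSpace ℝ (Fin m) :=
    fun γ => opensDeriv (fun w : c₀.U => γ • w)
  -- the sum over the group of the pullbacks of `β` times the Euclidean inner product
  let T₀ : c₀.U → EuclideanSpace ℝ (Fin m) →L[ℝ] EuclideanSpace ℝ (Fin m) →L[ℝ] ℝ :=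
    fun z => ∑ γ : c₀.Γ, β ((γ • z : c₀.U) : EuclideanSpace ℝ (Fin m)) •
      pullForm (D γ z) (innerSL ℝ)
  have hT₀a : ∀ z a b, T₀ z a b = ∑ γ : c₀.Γ, β ((γ • z : c₀.U) : EuclideanSpace ℝ (Fin m)) *
      Inner.inner ℝ (D γ z a) (D γ z b) := by
    intro z a b
    simp [T₀, pullForm_apply]
    rfl
  let K : Set M := c₀.proj '' (Subtype.val ⁻¹' tsupport β)
  have hK : IsCompact K := by
    refine IsCompact.image ?_ c₀.continuous_proj
    refine c₀.U.isOpen.isOpenEmbedding_subtypeVal.isInducing.isCompact_preimage_iff ?_ |>.2 hβc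
    exact hβs.trans (by rintro _ ⟨z, -, rfl⟩; exact ⟨z, rfl⟩)
  -- pulling back by `γ` permutes the summands
  have hinv : ∀ (γ : c₀.Γ) z, T₀ z = pullForm (D γ z) (T₀ (γ • z)) := by
    intro γ z
    ext a b
    rw [pullForm_apply, hT₀a, hT₀a, ← Equiv.sum_comp (Equiv.mulRight γ)]
    refine Finset.sum_congr rfl fun δ _ => ?_
    have h1 : D (δ * γ) z = D δ (γ • z) ∘L D γ z := c₀.opensDeriv_mul_smul δ γ z
    simp only [Equiv.coe_mulRight, h1, mul_smul]
    rfl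
  have hsm : ContMDiff (𝓡 m)
      𝓘(ℝ, EuclideanSpace ℝ (Fin m) →L[ℝ] EuclideanSpace ℝ (Fin m) →L[ℝ] ℝ) ∞ T₀ := by
    refine ContMDiff.sum fun γ _ => ContMDiff.smul (I := 𝓘(ℝ, ℝ))
      (f := fun z : c₀.U => β ((γ • z : c₀.U) : EuclideanSpace ℝ (Fin m)))
      (g := fun z : c₀.U => pullForm (D γ z) (innerSL ℝ)) ?_ ?_
    · exact hβ.contMDiff.comp (contMDiff_subtype_val.comp (c₀.contMDiff_smul γ))
    · exact fun z => (contMDiffAt_opensDeriv (f := fun w : c₀.U => γ • w)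
        (Eventually.of_forall (c₀.contMDiff_smul γ))).pullForm contMDiffAt_const
  have hsub : K ⊆ W ∧ K ⊆ range c₀.proj := by
    constructor
    · rintro _ ⟨z, hz, rfl⟩
      obtain ⟨w, hw, hwz⟩ := hβs hz
      rwa [← Subtype.ext hwz]
    · rintro _ ⟨z, hz, rfl⟩
      exact ⟨z, rfl⟩
  have hKT : ∀ z, c₀.proj z ∉ K → T₀ z = 0 := by
    intro z hz
    refine Finset.sum_eq_zero fun γ _ => ?_
    have : β ((γ • z : c₀.U) : EuclideanSpace ℝ (Fin m)) = 0 := by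
      refine image_eq_zero_of_notMem_tsupport fun h => hz ⟨γ • z, h, c₀.proj_smul γ z⟩
    ext a b
    exact mul_eq_zero_of_left this _
  let T : 𝓜.Premetric := Premetric.ofChart (c₀ := ⟨c₀, hc₀⟩) hinv hsm
    (fun z a b => by
      rw [hT₀a, hT₀a]
      exact Finset.sum_congr rfl fun γ _ => by rw [real_inner_comm])
    (fun z a => by
      rw [hT₀a]
      exact Finset.sum_nonneg fun γ _ => mul_nonneg (hβ0 _) real_inner_self_nonneg)
    hK.isClosed hsub.2 hKT
  have hT : ∀ (c : 𝓜.charts) (y : c.1.U) (h : c.1.LocalDiffeo c₀), c.1.IsTransition c₀ h →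
      y ∈ h.source → T.inner c y = pullForm (differential h y) (T₀ (h y)) :=
    fun c y h hh hy => extendForm_eq (c₀ := ⟨c₀, hc₀⟩) hinv hh hy
  refine ⟨T, K, ?_, hK, hsub.1, ?_⟩
  · have hpos : ∀ᶠ z : c₀.U in 𝓝 y₀, 0 < β z := by
      refine (hβ.continuous.comp continuous_subtype_val).continuousAt.eventually
        (lt_mem_nhds (a := (0 : ℝ)) ?_)
      simp [hβ1]
    refine Filter.mem_of_superset (c₀.isOpenMap_proj.image_mem_nhds hpos) ?_
    rintro _ ⟨z, hz, rfl⟩ c y hy a ha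
    obtain ⟨h, hh, hys, hyz⟩ := 𝓜.compatible c c.2 c₀ hc₀ y z hy
    rw [hT c y h hh hys, pullForm_apply, hyz, hT₀a]
    -- the summand of the neutral element is positive
    refine Finset.sum_pos' (fun γ _ => mul_nonneg (hβ0 _) real_inner_self_nonneg)
      ⟨1, Finset.mem_univ _, ?_⟩
    have h1 : D 1 z = ContinuousLinearMap.id ℝ _ := c₀.opensDeriv_one_smul z
    rw [h1, one_smul]
    refine mul_pos hz (real_inner_self_pos.2 ?_)
    rw [ContinuousLinearMap.id_apply]
    exact fun h0 => ha (differential_injective h hys (h0.trans (map_zero _).symm))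
  · intro c y hy
    by_cases hex : ∃ h : c.1.LocalDiffeo c₀, c.1.IsTransition c₀ h ∧ y ∈ h.source
    · obtain ⟨h, hh, hys⟩ := hex
      rw [hT c y h hh hys, hKT _ (by rw [hh _ hys]; exact hy)]
      ext; simp [pullForm_apply]
    · exact dif_neg hex

/-- Finitely many of the local forms add up to one that is positive on a given compact set. -/
theorem Premetric.exists_posAt_of_isCompact {C W : Set M} (hC : IsCompact C) (hW : IsOpen W)
    (hCW : C ⊆ W) : ∃ T : 𝓜.Premetric, (∀ q ∈ C, T.PosAt q) ∧ T.ZeroOff W := by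
  refine hC.induction_on (p := fun s => ∃ T : 𝓜.Premetric, (∀ q ∈ s, T.PosAt q) ∧ T.ZeroOff W)
    ⟨0, fun q hq => hq.elim, fun _ _ _ => rfl⟩
    (fun s t hst ⟨T, h1, h2⟩ => ⟨T, fun q hq => h1 q (hst hq), h2⟩) ?_ ?_
  · rintro s t ⟨S, hS, hS'⟩ ⟨T, hT, hT'⟩
    refine ⟨S + T, fun q hq c y hy a ha => ?_, fun c y hy => ?_⟩
    · rw [add_inner]
      rcases hq with hq | hq
      · exact add_pos_of_pos_of_nonneg (hS q hq c y hy a ha) (T.nonneg c y a)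
      · exact add_pos_of_nonneg_of_pos (S.nonneg c y a) (hT q hq c y hy a ha)
    · rw [add_inner, hS' c y hy, hT' c y hy]
      ext a b
      exact add_zero (0 : ℝ)
  · intro q hq
    obtain ⟨T, K, h1, -, h2, h3⟩ := exists_posAt_near (𝓜 := 𝓜) q (hW.mem_nhds (hCW hq))
    exact ⟨_, mem_nhdsWithin_of_mem_nhds h1, T, fun _ h => h,
      fun c y hy => h3 c y fun h => hy (h2 h)⟩

set_option synthInstance.maxHeartbeats 200000 in
/-- A locally finite sum of semidefinite forms, one of which is definite at each point, is a
metric. -/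
def Metric.ofPremetrics {ι : Type*} (T : ι → 𝓜.Premetric) (W : ι → Set M) (hW : LocallyFinite W)
    (hTW : ∀ i, (T i).ZeroOff (W i)) (hpos : ∀ q, ∃ i, (T i).PosAt q) : 𝓜.Metric :=
  have hlf : ∀ c : 𝓜.charts, LocallyFinite fun i => Function.support ((T i).inner c) := fun c =>
    (hW.preimage_continuous c.1.continuous_proj).subset fun i y hy => by
      by_contra h
      exact hy (hTW i c y h)
  have hfin : ∀ (c : 𝓜.charts) (y : c.1.U), (Function.support fun i => (T i).inner c y).Finite :=
    fun c y => (hlf c).point_finite y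
  have happ : ∀ (c : 𝓜.charts) (y : c.1.U) (a b), (∑ᶠ i, (T i).inner c y) a b =
      ∑ᶠ i, (T i).inner c y a b := fun c y a b => by
    have h1 : (Function.support fun i => (T i).inner c y a b) ⊆ ((hfin c y).toFinset : Set ι) := by
      intro i hi
      rw [Finite.coe_toFinset]
      exact fun h0 => hi (by simp only [h0]; rfl)
    rw [finsum_eq_sum_of_support_subset _ h1,
      finsum_eq_sum_of_support_subset (s := (hfin c y).toFinset) _ (by simp)]
    simp
  have hfin' : ∀ (c : 𝓜.charts) (y : c.1.U) (a b),
      (Function.support fun i => (T i).inner c y a b).Finite :=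
    fun c y a b => (hfin c y).subset fun i hi h0 => hi (by
      change (T i).inner c y = 0 at h0
      simp [h0])
  { inner := fun c y => ∑ᶠ i, (T i).inner c y
    contMDiff := fun c => contMDiff_finsum (fun i => (T i).contMDiff c) (hlf c)
    symm := fun c y a b => by
      rw [happ, happ]
      exact finsum_congr fun i => (T i).symm c y a b
    pos := fun c y a ha => by
      rw [happ]
      obtain ⟨i, hi⟩ := hpos (c.1.proj y)
      exact finsum_pos (fun j => (T j).nonneg c y a) ⟨i, hi c y rfl a ha⟩ (hfin' c y a a)
    isometric := fun c c' h hh y hy a b => by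
      rw [happ, happ]
      refine finsum_congr fun i => ?_
      rw [(T i).isometric c c' h hh y hy]
      rfl }

/-- A paracompact orbifold has a metric: take a locally finite covering by relatively compact open
sets `u i`, a shrinking `v i` of it, and add forms that are positive on the closure of `v i` and
vanish outside `u i`. -/
theorem nonempty_metric [ParacompactSpace M] (𝓜 : Orbifold m M) : Nonempty 𝓜.Metric := by
  have := 𝓜.t2
  -- an orbifold is locally compact
  have hex : ∀ q : M, ∃ W : Set M, IsOpen W ∧ q ∈ W ∧ ∃ K, IsCompact K ∧ W ⊆ K := by
    intro q
    obtain ⟨c, hc, y, rfl⟩ := 𝓜.cover q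
    have : LocallyCompactSpace c.U := c.U.isOpen.isOpenEmbedding_subtypeVal.locallyCompactSpace
    obtain ⟨K, hK, hyK⟩ := exists_compact_mem_nhds y
    exact ⟨interior (c.proj '' K), isOpen_interior,
      mem_interior_iff_mem_nhds.2 (c.isOpenMap_proj.image_mem_nhds hyK), c.proj '' K,
      hK.image c.continuous_proj, interior_subset⟩
  choose W hWo hqW K hK hWK using hex
  obtain ⟨u, huo, hu, hulf, huW⟩ := precise_refinement W hWo
    (eq_univ_of_forall fun q => mem_iUnion.2 ⟨q, hqW q⟩)
  obtain ⟨v, hv, -, hvu⟩ := exists_iUnion_eq_closure_subset huo (fun q => hulf.point_finite q) hu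
  have hcpt : ∀ q, IsCompact (closure (v q)) := fun q =>
    (hK q).of_isClosed_subset isClosed_closure ((hvu q).trans ((huW q).trans (hWK q)))
  choose T hT hTz using fun q => Premetric.exists_posAt_of_isCompact (𝓜 := 𝓜)
    (hcpt q) (huo q) (hvu q)
  refine ⟨Metric.ofPremetrics T u hulf hTz fun q => ?_⟩
  obtain ⟨i, hi⟩ := mem_iUnion.1 (hv ▸ mem_univ q : q ∈ ⋃ i, v i)
  exact ⟨i, hT i q (subset_closure hi)⟩

end Orbifold

/-! ### Manifolds glued from local homeomorphisms -/

section Gluing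

variable {X : Type*} [TopologicalSpace X] {ι : Type*} {N : ι → Type*} [∀ i, TopologicalSpace (N i)]
  {H F : Type*} [TopologicalSpace H] [NormedAddCommGroup F] [NormedSpace ℝ F]
  {J : ModelWithCorners ℝ F H} [J.Boundaryless] [∀ i, ChartedSpace H (N i)]
  [∀ i, IsManifold J ∞ (N i)] {n : ℕ}

/-- A space covered by local homeomorphisms from manifolds, whose transition maps are smooth, is a
manifold, and the local homeomorphisms are local diffeomorphisms. The maps `τ` need to be smooth at
the given point only, because the hypothesis is available at all points; the isomorphism `lam`
serves to have a Euclidean space as the model. -/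
theorem exists_isManifold_of_isLocalHomeomorph (lam : F ≃L[ℝ] EuclideanSpace ℝ (Fin n))
    (f : ∀ i, N i → X) (hf : ∀ i, IsLocalHomeomorph (f i)) (hcov : ∀ q, ∃ i a, f i a = q)
    (htr : ∀ i j a b, f i a = f j b → ∃ τ : N i → N j, ContMDiffAt J J ∞ τ a ∧ τ a = b ∧
      ∀ᶠ a' in 𝓝 a, f j (τ a') = f i a') :
    ∃ (_ : ChartedSpace (EuclideanSpace ℝ (Fin n)) X) (_ : IsManifold (𝓡 n) ∞ X),
      ∀ i, IsLocalDiffeomorph J (𝓡 n) ∞ (f i) := by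
  choose idx pt hpt using hcov
  choose e hes hef using fun q => hf (idx q) (pt q)
  have he : ∀ q a, e q a = f (idx q) a := fun q a => by rw [← hef q]
  -- the chart around `q` is the inverse of a local homeomorphism, followed by a chart of its domain
  let ch : X → OpenPartialHomeomorph X (EuclideanSpace ℝ (Fin n)) := fun q =>
    (e q).symm ≫ₕ (chartAt H (pt q) ≫ₕ
      (J.toHomeomorph.trans lam.toHomeomorph).toOpenPartialHomeomorph)
  have hch : ∀ q x, ch q x = lam (extChartAt J (pt q) ((e q).symm x)) := fun q x => rfl
  have hchs : ∀ q x, (ch q).symm x = f (idx q) ((extChartAt J (pt q)).symm (lam.symm x)) :=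
    fun q x => he q _
  have hsrc : ∀ q x, x ∈ (ch q).source ↔
      x ∈ (e q).target ∧ (e q).symm x ∈ (chartAt H (pt q)).source := by
    intro q x
    simp [ch]
  have hmem : ∀ q, q ∈ (ch q).source := by
    intro q
    rw [hsrc]
    have h1 : e q (pt q) = q := by rw [he, hpt]
    refine ⟨by simpa [h1] using (e q).map_source (hes q), ?_⟩
    have h2 : (e q).symm q = pt q := by simpa [h1] using (e q).left_inv (hes q)
    rw [h2]
    exact mem_chart_source H (pt q)
  let cs : ChartedSpace (EuclideanSpace ℝ (Fin n)) X :=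
    { atlas := range ch
      chartAt := ch
      mem_chart_source := hmem
      chart_mem_atlas := fun q => ⟨q, rfl⟩ }
  -- a local inverse of one of the maps, composed with another one, is a transition map
  have hinv : ∀ q i a, f i a ∈ (e q).target → ∃ τ : N i → N (idx q), ContMDiffAt J J ∞ τ a ∧
      ∀ᶠ a' in 𝓝 a, (e q).symm (f i a') = τ a' := by
    intro q i a ha
    obtain ⟨τ, h1, h2, h3⟩ := htr i (idx q) a ((e q).symm (f i a)) (by
      rw [← he, (e q).right_inv ha])
    refine ⟨τ, h1, ?_⟩
    have h4 : ∀ᶠ a' in 𝓝 a, τ a' ∈ (e q).source := by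
      refine h1.continuousAt.eventually ((e q).open_source.mem_nhds ?_)
      rw [h2]
      exact (e q).map_target ha
    filter_upwards [h3, h4] with a' h5 h6
    rw [← h5, ← he, (e q).left_inv h6]
  -- the maps `f i` are smooth in the charts
  have key : ∀ q i a, f i a ∈ (ch q).source →
      ContMDiffAt J 𝓘(ℝ, EuclideanSpace ℝ (Fin n)) ∞ (fun a' => ch q (f i a')) a := by
    intro q i a ha
    rw [hsrc] at ha
    obtain ⟨τ, h1, h3⟩ := hinv q i a ha.1
    have h4 : ContMDiffAt J 𝓘(ℝ, F) ∞ (fun a' => extChartAt J (pt q) (τ a')) a := by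
      refine ContMDiffAt.comp a (contMDiffAt_extChartAt' ?_) h1
      rw [← h3.self_of_nhds]
      exact ha.2
    have h5 : ContMDiffAt J 𝓘(ℝ, EuclideanSpace ℝ (Fin n)) ∞
        (fun a' => lam (extChartAt J (pt q) (τ a'))) a :=
      (lam.contDiff.contMDiff.contMDiffAt).comp a h4
    refine h5.congr_of_eventuallyEq ?_
    filter_upwards [h3] with a' h6
    rw [hch, h6]
  -- the inverse of a chart lifts to a smooth map to the domain of a local homeomorphism
  have hsymm : ∀ q, ∀ x ∈ (ch q).target, ContMDiffAt 𝓘(ℝ, EuclideanSpace ℝ (Fin n)) J ∞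
      (fun x => (extChartAt J (pt q)).symm (lam.symm x)) x := by
    intro q x hx
    have h1 : lam.symm x ∈ (extChartAt J (pt q)).target := by
      have h2 := (ch q).map_target hx
      rw [hsrc] at h2
      have h3 := (ch q).right_inv hx
      rw [hch] at h3
      rw [← h3, ContinuousLinearEquiv.symm_apply_apply]
      refine (extChartAt J (pt q)).map_source ?_
      rw [extChartAt_source]
      exact h2.2
    refine ContMDiffAt.comp x ?_ (lam.symm.contDiff.contMDiff.contMDiffAt)
    exact (contMDiffOn_extChartAt_symm (pt q)).contMDiffAt
      ((isOpen_extChartAt_target (pt q)).mem_nhds h1)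
  have : IsManifold (𝓡 n) ∞ X := by
    refine isManifold_of_contDiffOn _ _ _ ?_
    rintro _ _ ⟨q, rfl⟩ ⟨q', rfl⟩ x ⟨hx, -⟩
    have hx1 : x ∈ (ch q).target := hx.1
    have hx2 : (ch q).symm x ∈ (ch q').source := hx.2
    refine (contMDiffAt_iff_contDiffAt.1 ?_).contDiffWithinAt
    rw [hchs] at hx2
    refine (ContMDiffAt.comp x (key q' (idx q) _ hx2) (hsymm q x hx1)).congr_of_eventuallyEq ?_
    refine Eventually.of_forall fun y => ?_
    change ch q' ((ch q).symm y) = _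
    rw [hchs]
    rfl
  refine ⟨cs, inferInstance, fun i a => ?_⟩
  obtain ⟨e₀, ha₀, h₀⟩ := hf i a
  have h₀' : ∀ b, e₀ b = f i b := fun b => by rw [h₀]
  refine ⟨{ toPartialEquiv := e₀.toPartialEquiv
            open_source := e₀.open_source
            open_target := e₀.open_target
            contMDiffOn_toFun := ?_
            contMDiffOn_invFun := ?_ }, ha₀, fun b _ => (h₀' b).symm⟩
  · intro b hb
    have h1 : ContMDiffAt J (𝓡 n) ∞ (f i) b := by
      rw [contMDiffAt_iff_target]
      exact ⟨(hf i).continuous.continuousAt, key (f i b) i b (hmem _)⟩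
    exact (h1.congr_of_eventuallyEq (Eventually.of_forall h₀')).contMDiffWithinAt
  -- near `q` the inverse of `e₀` is a transition map, applied to the inverse of the chart around
  -- `q`
  · intro q hq
    have hq' : q ∈ (e q).target := ((hsrc q q).1 (hmem q)).1
    have h1 : f (idx q) (pt q) ∈ e₀.target := by rwa [hpt]
    obtain ⟨τ, h2, h3, h4⟩ := htr (idx q) i (pt q) (e₀.symm q) (by
      rw [← h₀', e₀.right_inv hq, hpt])
    have h5 : (e q).symm q = pt q := by
      have := (e q).left_inv (hes q)
      rwa [he, hpt] at this
    have h6 : ContMDiffAt (𝓡 n) J ∞ (e q).symm q := by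
      have h7 : ContMDiffAt (𝓡 n) 𝓘(ℝ, EuclideanSpace ℝ (Fin n)) ∞ (ch q) q :=
        contMDiffAt_extChartAt
      have h8 := ContMDiffAt.comp q (hsymm q (ch q q) ((ch q).map_source (hmem q))) h7
      refine h8.congr_of_eventuallyEq ?_
      filter_upwards [(ch q).open_source.mem_nhds (hmem q)] with y hy
      have hy' := ((hsrc q y).1 hy).2
      rw [Function.comp_apply, hch, ContinuousLinearEquiv.symm_apply_apply,
        (extChartAt J (pt q)).left_inv (by rwa [extChartAt_source])]
    rw [← h5] at h2
    refine ((ContMDiffAt.comp q h2 h6).congr_of_eventuallyEq ?_).contMDiffWithinAt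
    have h9 : ∀ᶠ y in 𝓝 q, τ ((e q).symm y) ∈ e₀.source := by
      refine (ContMDiffAt.comp q h2 h6).continuousAt.eventually (e₀.open_source.mem_nhds ?_)
      rw [Function.comp_apply, h5, h3]
      exact e₀.map_target hq
    have h10 : ∀ᶠ y in 𝓝 q, f i (τ ((e q).symm y)) = f (idx q) ((e q).symm y) := by
      rw [← h5] at h4
      exact h6.continuousAt.eventually h4
    filter_upwards [h9, h10, (e q).open_target.mem_nhds hq'] with y h11 h12 h13
    rw [← h₀', ← he, (e q).right_inv h13] at h12
    have h14 := e₀.left_inv h11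
    rwa [h12] at h14

end Gluing

/-! ### The orthogonal group as a Lie group -/

section OrthogonalGroup

open Matrix

variable {m : ℕ}

section MatrixSmooth

variable {F H X : Type*} [NormedAddCommGroup F] [NormedSpace ℝ F] [TopologicalSpace H]
  {I : ModelWithCorners ℝ F H} [TopologicalSpace X] [ChartedSpace H X]

variable (I) in
/-- A matrix-valued map is smooth at a point if its entries are. No norm on matrices is needed. -/
def MatSmoothAt (A : X → Matrix (Fin m) (Fin m) ℝ) (x : X) : Prop :=
  ∀ i j, ContMDiffAt I 𝓘(ℝ, ℝ) ∞ (fun z => A z i j) x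

theorem matSmoothAt_const (A : Matrix (Fin m) (Fin m) ℝ) (x : X) :
    MatSmoothAt I (fun _ : X => A) x := fun _ _ => contMDiffAt_const

theorem MatSmoothAt.add {A B : X → Matrix (Fin m) (Fin m) ℝ} {x : X}
    (hA : MatSmoothAt I A x) (hB : MatSmoothAt I B x) : MatSmoothAt I (fun z => A z + B z) x :=
  fun i j => (hA i j).add (hB i j)

theorem MatSmoothAt.sub {A B : X → Matrix (Fin m) (Fin m) ℝ} {x : X}
    (hA : MatSmoothAt I A x) (hB : MatSmoothAt I B x) : MatSmoothAt I (fun z => A z - B z) x :=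
  fun i j => (hA i j).sub (hB i j)

theorem MatSmoothAt.mul {A B : X → Matrix (Fin m) (Fin m) ℝ} {x : X}
    (hA : MatSmoothAt I A x) (hB : MatSmoothAt I B x) : MatSmoothAt I (fun z => A z * B z) x := by
  intro i j
  simp only [Matrix.mul_apply]
  exact ContMDiffAt.sum fun k _ => (hA i k).mul (hB k j)

theorem MatSmoothAt.det {A : X → Matrix (Fin m) (Fin m) ℝ} {x : X} (hA : MatSmoothAt I A x) :
    ContMDiffAt I 𝓘(ℝ, ℝ) ∞ (fun z => (A z).det) x := by
  simp only [Matrix.det_apply']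
  exact ContMDiffAt.sum fun σ _ => contMDiffAt_const.mul (contMDiffAt_finsetProd fun i _ => hA _ _)

/-- Cramer's rule: the entries of the inverse are quotients of determinants. -/
theorem MatSmoothAt.inv {A : X → Matrix (Fin m) (Fin m) ℝ} {x : X}
    (hA : MatSmoothAt I A x) (hx : (A x).det ≠ 0) : MatSmoothAt I (fun z => (A z)⁻¹) x := by
  intro i j
  have h1 : ∀ z, (A z)⁻¹ i j = (A z).det⁻¹ * ((A z).updateRow j (Pi.single i 1)).det := by
    intro z
    rw [Matrix.inv_def, Matrix.smul_apply, Matrix.adjugate_apply, Ring.inverse_eq_inv, smul_eq_mul]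
  simp only [h1]
  refine ContMDiffAt.mul ?_ (MatSmoothAt.det fun k l => ?_)
  · exact ((contDiffAt_inv ℝ hx).contMDiffAt).comp x hA.det
  · by_cases hk : k = j
    · subst hk
      simp only [Matrix.updateRow_self]
      exact contMDiffAt_const
    · simp only [Matrix.updateRow_ne hk]
      exact hA k l

theorem MatSmoothAt.congr {A B : X → Matrix (Fin m) (Fin m) ℝ} {x : X}
    (hA : MatSmoothAt I A x) (h : B =ᶠ[𝓝 x] A) : MatSmoothAt I B x := fun i j =>
  (hA i j).congr_of_eventuallyEq (by filter_upwards [h] with z hz; rw [hz])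

theorem MatSmoothAt.continuousAt {A : X → Matrix (Fin m) (Fin m) ℝ} {x : X}
    (hA : MatSmoothAt I A x) : ContinuousAt A x :=
  continuousAt_pi.2 fun i => continuousAt_pi.2 fun j => (hA i j).continuousAt

theorem MatSmoothAt.comp {F' H' Y : Type*} [NormedAddCommGroup F'] [NormedSpace ℝ F']
    [TopologicalSpace H'] {I' : ModelWithCorners ℝ F' H'} [TopologicalSpace Y] [ChartedSpace H' Y]
    {A : X → Matrix (Fin m) (Fin m) ℝ} {f : Y → X} {y : Y} (hA : MatSmoothAt I A (f y))
    (hf : ContMDiffAt I' I ∞ f y) : MatSmoothAt I' (fun z => A (f z)) y :=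
  fun i j => ContMDiffAt.comp y (hA i j) hf

end MatrixSmooth

/-- The Cayley transform `(1 - A) (1 + A)⁻¹`. It is an involution of the matrices with `1 + A`
invertible that exchanges skew-symmetric and orthogonal ones, which yields charts of `O(m)` with
explicit smooth inverses. -/
def cayley (A : Matrix (Fin m) (Fin m) ℝ) : Matrix (Fin m) (Fin m) ℝ := (1 - A) * (1 + A)⁻¹

theorem cayley_mul {A : Matrix (Fin m) (Fin m) ℝ} (hA : (1 + A).det ≠ 0) :
    cayley A * (1 + A) = 1 - A := by
  rw [cayley, Matrix.mul_assoc, Matrix.nonsing_inv_mul _ hA.isUnit, Matrix.mul_one]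

theorem mul_cayley {A : Matrix (Fin m) (Fin m) ℝ} (hA : (1 + A).det ≠ 0) :
    (1 + A) * cayley A = 1 - A := by
  have h : (1 + A) * (1 - A) = (1 - A) * (1 + A) := by noncomm_ring
  rw [cayley, ← Matrix.mul_assoc, h, Matrix.mul_assoc, Matrix.mul_nonsing_inv _ hA.isUnit,
    Matrix.mul_one]

theorem one_add_cayley_mul {A : Matrix (Fin m) (Fin m) ℝ} (hA : (1 + A).det ≠ 0) :
    (1 + cayley A) * (1 + A) = (2 : ℝ) • 1 := by
  rw [Matrix.add_mul, cayley_mul hA, two_smul]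
  noncomm_ring

theorem det_one_add_cayley {A : Matrix (Fin m) (Fin m) ℝ} (hA : (1 + A).det ≠ 0) :
    (1 + cayley A).det ≠ 0 := by
  intro h
  have h1 := congrArg Matrix.det (one_add_cayley_mul hA)
  rw [Matrix.det_mul, h, zero_mul, Matrix.det_smul, Matrix.det_one, mul_one] at h1
  exact pow_ne_zero _ two_ne_zero h1.symm

/-- The Cayley transform is an involution where it is defined. -/
theorem cayley_cayley {A : Matrix (Fin m) (Fin m) ℝ} (hA : (1 + A).det ≠ 0) :
    cayley (cayley A) = A := by
  have h1 := det_one_add_cayley hA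
  have h2 := cayley_mul h1
  have h3 : A * (1 + cayley A) = 1 - cayley A := by
    have h4 := mul_cayley hA
    rw [Matrix.add_mul, Matrix.one_mul] at h4
    rw [Matrix.mul_add, Matrix.mul_one, eq_sub_of_add_eq' h4]
    noncomm_ring
  have h5 := congrArg (· * (1 + cayley A)⁻¹) (h2.trans h3.symm)
  simpa [Matrix.mul_assoc, Matrix.mul_nonsing_inv _ h1.isUnit] using h5

/-- If `A` is skew-symmetric and `v + A v = 0`, then `⟨v, v⟩ = -⟨v, A v⟩ = 0`. -/
theorem det_one_add_of_skew {A : Matrix (Fin m) (Fin m) ℝ} (hA : Aᵀ = -A) : (1 + A).det ≠ 0 := by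
  intro h
  obtain ⟨v, hv, hv0⟩ := Matrix.exists_mulVec_eq_zero_iff.2 h
  have h1 : v ⬝ᵥ (A *ᵥ v) = 0 := by
    have h2 : v ⬝ᵥ (A *ᵥ v) = -(v ⬝ᵥ (A *ᵥ v)) := by
      conv_lhs => rw [Matrix.dotProduct_mulVec, ← Matrix.mulVec_transpose, hA, Matrix.neg_mulVec,
        neg_dotProduct, dotProduct_comm]
    linarith
  rw [Matrix.add_mulVec, Matrix.one_mulVec] at hv0
  have h3 : v ⬝ᵥ (v + A *ᵥ v) = 0 := by rw [hv0, dotProduct_zero]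
  rw [dotProduct_add, h1, add_zero] at h3
  exact hv (dotProduct_self_eq_zero.1 h3)

theorem cayley_mem_orthogonalGroup {A : Matrix (Fin m) (Fin m) ℝ} (hA : Aᵀ = -A) :
    cayley A ∈ Matrix.orthogonalGroup (Fin m) ℝ := by
  have hd := det_one_add_of_skew hA
  rw [Matrix.mem_orthogonalGroup_iff']
  have h1 := cayley_mul hd
  have h2 := congrArg Matrix.transpose h1
  rw [Matrix.transpose_mul, Matrix.transpose_add, Matrix.transpose_sub, Matrix.transpose_one, hA,
    ← sub_eq_add_neg, sub_neg_eq_add] at h2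
  have hd' : (1 - A).det ≠ 0 := by
    have h3 : 1 - A = (1 + A)ᵀ := by
      rw [Matrix.transpose_add, Matrix.transpose_one, hA, sub_eq_add_neg]
    rw [h3, Matrix.det_transpose]
    exact hd
  have h4 : (1 - A) * ((cayley A)ᵀ * cayley A) = (1 - A) * 1 := by
    rw [← Matrix.mul_assoc, h2, mul_cayley hd, Matrix.mul_one]
  have h5 := congrArg ((1 - A)⁻¹ * ·) h4
  simpa [← Matrix.mul_assoc, Matrix.nonsing_inv_mul _ hd'.isUnit] using h5

theorem cayley_skew {k : Matrix (Fin m) (Fin m) ℝ} (hk : k ∈ Matrix.orthogonalGroup (Fin m) ℝ)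
    (hd : (1 + k).det ≠ 0) : (cayley k)ᵀ = -cayley k := by
  have hk' : k * kᵀ = 1 := (Matrix.mem_orthogonalGroup_iff (Fin m) ℝ).1 hk
  have h1 := congrArg (fun B => k * Matrix.transpose B) (cayley_mul hd)
  simp only [Matrix.transpose_mul, Matrix.transpose_add, Matrix.transpose_sub, Matrix.transpose_one,
    ← Matrix.mul_assoc, Matrix.mul_add, Matrix.mul_sub, Matrix.mul_one, hk'] at h1
  have h2 : (1 + k) * (cayley k)ᵀ = (1 + k) * -cayley k := by
    rw [Matrix.mul_neg, mul_cayley hd, add_comm, Matrix.add_mul, h1, neg_sub]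
  have h3 := congrArg ((1 + k)⁻¹ * ·) h2
  simp only [← Matrix.mul_assoc, Matrix.nonsing_inv_mul _ hd.isUnit, Matrix.one_mul] at h3
  exact h3

theorem MatSmoothAt.cayley_comp {F H X : Type*} [NormedAddCommGroup F] [NormedSpace ℝ F]
    [TopologicalSpace H] {I : ModelWithCorners ℝ F H} [TopologicalSpace X] [ChartedSpace H X]
    {A : X → Matrix (Fin m) (Fin m) ℝ} {x : X}
    (hA : MatSmoothAt I A x) (hx : (1 + A x).det ≠ 0) :
    MatSmoothAt I (fun z => cayley (A z)) x :=
  ((matSmoothAt_const 1 x).sub hA).mul (((matSmoothAt_const 1 x).add hA).inv hx)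

variable (m) in
/-- The space of skew-symmetric matrices, as a subspace of the normed space of functions of two
indices. -/
def skewMatrices : Submodule ℝ (Fin m → Fin m → ℝ) where
  carrier := {A | (Matrix.of A)ᵀ = -Matrix.of A}
  add_mem' {A B} hA hB := by
    simp only [mem_ofPred_eq] at *
    rw [← Matrix.of_add_of, Matrix.transpose_add, hA, hB, neg_add]
  zero_mem' := by simp
  smul_mem' r A hA := by
    simp only [mem_ofPred_eq] at *
    rw [← Matrix.smul_of, Matrix.transpose_smul, hA, smul_neg]

/-- The matrix of an element of `skewMatrices m`. -/
def skewMat (A : skewMatrices m) : Matrix (Fin m) (Fin m) ℝ := Matrix.of A.1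

theorem transpose_skewMat (A : skewMatrices m) : (skewMat A)ᵀ = -skewMat A := A.2

theorem det_one_add_skewMat (A : skewMatrices m) : (1 + (skewMat A)).det ≠ 0 :=
  det_one_add_of_skew (transpose_skewMat A)

theorem skewMat_injective {A B : skewMatrices m} (h : skewMat A = skewMat B) : A = B :=
  Subtype.ext (Matrix.of.injective h)

/-- The translate by `g` of the Cayley parametrization of the orthogonal group near `1`. -/
def cayleyParam (g : orthogonalGroup (Fin m) ℝ) (A : skewMatrices m) : orthogonalGroup (Fin m) ℝ :=
  g * ⟨cayley (skewMat A), cayley_mem_orthogonalGroup (transpose_skewMat A)⟩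

/-- The inverse of `cayleyParam g`; it is meaningful on `{k | det (1 + g⁻¹ k) ≠ 0}`. -/
def cayleyParamInv (g k : orthogonalGroup (Fin m) ℝ) : skewMatrices m := by
  classical exact if h : (1 + (g⁻¹ * k : orthogonalGroup (Fin m) ℝ).1).det ≠ 0 then
    ⟨cayley (g⁻¹ * k : orthogonalGroup (Fin m) ℝ).1, cayley_skew (Subtype.prop _) h⟩ else 0

theorem cayleyParamInv_mat {g k : orthogonalGroup (Fin m) ℝ}
    (h : (1 + (g⁻¹ * k : orthogonalGroup (Fin m) ℝ).1).det ≠ 0) :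
    skewMat (cayleyParamInv g k) = cayley (g⁻¹ * k : orthogonalGroup (Fin m) ℝ).1 := by
  rw [cayleyParamInv, dif_pos h]
  rfl

theorem inv_mul_cayleyParam (g : orthogonalGroup (Fin m) ℝ) (A : skewMatrices m) :
    (g⁻¹ * cayleyParam g A : orthogonalGroup (Fin m) ℝ).1 = cayley (skewMat A) := by
  rw [cayleyParam, inv_mul_cancel_left]

theorem cayleyParam_zero (g : orthogonalGroup (Fin m) ℝ) : cayleyParam g 0 = g := by
  have h : skewMat (0 : skewMatrices m) = 0 := rfl
  apply Subtype.ext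
  simp [cayleyParam, cayley, h]

theorem cayleyParamInv_cayleyParam (g : orthogonalGroup (Fin m) ℝ) (A : skewMatrices m) :
    cayleyParamInv g (cayleyParam g A) = A := by
  apply skewMat_injective
  rw [cayleyParamInv_mat] <;> rw [inv_mul_cayleyParam]
  · exact cayley_cayley (det_one_add_skewMat A)
  · exact det_one_add_cayley (det_one_add_skewMat A)

theorem cayleyParam_cayleyParamInv {g k : orthogonalGroup (Fin m) ℝ}
    (h : (1 + (g⁻¹ * k : orthogonalGroup (Fin m) ℝ).1).det ≠ 0) :
    cayleyParam g (cayleyParamInv g k) = k := by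
  rw [cayleyParam, ← mul_right_inj g⁻¹, inv_mul_cancel_left]
  apply Subtype.ext
  change cayley (skewMat (cayleyParamInv g k)) = _
  rw [cayleyParamInv_mat h, cayley_cayley h]

theorem MatSmoothAt.skew {F H X : Type*} [NormedAddCommGroup F] [NormedSpace ℝ F]
    [TopologicalSpace H] {I : ModelWithCorners ℝ F H} [TopologicalSpace X] [ChartedSpace H X]
    {f : X → skewMatrices m} {x : X} (h : MatSmoothAt I (fun z => skewMat (f z)) x) :
    ContMDiffAt I 𝓘(ℝ, skewMatrices m) ∞ f x := by
  -- compose with a linear retraction of the space of matrices to the subspace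
  obtain ⟨P, hP⟩ := (skewMatrices m).subtype.exists_leftInverse_of_injective
    (LinearMap.ker_eq_bot.2 Subtype.val_injective)
  have h1 : f = fun z => LinearMap.toContinuousLinearMap P (f z).1 :=
    funext fun z => (LinearMap.congr_fun hP (f z)).symm
  rw [h1]
  have h2 : ContMDiffAt I 𝓘(ℝ, Fin m → Fin m → ℝ) ∞ (fun z => (f z).1) x :=
    contMDiffAt_pi_space.2 fun i => contMDiffAt_pi_space.2 fun j => h i j
  exact (LinearMap.toContinuousLinearMap P).contDiff.contMDiff.contMDiffAt.comp x h2

theorem matSmoothAt_mat (A : skewMatrices m) :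
    MatSmoothAt 𝓘(ℝ, skewMatrices m) (fun A : skewMatrices m => (skewMat A)) A := fun i j =>
  contMDiffAt_pi_space.1 (contMDiffAt_pi_space.1
    ((skewMatrices m).subtypeL.contDiff.contMDiff.contMDiffAt (x := A)) i) j

theorem matSmoothAt_cayleyParam (g : orthogonalGroup (Fin m) ℝ) (A : skewMatrices m) :
    MatSmoothAt 𝓘(ℝ, skewMatrices m) (fun A => (cayleyParam g A).1) A :=
  (matSmoothAt_const g.1 A).mul ((matSmoothAt_mat A).cayley_comp (det_one_add_skewMat A))

theorem isOpen_cayleyParam_target (g : orthogonalGroup (Fin m) ℝ) :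
    IsOpen {k | (1 + (g⁻¹ * k : orthogonalGroup (Fin m) ℝ).1).det ≠ 0} := by
  refine isOpen_ne_fun (Continuous.matrix_det ?_) continuous_const
  exact continuous_const.add (continuous_subtype_val.comp (continuous_const.mul continuous_id))

theorem isLocalHomeomorph_cayleyParam (g : orthogonalGroup (Fin m) ℝ) :
    IsLocalHomeomorph (cayleyParam g) := by
  intro A
  refine ⟨{ toFun := cayleyParam g
            invFun := cayleyParamInv g
            source := univ
            target := {k | (1 + (g⁻¹ * k : orthogonalGroup (Fin m) ℝ).1).det ≠ 0}
            map_source' := fun A _ => ?_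
            map_target' := fun _ _ => mem_univ _
            left_inv' := fun A _ => cayleyParamInv_cayleyParam g A
            right_inv' := fun k hk => cayleyParam_cayleyParamInv hk
            open_source := isOpen_univ
            open_target := isOpen_cayleyParam_target g
            continuousOn_toFun := ?_
            continuousOn_invFun := ?_ }, mem_univ A, rfl⟩
  · rw [mem_ofPred_eq, inv_mul_cayleyParam]
    exact det_one_add_cayley (det_one_add_skewMat A)
  · exact (continuous_induced_rng.2
      (continuous_iff_continuousAt.2 fun A =>
        (matSmoothAt_cayleyParam g A).continuousAt)).continuousOn
  · rw [continuousOn_iff_continuous_domRestrict, continuous_induced_rng]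
    refine continuous_iff_continuousAt.2 fun k => ?_
    -- the Cayley transform is continuous at `g⁻¹ k`, where the relevant determinant does not vanish
    let B₀ : Fin m → Fin m → ℝ := (g⁻¹ * k : orthogonalGroup (Fin m) ℝ).1
    have h1 : ∀ i j, ContMDiffAt 𝓘(ℝ, Fin m → Fin m → ℝ) 𝓘(ℝ, ℝ) ∞
        (fun B : Fin m → Fin m → ℝ => B i j) B₀ := fun i j =>
      (contDiff_apply_apply ℝ ℝ i j).contMDiff B₀
    have h2 : MatSmoothAt 𝓘(ℝ, Fin m → Fin m → ℝ)
        (fun B : Fin m → Fin m → ℝ => cayley (Matrix.of B)) B₀ :=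
      MatSmoothAt.cayley_comp (A := fun B : Fin m → Fin m → ℝ => Matrix.of B) h1 k.2
    have h3 : Continuous fun k : {k | (1 + (g⁻¹ * k : orthogonalGroup (Fin m) ℝ).1).det ≠ 0} =>
        (g⁻¹ * k : orthogonalGroup (Fin m) ℝ).1 :=
      continuous_subtype_val.comp (continuous_const.mul continuous_subtype_val)
    have h5 : ContinuousAt (fun B : Fin m → Fin m → ℝ => cayley (Matrix.of B)) B₀ := h2.continuousAt
    have h4 : ContinuousAt
        (fun k : {k | (1 + (g⁻¹ * k : orthogonalGroup (Fin m) ℝ).1).det ≠ 0} =>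
          cayley (g⁻¹ * k : orthogonalGroup (Fin m) ℝ).1) k :=
      Tendsto.comp h5 h3.continuousAt
    refine h4.congr (Eventually.of_forall fun k => ?_)
    exact (cayleyParamInv_mat k.2).symm

theorem MatSmoothAt.cayleyParamInv {F H X : Type*} [NormedAddCommGroup F] [NormedSpace ℝ F]
    [TopologicalSpace H] {I : ModelWithCorners ℝ F H} [TopologicalSpace X] [ChartedSpace H X]
    {g : orthogonalGroup (Fin m) ℝ} {f : X → orthogonalGroup (Fin m) ℝ} {x : X}
    (hf : MatSmoothAt I (fun z => (f z).1) x)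
    (hd : (1 + (g⁻¹ * f x : orthogonalGroup (Fin m) ℝ).1).det ≠ 0) :
    ContMDiffAt I 𝓘(ℝ, skewMatrices m) ∞ (fun z => _root_.cayleyParamInv g (f z)) x ∧
      ∀ᶠ z in 𝓝 x, cayleyParam g (_root_.cayleyParamInv g (f z)) = f z := by
  have h1 : MatSmoothAt I (fun z => (g⁻¹ * f z : orthogonalGroup (Fin m) ℝ).1) x :=
    (matSmoothAt_const (g⁻¹).1 x).mul hf
  have hev : ∀ᶠ z in 𝓝 x, (1 + (g⁻¹ * f z : orthogonalGroup (Fin m) ℝ).1).det ≠ 0 := by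
    have h2 : ContinuousAt f x :=
      Topology.IsInducing.subtypeVal.continuousAt_iff.2 hf.continuousAt
    exact h2.eventually ((isOpen_cayleyParam_target g).mem_nhds hd)
  constructor
  · refine MatSmoothAt.skew ((h1.cayley_comp hd).congr ?_)
    filter_upwards [hev] with z hz using cayleyParamInv_mat hz
  · filter_upwards [hev] with z hz using cayleyParam_cayleyParamInv hz

theorem det_one_add_one : (1 + (1 : Matrix (Fin m) (Fin m) ℝ)).det ≠ 0 := by
  rw [← two_smul ℝ, Matrix.det_smul, Matrix.det_one, mul_one]
  exact pow_ne_zero _ two_ne_zero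

variable (m) in
/-- The dimension of the orthogonal group. -/
def orthDim : ℕ := Module.finrank ℝ (skewMatrices m)

/-- The translates of the Cayley parametrization are local homeomorphisms with smooth transition
maps, so they make the orthogonal group a manifold. -/
theorem exists_isManifold_orthogonalGroup :
    ∃ (_ : ChartedSpace (EuclideanSpace ℝ (Fin (orthDim m))) (orthogonalGroup (Fin m) ℝ))
      (_ : IsManifold (𝓡 (orthDim m)) ∞ (orthogonalGroup (Fin m) ℝ)),
      ∀ g : orthogonalGroup (Fin m) ℝ,
        IsLocalDiffeomorph 𝓘(ℝ, skewMatrices m) (𝓡 (orthDim m)) ∞ (cayleyParam g) := by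
  refine exists_isManifold_of_isLocalHomeomorph (N := fun _ => skewMatrices m)
    (toEuclidean (E := skewMatrices m)) cayleyParam isLocalHomeomorph_cayleyParam (fun k => ?_)
    fun g h A B hAB => ?_
  · exact ⟨k, 0, cayleyParam_zero k⟩
  · have hd : (1 + (h⁻¹ * cayleyParam g A : orthogonalGroup (Fin m) ℝ).1).det ≠ 0 := by
      rw [hAB, inv_mul_cayleyParam]
      exact det_one_add_cayley (det_one_add_skewMat B)
    obtain ⟨h1, h2⟩ := MatSmoothAt.cayleyParamInv (matSmoothAt_cayleyParam g A) hd
    exact ⟨fun A => cayleyParamInv h (cayleyParam g A), h1,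
      by simp only [hAB, cayleyParamInv_cayleyParam], h2⟩

instance : ChartedSpace (EuclideanSpace ℝ (Fin (orthDim m))) (orthogonalGroup (Fin m) ℝ) :=
  exists_isManifold_orthogonalGroup.choose

instance : IsManifold (𝓡 (orthDim m)) ∞ (orthogonalGroup (Fin m) ℝ) :=
  exists_isManifold_orthogonalGroup.choose_spec.choose

theorem isLocalDiffeomorph_cayleyParam (g : orthogonalGroup (Fin m) ℝ) :
    IsLocalDiffeomorph 𝓘(ℝ, skewMatrices m) (𝓡 (orthDim m)) ∞ (cayleyParam g) :=
  exists_isManifold_orthogonalGroup.choose_spec.choose_spec g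

theorem matSmoothAt_orthogonalGroup_coe (g : orthogonalGroup (Fin m) ℝ) :
    MatSmoothAt (𝓡 (orthDim m)) (fun g : orthogonalGroup (Fin m) ℝ => g.1) g := by
  obtain ⟨Φ, hΦ, hΦe⟩ := isLocalDiffeomorph_cayleyParam g 0
  have hg : g ∈ Φ.target := by
    rw [← cayleyParam_zero g, hΦe hΦ]
    exact Φ.apply_mem_target hΦ
  refine ((matSmoothAt_cayleyParam g (Φ.symm g)).comp (Φ.contMDiffAt_symm hg)).congr ?_
  filter_upwards [Φ.open_target.mem_nhds hg] with k hk
  rw [hΦe (Φ.symm_apply_mem_source hk), Φ.apply_symm_apply hk]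

section

variable {F H X : Type*} [NormedAddCommGroup F] [NormedSpace ℝ F] [TopologicalSpace H]
  {I : ModelWithCorners ℝ F H} [TopologicalSpace X] [ChartedSpace H X]

/-- A map to the orthogonal group is smooth if and only if all matrix entries are. -/
theorem contMDiffAt_orthogonalGroup_iff {f : X → orthogonalGroup (Fin m) ℝ} {x : X} :
    ContMDiffAt I (𝓡 (orthDim m)) ∞ f x ↔ MatSmoothAt I (fun z => (f z).1) x := by
  refine ⟨fun h => (matSmoothAt_orthogonalGroup_coe (f x)).comp h, fun hf => ?_⟩
  have hd : (1 + ((f x)⁻¹ * f x : orthogonalGroup (Fin m) ℝ).1).det ≠ 0 := by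
    rw [inv_mul_cancel]
    exact det_one_add_one
  obtain ⟨h1, h2⟩ := hf.cayleyParamInv hd
  refine (((isLocalDiffeomorph_cayleyParam (f x)).contMDiff.contMDiffAt).comp x
    h1).congr_of_eventuallyEq ?_
  filter_upwards [h2] with z hz using hz.symm

end

instance : LieGroup (𝓡 (orthDim m)) ∞ (orthogonalGroup (Fin m) ℝ) where
  contMDiff_mul := fun p => contMDiffAt_orthogonalGroup_iff.2
    (((matSmoothAt_orthogonalGroup_coe p.1).comp contMDiffAt_fst).mul
      ((matSmoothAt_orthogonalGroup_coe p.2).comp contMDiffAt_snd))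
  contMDiff_inv := fun p => contMDiffAt_orthogonalGroup_iff.2
    fun i j => matSmoothAt_orthogonalGroup_coe p j i

instance : CompactSpace (orthogonalGroup (Fin m) ℝ) := by
  refine isCompact_iff_compactSpace.1 ?_
  have h1 : IsCompact (Set.univ.pi fun _ : Fin m => Set.univ.pi fun _ : Fin m => Icc (-1 : ℝ) 1) :=
    isCompact_univ_pi fun _ => isCompact_univ_pi fun _ => isCompact_Icc
  refine h1.of_isClosed_subset ?_ fun A hA i _ j _ => ?_
  · have h2 : {A : Matrix (Fin m) (Fin m) ℝ | A * Aᵀ = 1} = orthogonalGroup (Fin m) ℝ := by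
      ext A
      exact (Matrix.mem_orthogonalGroup_iff (Fin m) ℝ).symm
    rw [← h2]
    exact isClosed_eq (continuous_id.matrix_mul continuous_id.matrix_transpose) continuous_const
  · exact abs_le.1 (entry_norm_bound_of_unitary hA i j)

end OrthogonalGroup

/-! ### Orthonormal frames -/

section LinearAlgebra

variable {m : ℕ} {b : EuclideanSpace ℝ (Fin m) →L[ℝ] EuclideanSpace ℝ (Fin m) →L[ℝ] ℝ}
  {X X' : Fin m → EuclideanSpace ℝ (Fin m)}

/-- This holds for any bilinear form; definiteness is not needed. -/
theorem linearIndependent_of_orthonormal_form {n : ℕ} {X : Fin n → EuclideanSpace ℝ (Fin m)}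
    (hX : ∀ i j, b (X i) (X j) = if i = j then 1 else 0) : LinearIndependent ℝ X := by
  rw [Fintype.linearIndependent_iff]
  intro a ha i
  have h1 := congrArg (fun v => b v (X i)) ha
  simpa [hX] using h1

theorem sum_form_smul_eq (hX : ∀ i j, b (X i) (X j) = if i = j then 1 else 0)
    (v : EuclideanSpace ℝ (Fin m)) : ∑ i, b v (X i) • X i = v := by
  let B := basisOfLinearIndependentOfCardEqFinrank' X (linearIndependent_of_orthonormal_form hX)
    (by simp)
  have hB : ∀ i, B i = X i := fun i => by simp [B]
  have h1 := B.sum_repr v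
  simp only [hB] at h1
  have h2 : ∀ j, b v (X j) = B.repr v j := fun j => by
    conv_lhs => rw [← h1]
    simp [hX]
  simpa only [h2] using h1

theorem eq_of_eq_on_frame (hX : ∀ i j, b (X i) (X j) = if i = j then 1 else 0)
    {A A' : EuclideanSpace ℝ (Fin m) →L[ℝ] EuclideanSpace ℝ (Fin m)}
    (h : ∀ i, A (X i) = A' (X i)) : A = A' := by
  ext1 v
  rw [← sum_form_smul_eq hX v]
  simp [h]

/-- The matrix that expresses an orthonormal frame in terms of another one. -/
def frameMatrix (hX : ∀ i j, b (X i) (X j) = if i = j then 1 else 0)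
    (hX' : ∀ i j, b (X' i) (X' j) = if i = j then 1 else 0) : Matrix.orthogonalGroup (Fin m) ℝ :=
  ⟨Matrix.of fun i j => b (X i) (X' j), by
    rw [Matrix.mem_orthogonalGroup_iff]
    ext i j
    rw [Matrix.mul_apply, Matrix.one_apply, ← hX i j]
    -- expand the vector in the frame `X'`
    conv_rhs => rw [← sum_form_smul_eq hX' (X j)]
    simp [mul_comm]⟩

theorem sum_frameMatrix_smul
    (hX : ∀ i j, b (X i) (X j) = if i = j then 1 else 0)
    (hX' : ∀ i j, b (X' i) (X' j) = if i = j then 1 else 0) (i : Fin m) :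
    ∑ j, (frameMatrix hX hX').1 i j • X' j = X i :=
  sum_form_smul_eq hX' (X i)

end LinearAlgebra

namespace Orbifold

open OrbifoldChart

variable {m : ℕ} {M : Type u} [TopologicalSpace M] {𝓜 : Orbifold m M} {μ : 𝓜.Metric}

namespace ChartFrame

variable {c c' c'' : 𝓜.charts}

theorem ext' {z z' : ChartFrame μ c} (h1 : z.1.1 = z'.1.1) (h2 : ∀ i, z.1.2 i = z'.1.2 i) :
    z = z' :=
  Subtype.ext (Prod.ext h1 (funext h2))

theorem continuous_val : Continuous (fun z : ChartFrame μ c => z.1) := continuous_subtype_val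

theorem continuous_point : Continuous (fun z : ChartFrame μ c => z.1.1) :=
  continuous_fst.comp continuous_val

theorem continuous_vector (i : Fin m) : Continuous (fun z : ChartFrame μ c => z.1.2 i) :=
  (continuous_apply i).comp (continuous_snd.comp continuous_val)

/-- The image of a frame under the differential of a change of charts. -/
def push (h : c.1.LocalDiffeo c'.1) (hh : c.1.IsTransition c'.1 h) (z : ChartFrame μ c)
    (hz : z.1.1 ∈ h.source) : ChartFrame μ c' :=
  ⟨(h z.1.1, fun i => differential h z.1.1 (z.1.2 i)), fun i j => by
    rw [μ.isometric c c' h hh _ hz, z.2]⟩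

/-- The orthogonal group acts freely on the frames of a chart. (It need not act freely on the frame
bundle.) -/
theorem rotate_injective (z : ChartFrame μ c) :
    Function.Injective fun g : Matrix.orthogonalGroup (Fin m) ℝ => z.rotate g := by
  intro g g' h
  apply Subtype.ext
  ext i j
  have h1 := congrArg (fun w : ChartFrame μ c => μ.inner c z.1.1 (w.1.2 i) (z.1.2 j)) h
  simpa [rotate, z.2] using h1

theorem rotate_push (h : c.1.LocalDiffeo c'.1) (hh : c.1.IsTransition c'.1 h) (z : ChartFrame μ c)
    (hz : z.1.1 ∈ h.source) (g : Matrix.orthogonalGroup (Fin m) ℝ) :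
    (z.rotate g).push h hh hz = (z.push h hh hz).rotate g :=
  ext' rfl fun i => by simp [push, rotate]

end ChartFrame

theorem frameRel_iff {c c' : 𝓜.charts} {z : ChartFrame μ c} {z' : ChartFrame μ c'} :
    FrameRel μ ⟨c, z⟩ ⟨c', z'⟩ ↔ ∃ (h : c.1.LocalDiffeo c'.1) (hh : c.1.IsTransition c'.1 h)
      (hz : z.1.1 ∈ h.source), z.push h hh hz = z' := by
  constructor
  · rintro ⟨h, hh, hz, h1, h2⟩
    exact ⟨h, hh, hz, ChartFrame.ext' h1 h2⟩
  · rintro ⟨h, hh, hz, rfl⟩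
    exact ⟨h, hh, hz, rfl, fun _ => rfl⟩

theorem frameRel_equivalence : Equivalence (FrameRel μ) where
  refl a := ⟨reflDiffeo a.1.1, isTransition_refl, mem_univ _, rfl, fun i => by
    change opensDeriv (fun z => z) _ _ = _
    rw [opensDeriv_id]
    rfl⟩
  symm := by
    rintro ⟨c, z⟩ ⟨c', z'⟩ ⟨h, hh, hz, h1, h2⟩
    dsimp only at *
    refine ⟨h.symm, isTransition_symm hh, ?_, ?_, fun i => ?_⟩ <;> dsimp only
    · rw [← h1]
      exact h.apply_mem_target hz
    · rw [← h1, h.symm_apply_apply hz]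
    · rw [← h1, ← h2]
      exact congrArg (fun A => A (z.1.2 i)) (symm_differential_comp h hz)
  trans := by
    rintro ⟨c, z⟩ ⟨c', z'⟩ ⟨c'', z''⟩ ⟨h, hh, hz, h1, h2⟩ ⟨k, hk, hz', k1, k2⟩
    dsimp only at *
    rw [← h1] at hz' k1 k2
    refine ⟨h.trans k, hh.trans hk, ⟨hz, hz'⟩, k1, fun i => ?_⟩
    dsimp only
    rw [differential_trans h k hz hz', ← k2, ← h2]
    rfl

namespace FrameBundle

variable {c c' : 𝓜.charts}

theorem mk_eq_iff {z : ChartFrame μ c} {z' : ChartFrame μ c'} :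
    mk c z = mk c' z' ↔ FrameRel μ ⟨c, z⟩ ⟨c', z'⟩ := by
  refine Iff.trans (Quot.eq (r := FrameRel μ)) ?_
  rw [frameRel_equivalence.eqvGen_iff]

theorem mk_push (h : c.1.LocalDiffeo c'.1) (hh : c.1.IsTransition c'.1 h) (z : ChartFrame μ c)
    (hz : z.1.1 ∈ h.source) : mk c' (z.push h hh hz) = mk c z :=
  (mk_eq_iff.2 (frameRel_iff.2 ⟨h, hh, hz, rfl⟩)).symm

theorem smul_mk (g : Matrix.orthogonalGroup (Fin m) ℝ) (z : ChartFrame μ c) :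
    g • mk c z = mk c (z.rotate g) := rfl

theorem base_smul (g : Matrix.orthogonalGroup (Fin m) ℝ) (q : FrameBundle μ) :
    base (g • q) = base q := by
  obtain ⟨a, rfl⟩ := Quot.exists_rep q
  rfl

theorem continuous_mk (c : 𝓜.charts) : Continuous (mk (μ := μ) c) :=
  continuous_quot_mk.comp continuous_sigmaMk

theorem continuous_base : Continuous (base (μ := μ)) :=
  continuous_quot_lift _ (continuous_sigma fun c =>
    c.1.continuous_proj.comp ChartFrame.continuous_point)

theorem exists_mk (q : FrameBundle μ) : ∃ (c : 𝓜.charts) (z : ChartFrame μ c), mk c z = q := by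
  obtain ⟨⟨c, z⟩, rfl⟩ := Quot.exists_rep q
  exact ⟨c, z, rfl⟩

/-- Over a point of a chart, every element of the frame bundle is a frame of that chart. -/
theorem exists_mk_of_base_eq {q : FrameBundle μ} {y : c.1.U} (hq : base q = c.1.proj y) :
    ∃ z : ChartFrame μ c, z.1.1 = y ∧ mk c z = q := by
  obtain ⟨c₀, z₀, rfl⟩ := exists_mk q
  obtain ⟨h, hh, hz, hy⟩ := 𝓜.compatible c₀ c₀.2 c c.2 z₀.1.1 y hq
  exact ⟨z₀.push h hh hz, hy, mk_push h hh z₀ hz⟩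

/-- The differential of a change of charts is continuous on frames. The map is written on all frames
of the chart, but it is meaningful only over the source of `h`. -/
theorem continuousAt_push_val (h : c.1.LocalDiffeo c'.1) {z : ChartFrame μ c}
    (hz : z.1.1 ∈ h.source) :
    ContinuousAt (fun w : ChartFrame μ c =>
      (h w.1.1, fun i => differential h w.1.1 (w.1.2 i))) z := by
  have h1 : ContinuousAt h z.1.1 := (h.contMDiffAt hz).continuousAt
  have h2 : ContinuousAt (differential h) z.1.1 := (contMDiffAt_differential h hz).continuousAt
  have h3 := (ChartFrame.continuous_point (μ := μ) (c := c)).continuousAt (x := z)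
  refine (ContinuousAt.comp (f := fun w : ChartFrame μ c => w.1.1) h1 h3).prodMk
    (continuousAt_pi.2 fun i => ?_)
  exact (ContinuousAt.comp (f := fun w : ChartFrame μ c => w.1.1) h2 h3).clm_apply
    (ChartFrame.continuous_vector i).continuousAt

/-- The saturation of an open set of frames of a chart is open, because the differential of a change
of charts takes nearby frames to nearby frames. -/
theorem isOpenMap_mk (c : 𝓜.charts) : IsOpenMap (mk (μ := μ) c) := by
  intro O hO
  obtain ⟨O', hO', rfl⟩ := isOpen_induced_iff.1 hO
  have h1 : ∀ c' : 𝓜.charts,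
      IsOpen {z' : ChartFrame μ c' | mk c' z' ∈ mk c '' (Subtype.val ⁻¹' O')} := by
    intro c'
    rw [isOpen_iff_mem_nhds]
    rintro z' ⟨z, hz, hzz⟩
    obtain ⟨h, hh, hs, rfl⟩ := frameRel_iff.1 (mk_eq_iff.1 hzz.symm)
    filter_upwards [(continuousAt_push_val h hs).eventually (hO'.mem_nhds hz),
      ChartFrame.continuous_point.continuousAt.eventually (h.open_source.mem_nhds hs)] with w hw hws
    exact ⟨w.push h hh hws, hw, mk_push h hh w hws⟩
  exact isOpen_coinduced.2 (isOpen_sigma_iff.2 h1)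

/-- The relation on the frames of a chart given by an element of the group of the chart. -/
def actRel (μ : 𝓜.Metric) (c : 𝓜.charts) (γ : c.1.Γ) : Set (ChartFrame μ c × ChartFrame μ c) :=
  {p | γ • p.1.1.1 = p.2.1.1 ∧
    ∀ i, opensDeriv (fun y : c.1.U => γ • y) p.1.1.1 (p.1.1.2 i) = p.2.1.2 i}

theorem isClosed_actRel (γ : c.1.Γ) : IsClosed (actRel μ c γ) := by
  have h1 : Continuous fun p : ChartFrame μ c × ChartFrame μ c => p.1.1.1 :=
    ChartFrame.continuous_point.comp continuous_fst
  have h2 : Continuous (opensDeriv fun y : c.1.U => γ • y) :=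
    continuous_iff_continuousAt.2 fun y => (contMDiffAt_opensDeriv
      (Eventually.of_forall (c.1.contMDiff_smul γ))).continuousAt
  have h3 : actRel μ c γ = {p | γ • p.1.1.1 = p.2.1.1} ∩
      ⋂ i, {p | opensDeriv (fun y : c.1.U => γ • y) p.1.1.1 (p.1.1.2 i) = p.2.1.2 i} := by
    ext p
    simp [actRel]
  rw [h3]
  refine (isClosed_eq ((c.1.continuous_smul γ).comp h1)
    (ChartFrame.continuous_point.comp continuous_snd)).inter ?_
  exact isClosed_iInter fun i => isClosed_eq
    ((h2.comp h1).clm_apply ((ChartFrame.continuous_vector i).comp continuous_fst))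
    ((ChartFrame.continuous_vector i).comp continuous_snd)

/-- Two frames of the same chart represent the same element of the frame bundle if and only if the
group of the chart takes one to the other. -/
theorem mk_eq_iff_actRel {z z' : ChartFrame μ c} :
    mk c z = mk c z' ↔ ∃ γ, (z, z') ∈ actRel μ c γ := by
  rw [mk_eq_iff, frameRel_iff]
  constructor
  · rintro ⟨h, hh, hz, rfl⟩
    obtain ⟨γ, hγ⟩ := isTransition_refl.eventually_eq_smul hh (mem_univ z.1.1) hz
    refine ⟨γ, hγ.self_of_nhds.symm, fun i => ?_⟩
    change _ = opensDeriv h _ _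
    rw [opensDeriv_congr hγ]
    rfl
  · rintro ⟨γ, h1, h2⟩
    exact ⟨smulDiffeo c.1 γ, isTransition_smulDiffeo γ, mem_univ _, ChartFrame.ext' h1 h2⟩

/-- The group of a chart acts freely on the frames. -/
theorem eq_one_of_mem_actRel {z : ChartFrame μ c} {γ : c.1.Γ} (h : (z, z) ∈ actRel μ c γ) :
    γ = 1 :=
  c.1.eq_one_of_opensDeriv_eq_id h.1 (eq_of_eq_on_frame z.2 h.2)

/-- The map from the frames of a chart to the frame bundle is locally injective, because the finite
group of the chart acts freely on the frames. -/
theorem eventually_eq_of_mk_eq (z : ChartFrame μ c) :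
    ∀ᶠ p : ChartFrame μ c × ChartFrame μ c in 𝓝 (z, z), mk c p.1 = mk c p.2 → p.1 = p.2 := by
  have h1 : ∀ γ : c.1.Γ, ∀ᶠ p in 𝓝 (z, z), p ∈ actRel μ c γ → γ = 1 := by
    intro γ
    by_cases hγ : γ = 1
    · exact Eventually.of_forall fun _ _ => hγ
    · filter_upwards [(isClosed_actRel (μ := μ) γ).isOpen_compl.mem_nhds
        fun h => hγ (eq_one_of_mem_actRel h)] with p hp hp' using absurd hp' hp
  filter_upwards [eventually_all.2 h1] with p hp hpp
  obtain ⟨γ, hγ⟩ := mk_eq_iff_actRel.1 hpp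
  obtain rfl := hp γ hγ
  refine ChartFrame.ext' (by simpa using hγ.1) fun i => ?_
  have h2 := hγ.2 i
  rw [opensDeriv_one_smul] at h2
  exact h2

/-- Points over different points of `M` are separated by sets pulled back from `M`. Two points over
the same point are represented in one chart, where the equivalence relation is closed. -/
theorem t2Space (μ : 𝓜.Metric) : T2Space (FrameBundle μ) := by
  refine ⟨fun q q' hne => ?_⟩
  by_cases hb : base q = base q'
  · obtain ⟨c, z, rfl⟩ := exists_mk q
    obtain ⟨z', -, rfl⟩ := exists_mk_of_base_eq (c := c) hb.symm
    have h1 : (z, z') ∈ (⋃ γ, actRel μ c γ)ᶜ := by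
      intro h
      exact hne (mk_eq_iff_actRel.2 (mem_iUnion.1 h))
    obtain ⟨A, B, hA, hB, hz, hz', hAB⟩ := isOpen_prod_iff.1
      (isClosed_iUnion_of_finite fun γ => isClosed_actRel (μ := μ) (c := c) γ).isOpen_compl z z' h1
    refine ⟨mk c '' A, mk c '' B, isOpenMap_mk c A hA, isOpenMap_mk c B hB, ⟨z, hz, rfl⟩,
      ⟨z', hz', rfl⟩, ?_⟩
    rw [Set.disjoint_left]
    rintro _ ⟨w, hw, rfl⟩ ⟨w', hw', hww⟩
    exact hAB (mk_mem_prod hw hw') (mem_iUnion.2 (mk_eq_iff_actRel.1 hww.symm))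
  · have := 𝓜.t2
    obtain ⟨A, B, hA, hB, hq, hq', hAB⟩ := t2_separation hb
    exact ⟨base ⁻¹' A, base ⁻¹' B, hA.preimage continuous_base, hB.preimage continuous_base,
      hq, hq',
      hAB.preimage _⟩

/-- A rotation that fixes the class of a frame is the effect on this frame of an element of the
finite group of the chart, and it is determined by this element. -/
theorem finite_stabilizer (q : FrameBundle μ) :
    Finite (MulAction.stabilizer (Matrix.orthogonalGroup (Fin m) ℝ) q) := by
  obtain ⟨c, z, rfl⟩ := exists_mk q
  have h1 : ∀ g : MulAction.stabilizer (Matrix.orthogonalGroup (Fin m) ℝ) (mk c z),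
      ∃ γ, (z, z.rotate g.1) ∈ actRel μ c γ := fun g =>
    mk_eq_iff_actRel.1 (g.2.symm : mk c z = mk c (z.rotate g.1))
  choose f hf using h1
  refine Finite.of_injective f fun g g' h => Subtype.ext (z.rotate_injective ?_)
  have h2 := hf g
  rw [h] at h2
  refine ChartFrame.ext' rfl fun i => ?_
  exact (h2.2 i).symm.trans ((hf g').2 i)

end FrameBundle

end Orbifold

/-! ### Orthonormal frame fields and the smooth structure of the frame bundle -/

section GramSchmidt

variable {m : ℕ} {F H X : Type*} [NormedAddCommGroup F] [NormedSpace ℝ F] [TopologicalSpace H]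
  {I : ModelWithCorners ℝ F H} [TopologicalSpace X] [ChartedSpace H X]

/-- The Gram–Schmidt process, applied to the standard basis and a smooth family of inner products.
Since the inner product varies, the bilinear forms are arguments and not an instance. -/
theorem exists_smooth_orthonormal_frame
    {b : X → EuclideanSpace ℝ (Fin m) →L[ℝ] EuclideanSpace ℝ (Fin m) →L[ℝ] ℝ}
    (hb : ContMDiff I
      𝓘(ℝ, EuclideanSpace ℝ (Fin m) →L[ℝ] EuclideanSpace ℝ (Fin m) →L[ℝ] ℝ) ∞ b)
    (hsymm : ∀ x v w, b x v w = b x w v) (hpos : ∀ x v, v ≠ 0 → 0 < b x v v) :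
    ∃ σ : X → Fin m → EuclideanSpace ℝ (Fin m),
      ContMDiff I 𝓘(ℝ, Fin m → EuclideanSpace ℝ (Fin m)) ∞ σ ∧
      ∀ x i j, b x (σ x i) (σ x j) = if i = j then 1 else 0 := by
  -- index the standard basis by natural numbers, so as to construct the frame by induction
  let e : ℕ → EuclideanSpace ℝ (Fin m) := fun i =>
    if h : i < m then EuclideanSpace.single ⟨i, h⟩ 1 else 0
  let S : ℕ → Submodule ℝ (EuclideanSpace ℝ (Fin m)) := fun n => Submodule.span ℝ (e '' Iio n)
  have hS : ∀ n, S n ≤ S (n + 1) := fun n =>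
    Submodule.span_mono (image_mono fun i hi => lt_trans hi (Nat.lt_succ_self n))
  have heS : ∀ n < m, e n ∉ S n := by
    intro n hn h
    have h1 : S n ≤ LinearMap.ker (EuclideanSpace.proj (⟨n, hn⟩ : Fin m) :
        EuclideanSpace ℝ (Fin m) →L[ℝ] ℝ).toLinearMap := by
      refine Submodule.span_le.2 ?_
      rintro _ ⟨i, hi, rfl⟩
      have hi' : i < n := hi
      simp [e, hi'.trans hn, hi'.ne']
    have h2 := h1 h
    simp [e, hn] at h2
  have key : ∀ n ≤ m, ∃ σ : ℕ → X → EuclideanSpace ℝ (Fin m),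
      (∀ i < n, ContMDiff I 𝓘(ℝ, EuclideanSpace ℝ (Fin m)) ∞ (σ i)) ∧
      (∀ x, ∀ i < n, ∀ j < n, b x (σ i x) (σ j x) = if i = j then 1 else 0) ∧
      ∀ x, ∀ i < n, σ i x ∈ S n := by
    intro n
    induction n with
    | zero => exact fun _ => ⟨fun _ _ => 0, by simp, by simp, by simp⟩
    | succ n ih =>
      intro hn
      obtain ⟨σ, h1, h2, h3⟩ := ih (by lia)
      -- the component of the next basis vector orthogonal to the vectors constructed so far
      let w : X → EuclideanSpace ℝ (Fin m) := fun x =>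
        e n - ∑ i ∈ Finset.range n, b x (e n) (σ i x) • σ i x
      have hwS : ∀ x, w x ∈ S (n + 1) := fun x => by
        refine Submodule.sub_mem _ (Submodule.subset_span ⟨n, Nat.lt_succ_self n, rfl⟩)
          (Submodule.sum_mem _ fun i hi => Submodule.smul_mem _ _ ?_)
        exact hS n (h3 x i (Finset.mem_range.1 hi))
      have hw0 : ∀ x, w x ≠ 0 := fun x h => by
        refine heS n (by lia) ?_
        rw [sub_eq_zero.1 h]
        exact Submodule.sum_mem _ fun i hi =>
          Submodule.smul_mem _ _ (h3 x i (Finset.mem_range.1 hi))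
      have hworth : ∀ x, ∀ j < n, b x (w x) (σ j x) = 0 := by
        intro x j hj
        have h4 : ∀ i ∈ Finset.range n, b x (e n) (σ i x) * b x (σ i x) (σ j x) =
            if i = j then b x (e n) (σ i x) else 0 := by
          intro i hi
          rw [h2 x i (Finset.mem_range.1 hi) j hj]
          simp
        simp only [w, map_sub, map_sum, map_smul, sub_apply, sum_apply, smul_apply, smul_eq_mul]
        rw [Finset.sum_congr rfl h4]
        simp [hj]
      have hwsm : ContMDiff I 𝓘(ℝ, EuclideanSpace ℝ (Fin m)) ∞ w := by
        refine contMDiff_const.sub (ContMDiff.sum fun i hi => ?_)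
        have h5 := h1 i (Finset.mem_range.1 hi)
        exact ContMDiff.smul (I := 𝓘(ℝ, ℝ)) (f := fun x => b x (e n) (σ i x)) (g := σ i)
          ((hb.clm_apply contMDiff_const).clm_apply h5) h5
      let r : X → ℝ := fun x => (Real.sqrt (b x (w x) (w x)))⁻¹
      have hr : ∀ x, r x * r x * b x (w x) (w x) = 1 := fun x => by
        have h6 := hpos x _ (hw0 x)
        have h7 := Real.mul_self_sqrt h6.le
        have h8 : Real.sqrt (b x (w x) (w x)) ≠ 0 := (Real.sqrt_pos.2 h6).ne'
        simp only [r]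
        rw [← mul_inv, h7, inv_mul_cancel₀ h6.ne']
      have hrsm : ContMDiff I 𝓘(ℝ, ℝ) ∞ r := by
        intro x
        have h6 := (hpos x _ (hw0 x)).ne'
        have h8 : Real.sqrt (b x (w x) (w x)) ≠ 0 := (Real.sqrt_pos.2 (hpos x _ (hw0 x))).ne'
        have h9 : ContDiffAt ℝ ∞ (fun t : ℝ => (Real.sqrt t)⁻¹) (b x (w x) (w x)) :=
          (Real.contDiffAt_sqrt h6).inv h8
        exact ContMDiffAt.comp (g := fun t : ℝ => (Real.sqrt t)⁻¹)
          (f := fun x => b x (w x) (w x)) x h9.contMDiffAt ((hb.clm_apply hwsm).clm_apply hwsm x)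
      refine ⟨fun i x => if i < n then σ i x else r x • w x, fun i hi => ?_, fun x i hi j hj => ?_,
        fun x i hi => ?_⟩
      · by_cases h : i < n
        · simpa only [h, if_true] using h1 i h
        · simp only [h, if_false]
          exact hrsm.smul hwsm
      · by_cases h : i < n <;> by_cases h' : j < n
        · simpa only [h, h', if_true] using h2 x i h j h'
        · have hne : i ≠ j := by lia
          simp [h, h', hne, hsymm x (σ i x) (w x), hworth x i h]
        · have hne : i ≠ j := by lia
          simp [h, h', hne, hworth x j h']
        · have heq : i = j := by lia
          subst heq
          simpa [h, ← mul_assoc] using hr x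
      · by_cases h : i < n
        · simpa only [h, if_true] using hS n (h3 x i h)
        · simp only [h, if_false]
          exact Submodule.smul_mem _ _ (hwS x)
  obtain ⟨σ, h1, h2, -⟩ := key m le_rfl
  refine ⟨fun x i => σ i x, contMDiff_pi_space.2 fun i => h1 i i.2, fun x i j => ?_⟩
  rw [h2 x i i.2 j j.2]
  simp [Fin.ext_iff]

end GramSchmidt

namespace Orbifold

open OrbifoldChart

variable {m : ℕ} {M : Type u} [TopologicalSpace M] {𝓜 : Orbifold m M} {μ : 𝓜.Metric}

/-- A smooth field of orthonormal frames on the domain of a chart. -/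
structure FrameField (μ : 𝓜.Metric) (c : 𝓜.charts) where
  toFun : c.1.U → Fin m → EuclideanSpace ℝ (Fin m)
  orth : ∀ y i j, μ.inner c y (toFun y i) (toFun y j) = if i = j then 1 else 0
  smooth : ContMDiff (𝓡 m) 𝓘(ℝ, Fin m → EuclideanSpace ℝ (Fin m)) ∞ toFun

theorem nonempty_frameField (μ : 𝓜.Metric) (c : 𝓜.charts) : Nonempty (FrameField μ c) := by
  obtain ⟨σ, h1, h2⟩ := exists_smooth_orthonormal_frame (μ.contMDiff c) (μ.symm c) (μ.pos c)
  exact ⟨⟨σ, h2, h1⟩⟩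

namespace FrameField

variable {c c' : 𝓜.charts} (σ : FrameField μ c) (σ' : FrameField μ c')

/-- The frame of a frame field at a point. -/
def frame (y : c.1.U) : ChartFrame μ c := ⟨(y, σ.toFun y), σ.orth y⟩

/-- The trivialization `O(m) × Ũ → F(Ũ)` given by a frame field. -/
def frameAt (p : Matrix.orthogonalGroup (Fin m) ℝ × c.1.U) : ChartFrame μ c :=
  (σ.frame p.2).rotate p.1

/-- The inverse `F(Ũ) → O(m) × Ũ` of the trivialization given by a frame field. -/
def coord (z : ChartFrame μ c) : Matrix.orthogonalGroup (Fin m) ℝ × c.1.U :=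
  (frameMatrix z.2 (σ.orth z.1.1), z.1.1)

theorem frameAt_coord (z : ChartFrame μ c) : σ.frameAt (σ.coord z) = z :=
  ChartFrame.ext' rfl fun i => sum_frameMatrix_smul z.2 (σ.orth z.1.1) i

theorem coord_frameAt (p : Matrix.orthogonalGroup (Fin m) ℝ × c.1.U) :
    σ.coord (σ.frameAt p) = p := by
  refine Prod.ext ?_ rfl
  exact ChartFrame.rotate_injective (σ.frame p.2) (σ.frameAt_coord (σ.frameAt p))

theorem frameAt_vector (p : Matrix.orthogonalGroup (Fin m) ℝ × c.1.U) (i : Fin m) :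
    (σ.frameAt p).1.2 i = ∑ j, p.1.1 i j • σ.toFun p.2 j := rfl

theorem continuous_toFun (i : Fin m) : Continuous fun y => σ.toFun y i :=
  (continuous_apply i).comp σ.smooth.continuous

theorem continuous_frameAt : Continuous σ.frameAt := by
  refine continuous_induced_rng.2 (continuous_snd.prodMk (continuous_pi fun i => ?_))
  refine continuous_finsetSum _ fun j _ => Continuous.smul
    (f := fun a : Matrix.orthogonalGroup (Fin m) ℝ × c.1.U => a.1.1 i j)
    (g := fun a : Matrix.orthogonalGroup (Fin m) ℝ × c.1.U => σ.toFun a.2 j) ?_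
    ((σ.continuous_toFun j).comp continuous_snd)
  have h : Continuous fun a : Matrix.orthogonalGroup (Fin m) ℝ × c.1.U => a.1.1 :=
    continuous_subtype_val.comp continuous_fst
  exact h.matrix_elem i j

theorem continuous_coord : Continuous σ.coord := by
  refine Continuous.prodMk (continuous_induced_rng.2 ?_) ChartFrame.continuous_point
  refine continuous_pi fun i => continuous_pi fun j => ?_
  exact ((((μ.contMDiff c).continuous.comp ChartFrame.continuous_point).clm_apply
    (ChartFrame.continuous_vector i)).clm_apply
    ((σ.continuous_toFun j).comp ChartFrame.continuous_point))

/-- The trivialization of the frames of a chart given by a frame field. -/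
def homeo : Matrix.orthogonalGroup (Fin m) ℝ × c.1.U ≃ₜ ChartFrame μ c where
  toFun := σ.frameAt
  invFun := σ.coord
  left_inv := σ.coord_frameAt
  right_inv := σ.frameAt_coord
  continuous_toFun := σ.continuous_frameAt
  continuous_invFun := σ.continuous_coord

/-- The parametrization `O(m) × Ũ → F(M)` given by a frame field. -/
def param (p : Matrix.orthogonalGroup (Fin m) ℝ × c.1.U) : FrameBundle μ :=
  p.1 • FrameBundle.mk c (σ.frame p.2)

theorem param_eq_mk (p : Matrix.orthogonalGroup (Fin m) ℝ × c.1.U) :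
    σ.param p = FrameBundle.mk c (σ.frameAt p) := rfl

theorem smul_param (g : Matrix.orthogonalGroup (Fin m) ℝ)
    (p : Matrix.orthogonalGroup (Fin m) ℝ × c.1.U) : g • σ.param p = σ.param (g * p.1, p.2) :=
  (mul_smul _ _ _).symm

theorem base_param (p : Matrix.orthogonalGroup (Fin m) ℝ × c.1.U) :
    (σ.param p).base = c.1.proj p.2 := rfl

theorem exists_param_of_base_eq {q : FrameBundle μ} {y : c.1.U} (hq : q.base = c.1.proj y) :
    ∃ g, σ.param (g, y) = q := by
  obtain ⟨z, rfl, rfl⟩ := FrameBundle.exists_mk_of_base_eq hq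
  refine ⟨(σ.coord z).1, ?_⟩
  rw [param_eq_mk]
  exact congrArg _ (σ.frameAt_coord z)

theorem continuous_param : Continuous σ.param :=
  (FrameBundle.continuous_mk c).comp σ.continuous_frameAt

theorem isOpenMap_param : IsOpenMap σ.param :=
  (FrameBundle.isOpenMap_mk c).comp σ.homeo.isOpenMap

/-- The parametrization is continuous, open and locally injective. -/
theorem isLocalHomeomorph_param : IsLocalHomeomorph σ.param := by
  rw [isLocalHomeomorph_iff_isOpenEmbedding_restrict]
  intro p
  have h1 := FrameBundle.eventually_eq_of_mk_eq (σ.frameAt p)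
  have h2 : ∀ᶠ r : (Matrix.orthogonalGroup (Fin m) ℝ × c.1.U) × _ in 𝓝 (p, p),
      σ.param r.1 = σ.param r.2 → r.1 = r.2 := by
    have h3 : Tendsto (Prod.map σ.frameAt σ.frameAt) (𝓝 (p, p))
        (𝓝 (σ.frameAt p, σ.frameAt p)) :=
      (σ.continuous_frameAt.prodMap σ.continuous_frameAt).tendsto (p, p)
    filter_upwards [h3.eventually h1] with r hr h4
    exact σ.homeo.injective (hr h4)
  rw [nhds_prod_eq] at h2
  obtain ⟨N, hN, hinj⟩ := (eventually_prod_self_iff'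
    (r := fun r => σ.param r.1 = σ.param r.2 → r.1 = r.2)).1 h2
  obtain ⟨O, hON, hO, hpO⟩ := mem_nhds_iff.1 hN
  refine ⟨O, hO.mem_nhds hpO, Topology.IsOpenEmbedding.of_continuous_injective_isOpenMap
    (σ.continuous_param.comp continuous_subtype_val) (fun a b hab => ?_)
    (σ.isOpenMap_param.comp hO.isOpenMap_subtype_val)⟩
  exact Subtype.ext (hinj a (hON a.2) b (hON b.2) hab)

theorem contMDiffAt_frameAt_vector (p : Matrix.orthogonalGroup (Fin m) ℝ × c.1.U) (i : Fin m) :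
    ContMDiffAt ((𝓡 (orthDim m)).prod (𝓡 m)) (𝓡 m) ∞ (fun p => (σ.frameAt p).1.2 i) p := by
  simp only [frameAt_vector]
  refine ContMDiffAt.sum fun j _ => ContMDiffAt.smul (I := 𝓘(ℝ, ℝ))
    (f := fun p : Matrix.orthogonalGroup (Fin m) ℝ × c.1.U => p.1.1 i j)
    (g := fun p : Matrix.orthogonalGroup (Fin m) ℝ × c.1.U => σ.toFun p.2 j) ?_ ?_
  · exact ((matSmoothAt_orthogonalGroup_coe p.1).comp contMDiffAt_fst) i j
  · exact (contMDiff_pi_space.1 σ.smooth j).contMDiffAt.comp p contMDiffAt_snd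

/-- The parametrizations of the frame bundle have smooth transition maps. -/
theorem exists_transition {p : Matrix.orthogonalGroup (Fin m) ℝ × c.1.U}
    {p' : Matrix.orthogonalGroup (Fin m) ℝ × c'.1.U} (hpp : σ.param p = σ'.param p') :
    ∃ τ : Matrix.orthogonalGroup (Fin m) ℝ × c.1.U → Matrix.orthogonalGroup (Fin m) ℝ × c'.1.U,
      ContMDiffAt ((𝓡 (orthDim m)).prod (𝓡 m)) ((𝓡 (orthDim m)).prod (𝓡 m)) ∞ τ p ∧ τ p = p' ∧
      ∀ᶠ r in 𝓝 p, σ'.param (τ r) = σ.param r := by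
  classical
  obtain ⟨h, hh, hs, hz⟩ := frameRel_iff.1 (FrameBundle.mk_eq_iff.1
    (show FrameBundle.mk c (σ.frameAt p) = FrameBundle.mk c' (σ'.frameAt p') from hpp))
  have hs' : p.2 ∈ h.source := hs
  -- the transition map is the differential of a change of charts, written in the two frame fields
  let τ : Matrix.orthogonalGroup (Fin m) ℝ × c.1.U → Matrix.orthogonalGroup (Fin m) ℝ × c'.1.U :=
    fun r => if hr : r.2 ∈ h.source then σ'.coord ((σ.frameAt r).push h hh hr) else p'
  have hτ : ∀ r (hr : r.2 ∈ h.source), τ r = σ'.coord ((σ.frameAt r).push h hh hr) :=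
    fun r hr => dif_pos hr
  have hev : ∀ᶠ r : Matrix.orthogonalGroup (Fin m) ℝ × c.1.U in 𝓝 p, r.2 ∈ h.source :=
    continuous_snd.continuousAt.eventually (h.open_source.mem_nhds hs')
  have hh1 : ContMDiffAt ((𝓡 (orthDim m)).prod (𝓡 m)) (𝓡 m) ∞
      (fun r : Matrix.orthogonalGroup (Fin m) ℝ × c.1.U => h r.2) p :=
    (h.contMDiffAt hs').comp p contMDiffAt_snd
  refine ⟨τ, ?_, ?_, ?_⟩
  · have h1 : ContMDiffAt ((𝓡 (orthDim m)).prod (𝓡 m)) (𝓡 (orthDim m)) ∞ (fun r => (τ r).1) p := by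
      rw [contMDiffAt_orthogonalGroup_iff]
      intro i j
      -- the matrix entries are inner products of the transported frame with the frame field `σ'`
      have h2 : ContMDiffAt ((𝓡 (orthDim m)).prod (𝓡 m)) 𝓘(ℝ, ℝ) ∞
          (fun r : Matrix.orthogonalGroup (Fin m) ℝ × c.1.U =>
            μ.inner c' (h r.2) (differential h r.2 ((σ.frameAt r).1.2 i))
              (σ'.toFun (h r.2) j)) p := by
        refine ContMDiffAt.clm_apply (ContMDiffAt.clm_apply ?_ ?_) ?_
        · exact ((μ.contMDiff c').contMDiffAt).comp p hh1
        · exact ((contMDiffAt_differential h hs').comp p contMDiffAt_snd).clm_apply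
            (σ.contMDiffAt_frameAt_vector p i)
        · exact ((contMDiff_pi_space.1 σ'.smooth j).contMDiffAt).comp p hh1
      refine h2.congr_of_eventuallyEq ?_
      filter_upwards [hev] with r hr
      rw [hτ r hr]
      rfl
    refine h1.prodMk (f := fun r => (τ r).1) (g := fun r => (τ r).2) (hh1.congr_of_eventuallyEq ?_)
    filter_upwards [hev] with r hr
    rw [hτ r hr]
    rfl
  · rw [hτ p hs', hz, coord_frameAt]
  · filter_upwards [hev] with r hr
    rw [hτ r hr, param_eq_mk, frameAt_coord, param_eq_mk]
    exact FrameBundle.mk_push h hh (σ.frameAt r) hr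

end FrameField

namespace FrameBundle

/-- The parametrizations `O(m) × Ũ → F(M)` given by all frame fields make the frame bundle a
manifold. -/
theorem exists_isManifold (μ : 𝓜.Metric) :
    ∃ (_ : ChartedSpace (EuclideanSpace ℝ (Fin (m + orthDim m))) (FrameBundle μ))
      (_ : IsManifold (𝓡 (m + orthDim m)) ∞ (FrameBundle μ)),
      ∀ i : Σ c : 𝓜.charts, FrameField μ c, IsLocalDiffeomorph
        ((𝓡 (orthDim m)).prod (𝓡 m)) (𝓡 (m + orthDim m)) ∞ i.2.param := by
  have lam : (EuclideanSpace ℝ (Fin (orthDim m)) × EuclideanSpace ℝ (Fin m)) ≃L[ℝ]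
      EuclideanSpace ℝ (Fin (m + orthDim m)) :=
    ContinuousLinearEquiv.ofFinrankEq (by simp [add_comm])
  refine exists_isManifold_of_isLocalHomeomorph
    (N := fun i : Σ c : 𝓜.charts, FrameField μ c => Matrix.orthogonalGroup (Fin m) ℝ × i.1.1.U)
    lam (fun i => i.2.param) (fun i => i.2.isLocalHomeomorph_param) (fun q => ?_)
    fun i j a b hab => i.2.exists_transition j.2 hab
  obtain ⟨c, z, rfl⟩ := exists_mk q
  obtain ⟨σ⟩ := nonempty_frameField μ c
  exact ⟨⟨c, σ⟩, σ.coord z, by rw [FrameField.param_eq_mk, FrameField.frameAt_coord]⟩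

instance : ChartedSpace (EuclideanSpace ℝ (Fin (m + orthDim m))) (FrameBundle μ) :=
  (exists_isManifold μ).choose

instance : IsManifold (𝓡 (m + orthDim m)) ∞ (FrameBundle μ) :=
  (exists_isManifold μ).choose_spec.choose

end FrameBundle

theorem FrameField.isLocalDiffeomorph_param {c : 𝓜.charts} (σ : FrameField μ c) :
    IsLocalDiffeomorph ((𝓡 (orthDim m)).prod (𝓡 m)) (𝓡 (m + orthDim m)) ∞ σ.param :=
  (FrameBundle.exists_isManifold μ).choose_spec.choose_spec ⟨c, σ⟩

theorem FrameField.isSlice {c : 𝓜.charts} (σ : FrameField μ c) :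
    IsSlice (d := orthDim m) (n := m + orthDim m) (G := Matrix.orthogonalGroup (Fin m) ℝ)
      (fun y => FrameBundle.mk c (σ.frame y)) :=
  σ.isLocalDiffeomorph_param

namespace FrameBundle

theorem exists_param (q : FrameBundle μ) :
    ∃ (c : 𝓜.charts) (σ : FrameField μ c) (p : _), σ.param p = q := by
  obtain ⟨c, z, rfl⟩ := exists_mk q
  obtain ⟨σ⟩ := nonempty_frameField μ c
  exact ⟨c, σ, σ.coord z, by rw [FrameField.param_eq_mk, FrameField.frameAt_coord]⟩

/-- In the parametrizations, the action is multiplication on the factor `O(m)`. -/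
theorem contMDiff_smul :
    ContMDiff ((𝓡 (orthDim m)).prod (𝓡 (m + orthDim m))) (𝓡 (m + orthDim m)) ∞
      (fun z : Matrix.orthogonalGroup (Fin m) ℝ × FrameBundle μ => z.1 • z.2) := by
  rintro ⟨g, q⟩
  obtain ⟨c, σ, p, rfl⟩ := exists_param q
  obtain ⟨Φ, hΦ, hΦe⟩ := σ.isLocalDiffeomorph_param p
  have hq : σ.param p ∈ Φ.target := by
    rw [hΦe hΦ]
    exact Φ.apply_mem_target hΦ
  have h1 : ContMDiffAt ((𝓡 (orthDim m)).prod (𝓡 (m + orthDim m))) ((𝓡 (orthDim m)).prod (𝓡 m)) ∞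
      (fun z : Matrix.orthogonalGroup (Fin m) ℝ × FrameBundle μ => Φ.symm z.2) (g, σ.param p) :=
    ContMDiffAt.comp (g := Φ.symm) (f := Prod.snd) (g, σ.param p) (Φ.contMDiffAt_symm hq)
      contMDiffAt_snd
  have h2 : ContMDiffAt ((𝓡 (orthDim m)).prod (𝓡 (m + orthDim m))) ((𝓡 (orthDim m)).prod (𝓡 m)) ∞
      (fun z : Matrix.orthogonalGroup (Fin m) ℝ × FrameBundle μ =>
        (z.1 * (Φ.symm z.2).1, (Φ.symm z.2).2)) (g, σ.param p) :=
    (contMDiffAt_fst.mul h1.fst).prodMk h1.snd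
  refine (ContMDiffAt.comp (g, σ.param p) σ.isLocalDiffeomorph_param.contMDiff.contMDiffAt
    h2).congr_of_eventuallyEq ?_
  filter_upwards [continuous_snd.continuousAt.eventually (Φ.open_target.mem_nhds hq)] with z hz
  rw [Function.comp_apply, ← σ.smul_param, hΦe (Φ.symm_apply_mem_source hz), Φ.apply_symm_apply hz]

/-- A neighbourhood of a fibre of the projection contains the preimage of a neighbourhood of the
base point: apply the tube lemma to `O(m) × Ũ`. -/
theorem exists_nhds_preimage_base_subset {q : M} {S : Set (FrameBundle μ)} (hS : IsOpen S)
    (hq : base ⁻¹' {q} ⊆ S) : ∃ W : Set M, IsOpen W ∧ q ∈ W ∧ base ⁻¹' W ⊆ S := by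
  obtain ⟨c, hc, y, rfl⟩ := 𝓜.cover q
  obtain ⟨σ⟩ := nonempty_frameField μ ⟨c, hc⟩
  obtain ⟨A, B, hA, hB, hAu, hyB, hAB⟩ := generalized_tube_lemma
    (isCompact_univ (X := Matrix.orthogonalGroup (Fin m) ℝ)) (isCompact_singleton (x := y))
    (hS.preimage σ.continuous_param) (by
      rintro ⟨g, y'⟩ ⟨-, hy⟩
      obtain rfl : y' = y := hy
      exact hq (σ.base_param (g, y')))
  refine ⟨c.proj '' B, c.isOpenMap_proj B hB, ⟨y, hyB rfl, rfl⟩, ?_⟩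
  rintro r ⟨z, hz, hr⟩
  obtain ⟨g, rfl⟩ := σ.exists_param_of_base_eq hr.symm
  exact hAB (mk_mem_prod (hAu (mem_univ g)) hz)

theorem isCompact_preimage_base (q : M) : IsCompact (base (μ := μ) ⁻¹' {q}) := by
  obtain ⟨c, hc, y, rfl⟩ := 𝓜.cover q
  obtain ⟨σ⟩ := nonempty_frameField μ ⟨c, hc⟩
  have h1 : base (μ := μ) ⁻¹' {c.proj y} = range fun g => σ.param (g, y) := by
    ext r
    constructor
    · intro hr
      exact σ.exists_param_of_base_eq hr
    · rintro ⟨g, rfl⟩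
      exact σ.base_param (g, y)
  rw [h1]
  exact isCompact_range (σ.continuous_param.comp (Continuous.prodMk_left y))

/-- The total space is paracompact because the projection is closed with compact fibres: an open
covering has a refinement by the intersections of its members, finitely many over each member of a
locally finite covering of `M`, with the preimages of these members. -/
theorem paracompactSpace [ParacompactSpace M] (μ : 𝓜.Metric) :
    ParacompactSpace (FrameBundle μ) := by
  refine ⟨fun α s hso hs => ?_⟩
  have h1 : ∀ q : M, ∃ (t : Finset α) (W : Set M), IsOpen W ∧ q ∈ W ∧
      base (μ := μ) ⁻¹' W ⊆ ⋃ a ∈ t, s a := by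
    intro q
    obtain ⟨t, ht⟩ := (isCompact_preimage_base (μ := μ) q).elim_finite_subcover s hso
      (by rw [hs]; exact subset_univ _)
    obtain ⟨W, hW, hq, hWs⟩ := exists_nhds_preimage_base_subset
      (isOpen_biUnion fun a (_ : a ∈ t) => hso a) ht
    exact ⟨t, W, hW, hq, hWs⟩
  choose t W hW hqW hWs using h1
  obtain ⟨v, hv, hvu, hvlf, hvW⟩ := precise_refinement W hW
    (eq_univ_of_forall fun q => mem_iUnion.2 ⟨q, hqW q⟩)
  refine ⟨Σ q : M, t q, fun β => base ⁻¹' v β.1 ∩ s β.2,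
    fun β => ((hv β.1).preimage continuous_base).inter (hso _), ?_, ?_,
    fun β => ⟨β.2, inter_subset_right⟩⟩
  · refine eq_univ_of_forall fun r => ?_
    obtain ⟨q, hq⟩ := mem_iUnion.1 (hvu.symm ▸ mem_univ r.base : r.base ∈ ⋃ q, v q)
    obtain ⟨a, ha, hra⟩ := mem_iUnion₂.1 (hWs q (hvW q hq))
    exact mem_iUnion.2 ⟨⟨q, a, ha⟩, hq, hra⟩
  · intro r
    obtain ⟨O, hO, hfin⟩ := hvlf r.base
    refine ⟨base ⁻¹' O, continuous_base.continuousAt hO, ?_⟩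
    refine (hfin.preimage' (f := Sigma.fst) fun q _ => ?_).subset ?_
    · refine (finite_range fun a : t q => (⟨q, a⟩ : Σ q : M, t q)).subset ?_
      rintro ⟨q', a⟩ rfl
      exact ⟨a, rfl⟩
    · rintro β ⟨z, hz, hzO⟩
      exact ⟨z.base, hz.1, hzO⟩

/-- Countably many charts cover `M`, and over each of them the frame bundle is an open image of
`O(m) × Ũ`. -/
theorem secondCountableTopology [SecondCountableTopology M] (μ : 𝓜.Metric) :
    SecondCountableTopology (FrameBundle μ) := by
  let U : 𝓜.charts → Set M := fun c => range c.1.proj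
  obtain ⟨T, hT, hTU⟩ := isOpen_iUnion_countable U fun c => c.1.isOpenMap_proj.isOpen_range
  have hcov : ⋃ c ∈ T, base (μ := μ) ⁻¹' U c = univ := by
    refine eq_univ_of_forall fun q => ?_
    obtain ⟨c, hc, hq⟩ := 𝓜.cover q.base
    have h1 : q.base ∈ ⋃ c, U c := mem_iUnion.2 ⟨⟨c, hc⟩, hq⟩
    rw [← hTU] at h1
    simpa using h1
  have := hT.to_subtype
  have hMat : SecondCountableTopology (Matrix (Fin m) (Fin m) ℝ) :=
    inferInstanceAs (SecondCountableTopology (Fin m → Fin m → ℝ))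
  have hO : SecondCountableTopology (Matrix.orthogonalGroup (Fin m) ℝ) :=
    Topology.IsEmbedding.subtypeVal.secondCountableTopology
  have hsc : ∀ c : T, SecondCountableTopology (base (μ := μ) ⁻¹' U c) := by
    intro c
    obtain ⟨σ⟩ := nonempty_frameField μ c.1
    have hr : ∀ p, σ.param p ∈ base (μ := μ) ⁻¹' U c := fun p => ⟨p.2, rfl⟩
    have hf : Continuous fun p => (⟨σ.param p, hr p⟩ : base (μ := μ) ⁻¹' U c) :=
      σ.continuous_param.subtype_mk _
    have hfo : IsOpenMap fun p => (⟨σ.param p, hr p⟩ : base (μ := μ) ⁻¹' U c) :=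
      σ.isOpenMap_param.subtype_mk _
    have hfs : Function.Surjective fun p => (⟨σ.param p, hr p⟩ : base (μ := μ) ⁻¹' U c) := by
      rintro ⟨q, y, hy⟩
      obtain ⟨g, hg⟩ := σ.exists_param_of_base_eq hy.symm
      exact ⟨(g, y), Subtype.ext hg⟩
    exact (hfo.isQuotientMap hf hfs).secondCountableTopology hfo
  refine secondCountableTopology_of_countable_cover (ι := T) (U := fun c => base ⁻¹' U c)
    (fun c => c.1.1.isOpenMap_proj.isOpen_range.preimage continuous_base) ?_
  rw [← hcov, iUnion_subtype]

end FrameBundle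

end Orbifold

/-! ### Slices and orbit spaces -/

/-- Two quotient maps with the same fibres have homeomorphic targets. -/
theorem exists_homeomorph_of_isQuotientMap {X Y Z : Type*} [TopologicalSpace X] [TopologicalSpace Y]
    [TopologicalSpace Z] {f : X → Y} {g : X → Z} (hf : Topology.IsQuotientMap f)
    (hg : Topology.IsQuotientMap g) (h : ∀ a b, f a = f b ↔ g a = g b) :
    ∃ φ : Y ≃ₜ Z, ∀ a, φ (f a) = g a := by
  let F : Y → Z := fun y => g (Function.surjInv hf.surjective y)
  let F' : Z → Y := fun z => f (Function.surjInv hg.surjective z)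
  have hF : ∀ a, F (f a) = g a := fun a => (h _ _).1 (Function.surjInv_eq hf.surjective (f a))
  have hF' : ∀ a, F' (g a) = f a := fun a => (h _ _).2 (Function.surjInv_eq hg.surjective (g a))
  refine ⟨⟨⟨F, F', fun y => ?_, fun z => ?_⟩, hf.continuous_iff.2 ?_, hg.continuous_iff.2 ?_⟩, hF⟩
  · obtain ⟨a, rfl⟩ := hf.surjective y
    rw [hF, hF']
  · obtain ⟨a, rfl⟩ := hg.surjective z
    rw [hF', hF]
  · exact hg.continuous.congr fun a => (hF a).symm
  · exact hf.continuous.congr fun a => (hF' a).symm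

section Slice

variable {d n m : ℕ} {G : Type*} [Group G] [TopologicalSpace G]
  [ChartedSpace (EuclideanSpace ℝ (Fin d)) G] [LieGroup (𝓡 d) ∞ G]
  {X : Type*} [TopologicalSpace X] [ChartedSpace (EuclideanSpace ℝ (Fin n)) X] [MulAction G X]
  {U U' : Opens (EuclideanSpace ℝ (Fin m))} {s : U → X} {s' : U' → X}

/-- Two slices that meet the same orbit are related by a diffeomorphism along the orbits: near
`g₀ • s y = s' y'` the local diffeomorphism `G × Ũ' → X` gives coordinates on `X`. The second
coordinate of `g₀ • s z` is the point `h z` with `s' (h z)` on the orbit of `s z`, and the first one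
determines a group element `b z` that takes `s z` to `s' (h z)`. -/
theorem IsSlice.exists_transition (hs : IsSlice (d := d) (n := n) (G := G) s)
    (hs' : IsSlice (d := d) (n := n) (G := G) s') {g₀ : G} {y : U} {y' : U'}
    (hy : g₀ • s y = s' y') :
    ∃ (h : PartialDiffeomorph (𝓡 m) (𝓡 m) U U' ∞) (b : U → G), y ∈ h.source ∧ h y = y' ∧
      ContMDiffOn (𝓡 m) (𝓡 d) ∞ b h.source ∧ ∀ z ∈ h.source, s' (h z) = b z • s z := by
  have : IsTopologicalGroup G := topologicalGroup_of_lieGroup (𝓡 d) ∞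
  obtain ⟨Φ, hΦ, hΦe⟩ := hs (g₀, y)
  obtain ⟨Φ', hΦ', hΦe'⟩ := hs' (1, y')
  have e1 : ∀ r ∈ Φ.source, r.1 • s r.2 = Φ r := fun r hr => hΦe hr
  have e1' : ∀ r ∈ Φ'.source, r.1 • s' r.2 = Φ' r := fun r hr => hΦe' hr
  have hq : g₀ • s y ∈ Φ'.target := by
    rw [hy, ← one_smul G (s' y'), e1' (1, y') hΦ']
    exact Φ'.apply_mem_target hΦ'
  have hq' : s' y' ∈ Φ.target := by
    rw [← hy, e1 (g₀, y) hΦ]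
    exact Φ.apply_mem_target hΦ
  -- coordinates of each of the slices with respect to the other one
  let f : U → G × U' := fun z => Φ'.symm (g₀ • s z)
  let f' : U' → G × U := fun z => Φ.symm (s' z)
  have hfy : f y = (1, y') := by
    simp only [f]
    rw [hy, ← one_smul G (s' y'), e1' (1, y') hΦ', Φ'.symm_apply_apply hΦ']
  have hfy' : f' y' = (g₀, y) := by
    simp only [f']
    rw [← hy, e1 (g₀, y) hΦ, Φ.symm_apply_apply hΦ]
  have hsm : ContMDiff (𝓡 m) (𝓡 n) ∞ fun z => g₀ • s z :=
    hs.contMDiff.comp (contMDiff_const.prodMk contMDiff_id)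
  have hsm' : ContMDiff (𝓡 m) (𝓡 n) ∞ s' := by
    have h1 : ContMDiff (𝓡 m) (𝓡 n) ∞ fun z => (1 : G) • s' z :=
      hs'.contMDiff.comp (contMDiff_const.prodMk contMDiff_id)
    simpa only [one_smul] using h1
  have hf : ∀ z, g₀ • s z ∈ Φ'.target → ContMDiffAt (𝓡 m) ((𝓡 d).prod (𝓡 m)) ∞ f z :=
    fun z hz => (Φ'.contMDiffAt_symm hz).comp z hsm.contMDiffAt
  have hf' : ∀ z, s' z ∈ Φ.target → ContMDiffAt (𝓡 m) ((𝓡 d).prod (𝓡 m)) ∞ f' z :=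
    fun z hz => (Φ.contMDiffAt_symm hz).comp z hsm'.contMDiffAt
  have hfs : ∀ z, g₀ • s z ∈ Φ'.target → (f z).1 • s' (f z).2 = g₀ • s z := fun z hz => by
    rw [e1' _ (Φ'.symm_apply_mem_source hz), Φ'.apply_symm_apply hz]
  have hfs' : ∀ z, s' z ∈ Φ.target → (f' z).1 • s (f' z).2 = s' z := fun z hz => by
    rw [e1 _ (Φ.symm_apply_mem_source hz), Φ.apply_symm_apply hz]
  -- restrict to points whose images lie in the domains where the coordinates are inverse to each
  -- other
  have hA : ∀ᶠ z in 𝓝 y, g₀ • s z ∈ Φ'.target ∧ ((f z).1⁻¹ * g₀, z) ∈ Φ.source := by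
    refine (hsm.continuous.continuousAt.eventually (Φ'.open_target.mem_nhds hq)).and ?_
    have h1 : ContinuousAt (fun z => ((f z).1⁻¹ * g₀, z)) y :=
      ((((hf y hq).continuousAt.fst).inv).mul continuousAt_const).prodMk continuousAt_id
    refine h1.eventually (Φ.open_source.mem_nhds ?_)
    simpa [hfy] using hΦ
  have hB : ∀ᶠ z in 𝓝 y', s' z ∈ Φ.target ∧ (g₀ * (f' z).1⁻¹, z) ∈ Φ'.source := by
    refine (hsm'.continuous.continuousAt.eventually (Φ.open_target.mem_nhds hq')).and ?_
    have h1 : ContinuousAt (fun z => (g₀ * (f' z).1⁻¹, z)) y' :=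
      (continuousAt_const.mul (((hf' y' hq').continuousAt.fst).inv)).prodMk continuousAt_id
    refine h1.eventually (Φ'.open_source.mem_nhds ?_)
    simpa [hfy'] using hΦ'
  obtain ⟨A, hA, hAo, hyA⟩ := eventually_nhds_iff.1 hA
  obtain ⟨B, hB, hBo, hyB⟩ := eventually_nhds_iff.1 hB
  have hs2 : ∀ z, g₀ • s z ∈ Φ'.target → s' (f z).2 = ((f z).1⁻¹ * g₀) • s z := fun z hz => by
    rw [mul_smul, ← hfs z hz, inv_smul_smul]
  obtain ⟨h, hyh, hhA, hhf⟩ := PartialDiffeomorph.exists_of_local_inverses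
    (I := 𝓡 m) (J := 𝓡 m) (f := fun z => (f z).2) (g := fun z => (f' z).2) hAo hBo hyA
    (by simpa only [hfy] using hyB) (fun z hz => (hf z (hA z hz).1).snd.contMDiffWithinAt)
    (fun z hz => (hf' z (hB z hz).1).snd.contMDiffWithinAt)
    (fun z hz _ => by
      simp only [f']
      rw [hs2 z (hA z hz).1, e1 _ (hA z hz).2, Φ.symm_apply_apply (hA z hz).2])
    (fun z hz _ => by
      have h2 : g₀ • s (f' z).2 = (g₀ * (f' z).1⁻¹) • s' z := by
        rw [mul_smul, ← hfs' z (hB z hz).1, inv_smul_smul]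
      simp only [f]
      rw [h2, e1' _ (hB z hz).2, Φ'.symm_apply_apply (hB z hz).2])
  refine ⟨h, fun z => (f z).1⁻¹ * g₀, hyh, by rw [hhf, hfy], fun z hz => ?_, fun z hz => ?_⟩
  · exact ((hf z (hA z (hhA hz)).1).fst.inv.mul contMDiffAt_const).contMDiffWithinAt
  · rw [hhf, hs2 z (hA z (hhA hz)).1]

/-- Slice charts are compatible with each other. -/
theorem OrbifoldChart.IsSliceChart.compatible
    {c c' : OrbifoldChart m (MulAction.orbitRel.Quotient G X)}
    (hc : c.IsSliceChart (d := d) (n := n) G X) (hc' : c'.IsSliceChart (d := d) (n := n) G X) :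
    c.Compatible c' := by
  obtain ⟨s, hs, hcs⟩ := hc
  obtain ⟨s', hs', hcs'⟩ := hc'
  intro y y' hyy
  rw [hcs, hcs'] at hyy
  obtain ⟨g₀, hg⟩ := Quotient.exact hyy.symm
  obtain ⟨h, b, hy, hhy, -, hb⟩ := hs.exists_transition hs' hg
  refine ⟨h, fun z hz => ?_, hy, hhy⟩
  rw [hcs, hcs', hb z hz]
  exact Quotient.sound ⟨b z, rfl⟩

/-- An orbifold structure of an orbit space whose charts are slice charts is the canonical one. -/
theorem Orbifold.isOrbitSpace_of_isSliceChart
    (𝓞 : Orbifold m (MulAction.orbitRel.Quotient G X))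
    (h : ∀ c ∈ 𝓞.charts, c.IsSliceChart (d := d) (n := n) G X) :
    𝓞.IsOrbitSpace (d := d) (n := n) := by
  -- a chart compatible with all slice charts is compatible with the given atlas, hence belongs to
  -- it
  refine Subset.antisymm (fun c hc c' hc' => (h c hc).compatible hc') fun c hc => ?_
  exact 𝓞.maximal c fun c' hc' => hc c' (h c' hc')

end Slice

/-! ### Transport of orbifold structures, and the orbit space of the frame bundle -/

section Transport

variable {m : ℕ} {M : Type u} [TopologicalSpace M] {N : Type v} [TopologicalSpace N]

theorem OrbifoldChart.map_symm_map (c : OrbifoldChart m M) (φ : M ≃ₜ N) :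
    (c.map φ).map φ.symm = c := by
  obtain ⟨⟩ := c
  simp [OrbifoldChart.map, ← Function.comp_assoc]

theorem OrbifoldChart.compatible_map_iff {c c' : OrbifoldChart m M} (φ : M ≃ₜ N) :
    (c.map φ).Compatible (c'.map φ) ↔ c.Compatible c' := by
  simp [Compatible, IsTransition]

/-- The orbifold structure on `N` that makes a homeomorphism `φ : M → N` a diffeomorphism. -/
def Orbifold.transport (𝓜 : Orbifold m M) (φ : M ≃ₜ N) : Orbifold m N where
  t2 := by
    have := 𝓜.t2
    exact φ.symm.isEmbedding.t2Space
  charts := {c | c.map φ.symm ∈ 𝓜.charts}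
  compatible c hc c' hc' :=
    (OrbifoldChart.compatible_map_iff φ.symm).1 (𝓜.compatible _ hc _ hc')
  cover q := by
    obtain ⟨c, hc, y, hy⟩ := 𝓜.cover (φ.symm q)
    exact ⟨c.map φ, by rwa [mem_ofPred_eq, c.map_symm_map], y, by simp [hy]⟩
  maximal c hc := 𝓜.maximal _ fun c' hc' => by
    rw [← c'.map_symm_map φ, OrbifoldChart.compatible_map_iff]
    exact hc _ (by rwa [mem_ofPred_eq, c'.map_symm_map])

/-- A homeomorphism, as a diffeomorphism to the transported structure. -/
def Orbifold.transportDiffeo (𝓜 : Orbifold m M) (φ : M ≃ₜ N) : 𝓜.Diffeo (𝓜.transport φ) where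
  toHomeo := φ
  map_mem c hc := by
    change (c.map φ).map φ.symm ∈ 𝓜.charts
    rwa [c.map_symm_map]
  symm_map_mem _ hc := hc

end Transport

namespace Orbifold

variable {m : ℕ} {M : Type u} [TopologicalSpace M] {𝓜 : Orbifold m M} {μ : 𝓜.Metric}

theorem FrameBundle.base_eq_iff (q r : FrameBundle μ) :
    q.base = r.base ↔ ∃ g : Matrix.orthogonalGroup (Fin m) ℝ, g • r = q := by
  constructor
  · intro h
    obtain ⟨c, σ, p, rfl⟩ := exists_param r
    obtain ⟨g, rfl⟩ := σ.exists_param_of_base_eq (y := p.2) h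
    refine ⟨g * p.1⁻¹, ?_⟩
    rw [σ.smul_param, inv_mul_cancel_right]
  · rintro ⟨g, rfl⟩
    exact base_smul g r

theorem FrameBundle.surjective_base : Function.Surjective (base (μ := μ)) := by
  intro q
  obtain ⟨c, hc, y, rfl⟩ := 𝓜.cover q
  obtain ⟨σ⟩ := nonempty_frameField μ ⟨c, hc⟩
  exact ⟨_, σ.base_param (1, y)⟩

theorem FrameBundle.isOpenMap_base : IsOpenMap (base (μ := μ)) := by
  intro S hS
  rw [isOpen_iff_mem_nhds]
  rintro _ ⟨q, hq, rfl⟩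
  obtain ⟨c, σ, p, rfl⟩ := exists_param q
  have h1 : IsOpen (c.1.proj '' (Prod.snd '' (σ.param ⁻¹' S))) :=
    c.1.isOpenMap_proj _ (isOpenMap_snd _ (hS.preimage σ.continuous_param))
  refine mem_of_superset (h1.mem_nhds ⟨p.2, ⟨p, hq, rfl⟩, rfl⟩) ?_
  rintro _ ⟨_, ⟨r, hr, rfl⟩, rfl⟩
  exact ⟨_, hr, σ.base_param r⟩

/-- The base of the frame bundle is the space of orbits. -/
theorem FrameBundle.exists_homeomorph_orbits (μ : 𝓜.Metric) :
    ∃ φ : M ≃ₜ MulAction.orbitRel.Quotient (Matrix.orthogonalGroup (Fin m) ℝ) (FrameBundle μ),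
      ∀ q : FrameBundle μ, φ q.base = Quotient.mk _ q := by
  refine exists_homeomorph_of_isQuotientMap
    (isOpenMap_base.isQuotientMap continuous_base surjective_base) isQuotientMap_quotient_mk'
    fun q r => ?_
  rw [base_eq_iff]
  exact (Quotient.eq (r := MulAction.orbitRel _ _)).symm

/-- A chart of the orbit space of the frame bundle is a slice chart: a slice is given by an
orthonormal frame field. -/
theorem isSliceChart_of_mem_transport
    {φ : M ≃ₜ MulAction.orbitRel.Quotient (Matrix.orthogonalGroup (Fin m) ℝ) (FrameBundle μ)}
    (hφ : ∀ q : FrameBundle μ, φ q.base = Quotient.mk _ q) {c : OrbifoldChart m _}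
    (hc : c ∈ (𝓜.transport φ).charts) :
    c.IsSliceChart (d := orthDim m) (n := m + orthDim m) _ _ := by
  obtain ⟨σ⟩ := nonempty_frameField μ ⟨c.map φ.symm, hc⟩
  refine ⟨_, σ.isSlice, fun y => ?_⟩
  rw [← hφ]
  exact (φ.apply_symm_apply (c.proj y)).symm

end Orbifold

/-! ### Bundle transitions and the transport along frames -/

/-- Smoothness of a family of linear endomorphisms, tested on vectors. The endomorphisms are linear
over `𝕜`, whereas smoothness is meant in the real sense. -/
def LinSmoothAt {𝕜 : Type*} [RCLike 𝕜] {V : Type*} [NormedAddCommGroup V] [NormedSpace 𝕜 V]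
    [NormedSpace ℝ V] {F H X : Type*} [NormedAddCommGroup F] [NormedSpace ℝ F] [TopologicalSpace H]
    (I : ModelWithCorners ℝ F H) [TopologicalSpace X] [ChartedSpace H X]
    (L : X → V →ₗ[𝕜] V) (q : X) : Prop :=
  ∀ a, ContMDiffAt I 𝓘(ℝ, V) ∞ (fun r => L r a) q

namespace VectorOrbibundleChart

variable {m : ℕ} {𝕜 : Type x} [RCLike 𝕜] {V : Type w} [NormedAddCommGroup V] [NormedSpace 𝕜 V]
  [NormedSpace ℝ V] {E : Type v} {M : Type u} [TopologicalSpace E] [TopologicalSpace M] {p : E → M}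

/-- A local vector bundle map `(z, a) ↦ (h z, L z a)` over a change of charts `h` that is compatible
with the maps to the total space. Invertibility of the linear parts is not required, and the values
of `lin` outside the source of `h` do not matter. -/
structure Transition (c c' : VectorOrbibundleChart m 𝕜 V p) where
  toDiffeo : c.base.LocalDiffeo c'.base
  lin : c.base.U → V →ₗ[𝕜] V
  isTransition : c.base.IsTransition c'.base toDiffeo
  contMDiffOn : ContMDiffOn ((𝓡 m).prod 𝓘(ℝ, V)) 𝓘(ℝ, V) ∞
    (fun z : c.base.U × V => lin z.1 z.2) (toDiffeo.source ×ˢ univ)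
  totalMap_eq : ∀ z ∈ toDiffeo.source, ∀ a : V,
    c'.totalMap (toDiffeo z, lin z a) = c.totalMap (z, a)

namespace Transition

variable {c c' c'' : VectorOrbibundleChart m 𝕜 V p}

theorem contMDiffAt (β : c.Transition c') {y : c.base.U} (hy : y ∈ β.toDiffeo.source) (a : V) :
    ContMDiffAt ((𝓡 m).prod 𝓘(ℝ, V)) 𝓘(ℝ, V) ∞ (fun z : c.base.U × V => β.lin z.1 z.2) (y, a) :=
  β.contMDiffOn.contMDiffAt ((β.toDiffeo.open_source.prod isOpen_univ).mem_nhds ⟨hy, mem_univ a⟩)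

theorem linSmoothAt (β : c.Transition c') {y : c.base.U} (hy : y ∈ β.toDiffeo.source) :
    LinSmoothAt (𝓡 m) β.lin y := fun a =>
  ContMDiffAt.comp (g := fun z : c.base.U × V => β.lin z.1 z.2) (f := fun z => (z, a)) y
    (β.contMDiffAt hy a) (contMDiffAt_id.prodMk contMDiffAt_const)

variable (c) in
/-- The identity as a bundle transition. -/
def refl : c.Transition c where
  toDiffeo := c.base.reflDiffeo
  lin _ := LinearMap.id
  isTransition := OrbifoldChart.isTransition_refl
  contMDiffOn := contMDiff_snd.contMDiffOn
  totalMap_eq _ _ _ := rfl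

variable (c) in
/-- An element of the group of a chart as a bundle transition. -/
def act (γ : c.base.Γ) : c.Transition c where
  toDiffeo := c.base.smulDiffeo γ
  lin y := c.fib γ y
  isTransition := OrbifoldChart.isTransition_smulDiffeo γ
  contMDiffOn := (c.contMDiff_fib γ).contMDiffOn
  totalMap_eq y _ a := ((c.totalMap_eq_iff (y, a) _).2 ⟨γ, rfl⟩).symm

/-- The composition of bundle transitions. -/
def trans (β : c.Transition c') (β' : c'.Transition c'') : c.Transition c'' where
  toDiffeo := β.toDiffeo.trans β'.toDiffeo
  lin y := β'.lin (β.toDiffeo y) ∘ₗ β.lin y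
  isTransition := β.isTransition.trans β'.isTransition
  contMDiffOn := by
    rintro ⟨y, a⟩ ⟨hy, -⟩
    obtain ⟨hy, hy'⟩ := OrbifoldChart.mem_trans_source.1 hy
    have h1 : ContMDiffAt ((𝓡 m).prod 𝓘(ℝ, V)) (𝓡 m) ∞
        (fun z : c.base.U × V => β.toDiffeo z.1) (y, a) :=
      (β.toDiffeo.contMDiffAt hy).comp (y, a) contMDiffAt_fst
    exact (ContMDiffAt.comp (g := fun z : c'.base.U × V => β'.lin z.1 z.2)
      (f := fun z : c.base.U × V => (β.toDiffeo z.1, β.lin z.1 z.2)) (y, a)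
      (β'.contMDiffAt hy' (β.lin y a)) (h1.prodMk (β.contMDiffAt hy a))).contMDiffWithinAt
  totalMap_eq y hy a := by
    obtain ⟨hy, hy'⟩ := OrbifoldChart.mem_trans_source.1 hy
    exact (β'.totalMap_eq _ hy' _).trans (β.totalMap_eq _ hy a)

/-- A bundle transition is determined by the change of charts below it: this is clear at the points
with trivial isotropy, and these are dense. -/
theorem lin_eq (β β' : c.Transition c') {y : c.base.U} (hy : y ∈ β.toDiffeo.source)
    (hy' : y ∈ β'.toDiffeo.source) (h : ∀ᶠ z in 𝓝 y, β.toDiffeo z = β'.toDiffeo z) :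
    β.lin y = β'.lin y := by
  ext a
  by_contra hne
  have h1 : ∀ᶠ z in 𝓝 y, β.lin z a ≠ β'.lin z a :=
    (β.linSmoothAt hy a).continuousAt.ne_iff_eventually_ne
      (β'.linSmoothAt hy' a).continuousAt |>.1 hne
  have h2 : ∀ᶠ z in 𝓝 y, (β.toDiffeo z = β'.toDiffeo z ∧ β.lin z a ≠ β'.lin z a) ∧
      z ∈ β.toDiffeo.source ∧ z ∈ β'.toDiffeo.source :=
    by
    filter_upwards [h, h1, β.toDiffeo.open_source.mem_nhds hy, β'.toDiffeo.open_source.mem_nhds hy']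
      with z k1 k2 k3 k4 using ⟨⟨k1, k2⟩, k3, k4⟩
  have hyt : β.toDiffeo y ∈ β.toDiffeo.target := β.toDiffeo.apply_mem_target hy
  have h3 : Tendsto β.toDiffeo.symm (𝓝 (β.toDiffeo y)) (𝓝 y) := by
    have h4 := (β.toDiffeo.contMDiffAt_symm hyt).continuousAt
    rwa [ContinuousAt, β.toDiffeo.symm_apply_apply hy] at h4
  -- near `y` there is a point over a point `w` with trivial isotropy at which the values still
  -- differ
  obtain ⟨w, hw, hwt, ⟨hw1, hw2⟩, hw3, hw4⟩ := c'.base.dense_regular.inter_nhds_nonempty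
    (inter_mem (β.toDiffeo.open_target.mem_nhds hyt) (h3.eventually h2))
  have h5 := β.toDiffeo.apply_symm_apply hwt
  have h6 := (β.totalMap_eq _ hw3 a).trans (β'.totalMap_eq _ hw4 a).symm
  obtain ⟨γ, hγ⟩ := (c'.totalMap_eq_iff _ _).1 h6
  have h7 := congrArg Prod.fst hγ
  have h8 := congrArg Prod.snd hγ
  dsimp only at h7 h8
  rw [← hw1, h5] at h7
  obtain rfl := hw γ h7
  rw [c'.fib_one] at h8
  exact hw2 h8

end Transition

end VectorOrbibundleChart

namespace VectorOrbibundle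

open VectorOrbibundleChart Orbifold

variable {m : ℕ} {𝕜 : Type x} [RCLike 𝕜] {V : Type w} [NormedAddCommGroup V] [NormedSpace 𝕜 V]
  [NormedSpace ℝ V] {E : Type v} {M : Type u} [TopologicalSpace E] [TopologicalSpace M] {p : E → M}
  {𝓜 : Orbifold m M} {𝓑 : VectorOrbibundle 𝕜 V 𝓜 p} {μ : 𝓜.Metric}

/-- The orbifold chart below a bundle chart. -/
def baseChart (𝓑 : VectorOrbibundle 𝕜 V 𝓜 p) (c : 𝓑.charts) : 𝓜.charts :=
  ⟨c.1.base, 𝓑.base_mem c c.2⟩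

variable {c c' c'' : 𝓑.charts}

/-- A bundle transition takes one frame to another. -/
def Carries (β : c.1.Transition c'.1) (z : ChartFrame μ (𝓑.baseChart c))
    (z' : ChartFrame μ (𝓑.baseChart c')) : Prop :=
  ∃ hz : z.1.1 ∈ β.toDiffeo.source, z.push β.toDiffeo β.isTransition hz = z'

theorem Carries.mk_eq {β : c.1.Transition c'.1} {z : ChartFrame μ (𝓑.baseChart c)}
    {z' : ChartFrame μ (𝓑.baseChart c')} (h : Carries β z z') :
    FrameBundle.mk _ z = FrameBundle.mk _ z' := by
  obtain ⟨hz, rfl⟩ := h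
  exact (FrameBundle.mk_push (c := 𝓑.baseChart c) (c' := 𝓑.baseChart c') _ β.isTransition z hz).symm

theorem Carries.refl (z : ChartFrame μ (𝓑.baseChart c)) :
    Carries (Transition.refl c.1) z z := by
  refine ⟨mem_univ _, ChartFrame.ext' rfl fun i => ?_⟩
  change opensDeriv (fun z => z) _ _ = _
  rw [opensDeriv_id]
  rfl

theorem Carries.trans {β : c.1.Transition c'.1} {β' : c'.1.Transition c''.1}
    {z : ChartFrame μ (𝓑.baseChart c)} {z' : ChartFrame μ (𝓑.baseChart c')}
    {z'' : ChartFrame μ (𝓑.baseChart c'')} (h : Carries β z z') (h' : Carries β' z' z'') :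
    Carries (β.trans β') z z'' := by
  obtain ⟨hz, rfl⟩ := h
  obtain ⟨hz', rfl⟩ := h'
  refine ⟨⟨hz, hz'⟩, ChartFrame.ext' rfl fun i => ?_⟩
  exact congrArg (fun A => A (z.1.2 i)) (OrbifoldChart.differential_trans _ _ hz hz')

theorem Carries.rotate {β : c.1.Transition c'.1} {z : ChartFrame μ (𝓑.baseChart c)}
    {z' : ChartFrame μ (𝓑.baseChart c')} (h : Carries β z z')
    (g : Matrix.orthogonalGroup (Fin m) ℝ) : Carries β (z.rotate g) (z'.rotate g) := by
  obtain ⟨hz, rfl⟩ := h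
  exact ⟨hz, ChartFrame.rotate_push (c := 𝓑.baseChart c) (c' := 𝓑.baseChart c') _ β.isTransition
    z hz g⟩

/-- A transition of the base that takes a frame to another one is covered by a bundle transition. -/
theorem exists_carries {z : ChartFrame μ (𝓑.baseChart c)} {z' : ChartFrame μ (𝓑.baseChart c')}
    (h : FrameBundle.mk _ z = FrameBundle.mk _ z') :
    ∃ β : c.1.Transition c'.1, Carries β z z' := by
  obtain ⟨h, hh, hz, hzz⟩ := frameRel_iff.1 (FrameBundle.mk_eq_iff.1 h)
  obtain ⟨k, L, hk, hks, hkz, hL, htot⟩ := 𝓑.compatible c c.2 c' c'.2 z.1.1 z'.1.1 (by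
    rw [← hzz]
    exact (hh _ hz).symm)
  -- a bundle transition between the base points exists by compatibility; correct it by an element
  -- of the group, so that its base agrees with the given change of charts
  let β : c.1.Transition c'.1 := ⟨k, fun y => (L y).toLinearMap, hk, hL, htot⟩
  obtain ⟨γ, hγ⟩ := hk.eventually_eq_smul hh hks hz
  refine ⟨β.trans (Transition.act c'.1 γ), ⟨hks, mem_univ _⟩, ?_⟩
  rw [← hzz]
  refine ChartFrame.ext' hγ.self_of_nhds.symm fun i => ?_
  refine congrArg (fun A => A (z.1.2 i)) (?_ : opensDeriv _ _ = opensDeriv _ _)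
  exact opensDeriv_congr (hγ.mono fun w hw => hw.symm)

/-- The linear part of a bundle transition on a fibre is determined by the images of a frame at the
base point. -/
theorem Carries.lin_eq {β β' : c.1.Transition c'.1} {z : ChartFrame μ (𝓑.baseChart c)}
    {z' : ChartFrame μ (𝓑.baseChart c')} (h : Carries β z z') (h' : Carries β' z z') :
    β.lin z.1.1 = β'.lin z.1.1 := by
  obtain ⟨hz, rfl⟩ := h
  obtain ⟨hz', h'⟩ := h'
  refine β.lin_eq β' hz hz' (β.isTransition.eventually_eq β'.isTransition hz hz' ?_ ?_)
  · exact (congrArg (fun w => w.1.1) h').symm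
  · exact eq_of_eq_on_frame z.2 fun i => (congrArg (fun w => w.1.2 i) h').symm

open Classical in
/-- The identification of the fibres over two frames that represent the same element of the frame
bundle: the linear part of any bundle transition that takes one frame to the other. -/
def transport (z : ChartFrame μ (𝓑.baseChart c)) (z' : ChartFrame μ (𝓑.baseChart c')) : V →ₗ[𝕜] V :=
  if h : ∃ β : c.1.Transition c'.1, Carries β z z' then h.choose.lin z.1.1 else 0

theorem Carries.transport_eq {β : c.1.Transition c'.1} {z : ChartFrame μ (𝓑.baseChart c)}
    {z' : ChartFrame μ (𝓑.baseChart c')} (h : Carries β z z') : transport z z' = β.lin z.1.1 := by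
  have h1 : ∃ β : c.1.Transition c'.1, Carries β z z' := ⟨β, h⟩
  rw [transport, dif_pos h1]
  exact h1.choose_spec.lin_eq h

theorem transport_self (z : ChartFrame μ (𝓑.baseChart c)) : transport z z = LinearMap.id :=
  (Carries.refl z).transport_eq

theorem transport_trans {z : ChartFrame μ (𝓑.baseChart c)} {z' : ChartFrame μ (𝓑.baseChart c')}
    {z'' : ChartFrame μ (𝓑.baseChart c'')} (h : FrameBundle.mk _ z = FrameBundle.mk _ z')
    (h' : FrameBundle.mk _ z' = FrameBundle.mk _ z'') (a : V) :
    transport z' z'' (transport z z' a) = transport z z'' a := by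
  obtain ⟨β, hβ⟩ := exists_carries h
  obtain ⟨β', hβ'⟩ := exists_carries h'
  rw [hβ.transport_eq, hβ'.transport_eq, (hβ.trans hβ').transport_eq]
  obtain ⟨hz, rfl⟩ := hβ
  rfl

/-- The transport does not change if both frames are rotated by the same element, since the same
transition carries the rotated frames. This makes the action of `O(m)` well defined. -/
theorem transport_rotate {z : ChartFrame μ (𝓑.baseChart c)} {z' : ChartFrame μ (𝓑.baseChart c')}
    (h : FrameBundle.mk _ z = FrameBundle.mk _ z') (g : Matrix.orthogonalGroup (Fin m) ℝ) :
    transport (z.rotate g) (z'.rotate g) = transport z z' := by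
  obtain ⟨β, hβ⟩ := exists_carries h
  rw [hβ.transport_eq, (hβ.rotate g).transport_eq]
  rfl

theorem totalMap_transport {z : ChartFrame μ (𝓑.baseChart c)} {z' : ChartFrame μ (𝓑.baseChart c')}
    (h : FrameBundle.mk _ z = FrameBundle.mk _ z') (a : V) :
    c'.1.totalMap (z'.1.1, transport z z' a) = c.1.totalMap (z.1.1, a) := by
  obtain ⟨β, hβ⟩ := exists_carries h
  rw [hβ.transport_eq]
  obtain ⟨hz, rfl⟩ := hβ
  exact β.totalMap_eq _ hz a

/-- If two pairs of a point and a vector represent the same element of the total space, then a frame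
at one point corresponds to a frame at the other one such that the transport between these frames
takes one vector to the other. -/
theorem exists_frame_of_totalMap_eq {z : ChartFrame μ (𝓑.baseChart c)} {y' : c'.1.base.U} {a a' : V}
    (h : c.1.totalMap (z.1.1, a) = c'.1.totalMap (y', a')) :
    ∃ z' : ChartFrame μ (𝓑.baseChart c'), z'.1.1 = y' ∧
      FrameBundle.mk _ z = FrameBundle.mk _ z' ∧ transport z z' a = a' := by
  have h1 : c.1.base.proj z.1.1 = c'.1.base.proj y' := by
    have := congrArg p h
    rwa [c.1.proj_totalMap, c'.1.proj_totalMap] at this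
  obtain ⟨z₁, hz₁, hz⟩ := FrameBundle.exists_mk_of_base_eq (c := 𝓑.baseChart c')
    (q := FrameBundle.mk (𝓑.baseChart c) z) (y := y') h1
  obtain ⟨β, hβ⟩ := exists_carries hz.symm
  have h2 := (totalMap_transport hz.symm a).trans h
  obtain ⟨γ, hγ⟩ := (c'.1.totalMap_eq_iff _ _).1 h2
  have hβ' : Carries (β.trans (Transition.act c'.1 γ)) z
      (z₁.push (c := 𝓑.baseChart c') (c' := 𝓑.baseChart c') (c'.1.base.smulDiffeo γ)
        (OrbifoldChart.isTransition_smulDiffeo γ) (mem_univ _)) :=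
    hβ.trans (β' := Transition.act c'.1 γ) ⟨mem_univ _, rfl⟩
  refine ⟨_, congrArg Prod.fst hγ, hβ'.mk_eq, ?_⟩
  rw [hβ'.transport_eq]
  have h3 := congrArg Prod.snd hγ
  dsimp only at h3
  rw [hβ.transport_eq] at h3
  obtain ⟨hz, rfl⟩ := hβ
  exact h3

/-- The transport depends smoothly on the frames as long as the base points do, and the frames
continuously. -/
theorem linSmoothAt_transport {F H Y : Type*} [NormedAddCommGroup F] [NormedSpace ℝ F]
    [TopologicalSpace H] {I : ModelWithCorners ℝ F H} [TopologicalSpace Y] [ChartedSpace H Y]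
    {f : Y → ChartFrame μ (𝓑.baseChart c)} {f' : Y → ChartFrame μ (𝓑.baseChart c')} {t : Y}
    (hf : ContinuousAt f t) (hf' : ContinuousAt f' t)
    (hs : ContMDiffAt I (𝓡 m) ∞ (fun r => ((f r).1.1 : c.1.base.U)) t)
    (h : ∀ᶠ r in 𝓝 t, FrameBundle.mk _ (f r) = FrameBundle.mk _ (f' r)) :
    LinSmoothAt I (fun r => transport (f r) (f' r)) t := by
  obtain ⟨β, hβ⟩ := exists_carries h.self_of_nhds
  have hβ' := hβ
  obtain ⟨hz, hzz⟩ := hβ'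
  intro a
  let b : Y → c.1.base.U := fun r => (f r).1.1
  refine (ContMDiffAt.comp (g := fun y : c.1.base.U => β.lin y a) (f := b) t
    (β.linSmoothAt hz a) hs).congr_of_eventuallyEq ?_
  classical
  -- near `t` a single transition `β` carries `f` to `f'`: the images `k` of the frames under `β`
  -- represent the same elements of the frame bundle as `f'`, and they agree with `f'` at `t`
  let k : Y → ChartFrame μ (𝓑.baseChart c') := fun r =>
    if hr : (f r).1.1 ∈ β.toDiffeo.source then
      (f r).push (c := 𝓑.baseChart c) (c' := 𝓑.baseChart c') β.toDiffeo β.isTransition hr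
    else f' t
  have hsrc : ∀ᶠ r in 𝓝 t, (f r).1.1 ∈ β.toDiffeo.source :=
    hs.continuousAt.eventually (β.toDiffeo.open_source.mem_nhds hz)
  have hkt : k t = f' t := (dif_pos hz).trans hzz
  have hk : ContinuousAt k t := by
    have h2 : Topology.IsInducing fun z : ChartFrame μ (𝓑.baseChart c') => z.1 := ⟨rfl⟩
    refine h2.continuousAt_iff.2 ?_
    refine (ContinuousAt.comp (f := f) (FrameBundle.continuousAt_push_val (c := 𝓑.baseChart c)
      (c' := 𝓑.baseChart c') β.toDiffeo hz) hf).congr ?_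
    filter_upwards [hsrc] with r hr
    have h3 : k r = _ := dif_pos hr
    exact congrArg Subtype.val h3.symm
  have h2 : ∀ᶠ r in 𝓝 t, FrameBundle.mk _ (k r) = FrameBundle.mk _ (f' r) → k r = f' r := by
    have h3 := hk.prodMk hf'
    rw [ContinuousAt, hkt] at h3
    exact h3.eventually (FrameBundle.eventually_eq_of_mk_eq (f' t))
  filter_upwards [h2, hsrc, h] with r hr hrs hrh
  have h4 : k r = _ := dif_pos hrs
  have h5 := FrameBundle.mk_push (c := 𝓑.baseChart c) (c' := 𝓑.baseChart c') _ β.isTransition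
    (f r) hrs
  rw [h4] at hr
  have h6 : Carries β (f r) (f' r) := ⟨hrs, hr (h5.trans hrh)⟩
  rw [h6.transport_eq]
  rfl

end VectorOrbibundle

/-! ### Smooth families of linear maps -/

section LinSmooth

variable {F H Y : Type*} [NormedAddCommGroup F] [NormedSpace ℝ F] [TopologicalSpace H]
  {I : ModelWithCorners ℝ F H} [TopologicalSpace Y] [ChartedSpace H Y]
  {𝕜 : Type*} [RCLike 𝕜] {V : Type*} [NormedAddCommGroup V] [NormedSpace 𝕜 V] [NormedSpace ℝ V]

/-- In finite dimensions, a family of linear maps is smooth if its values on each vector are. -/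
theorem contMDiffAt_clm_of_apply [FiniteDimensional ℝ V] {A : Y → V →L[ℝ] V} {t : Y}
    (h : ∀ a, ContMDiffAt I 𝓘(ℝ, V) ∞ (fun r => A r a) t) :
    ContMDiffAt I 𝓘(ℝ, V →L[ℝ] V) ∞ A t := by
  let b := Module.finBasis ℝ V
  let l : ∀ i, V →L[ℝ] V →L[ℝ] V := fun i =>
    ContinuousLinearMap.smulRightL ℝ V V (LinearMap.toContinuousLinearMap (b.coord i))
  have h1 : A = fun r => ∑ i, l i (A r (b i)) := by
    funext r
    ext a
    conv_lhs => rw [← b.sum_repr a]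
    simp [l, sum_apply, -Module.Basis.sum_repr]
  rw [h1]
  exact ContMDiffAt.sum fun i _ => (l i).contMDiff.contMDiffAt.comp t (h (b i))

theorem finiteDimensional_real_of_rclike (𝕜 V : Type*) [RCLike 𝕜] [NormedAddCommGroup V]
    [NormedSpace 𝕜 V] [NormedSpace ℝ V] [IsScalarTower ℝ 𝕜 V] [FiniteDimensional 𝕜 V] :
    FiniteDimensional ℝ V :=
  Module.Finite.trans 𝕜 V

variable [IsScalarTower ℝ 𝕜 V] [FiniteDimensional 𝕜 V]

/-- An endomorphism over `𝕜` as a continuous real-linear map. -/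
def LinearMap.toRealCLM (L : V →ₗ[𝕜] V) : V →L[ℝ] V :=
  haveI := finiteDimensional_real_of_rclike 𝕜 V
  LinearMap.toContinuousLinearMap (L.restrictScalars ℝ)

theorem LinearMap.toRealCLM_apply (L : V →ₗ[𝕜] V) (a : V) : L.toRealCLM a = L a := rfl

theorem LinSmoothAt.toRealCLM {L : Y → V →ₗ[𝕜] V} {t : Y} (h : LinSmoothAt I L t) :
    ContMDiffAt I 𝓘(ℝ, V →L[ℝ] V) ∞ (fun r => (L r).toRealCLM) t :=
  haveI := finiteDimensional_real_of_rclike 𝕜 V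
  contMDiffAt_clm_of_apply h

theorem LinSmoothAt.apply {L : Y → V →ₗ[𝕜] V} {t : Y} (h : LinSmoothAt I L t) {a : Y → V}
    (ha : ContMDiffAt I 𝓘(ℝ, V) ∞ a t) : ContMDiffAt I 𝓘(ℝ, V) ∞ (fun r => L r (a r)) t :=
  h.toRealCLM.clm_apply ha

end LinSmooth

/-! ### Equivariant vector bundles from cocycles -/

/-- The cocycle of a `G`-vector bundle: over the open sets of a covering the bundle is trivial, and
`map i j g q` expresses the action of `g` from the fibre over `q` to the fibre over `g • q` in the
trivializations `i` and `j`. For `g = 1` these maps are the changes of trivializations. Unlike in a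
`VectorBundleCore`, one cocycle carries both the bundle and the action. -/
structure EquivariantCore {d n : ℕ} (G : Type*) [Group G] [TopologicalSpace G]
    [ChartedSpace (EuclideanSpace ℝ (Fin d)) G]
    (X : Type*) [TopologicalSpace X] [ChartedSpace (EuclideanSpace ℝ (Fin n)) X] [MulAction G X]
    (𝕜 : Type*) [RCLike 𝕜] (V : Type*) [NormedAddCommGroup V] [NormedSpace 𝕜 V] [NormedSpace ℝ V]
    (ι : Type*) where
  baseSet : ι → Set X
  isOpen_baseSet : ∀ i, IsOpen (baseSet i)
  indexAt : X → ι
  mem_baseSet_at : ∀ q, q ∈ baseSet (indexAt q)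
  map : ι → ι → G → X → V →ₗ[𝕜] V
  map_one : ∀ i, ∀ q ∈ baseSet i, ∀ a, map i i 1 q a = a
  map_mul : ∀ i j k g h q, q ∈ baseSet i → h • q ∈ baseSet j → (g * h) • q ∈ baseSet k →
    ∀ a, map j k g (h • q) (map i j h q a) = map i k (g * h) q a
  linSmoothAt_map : ∀ i j g q, q ∈ baseSet i → g • q ∈ baseSet j →
    LinSmoothAt ((𝓡 d).prod (𝓡 n)) (fun z : G × X => map i j z.1 z.2) (g, q)

namespace EquivariantCore

open Bundle

variable {d n : ℕ} {G : Type v} [Group G] [TopologicalSpace G]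
  [ChartedSpace (EuclideanSpace ℝ (Fin d)) G]
  {X : Type u} [TopologicalSpace X] [ChartedSpace (EuclideanSpace ℝ (Fin n)) X] [MulAction G X]
  {𝕜 : Type x} [RCLike 𝕜] {V : Type w} [NormedAddCommGroup V] [NormedSpace 𝕜 V] [NormedSpace ℝ V]
  {ι : Type*} (C : EquivariantCore (d := d) (n := n) G X 𝕜 V ι)

theorem map_one_comp (i j k : ι) {q : X} (hi : q ∈ C.baseSet i) (hj : q ∈ C.baseSet j)
    (hk : q ∈ C.baseSet k) (a : V) : C.map j k 1 q (C.map i j 1 q a) = C.map i k 1 q a := by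
  have h1 := C.map_mul i j k 1 1 q hi (by rwa [one_smul]) (by rwa [mul_one, one_smul]) a
  rwa [one_smul, mul_one] at h1

theorem linSmoothAt_map_one (i j : ι) {q : X} (hi : q ∈ C.baseSet i) (hj : q ∈ C.baseSet j) :
    LinSmoothAt (𝓡 n) (fun r => C.map i j 1 r) q := fun a =>
  ContMDiffAt.comp (g := fun z : G × X => C.map i j z.1 z.2 a) (f := fun r => ((1 : G), r)) q
    (C.linSmoothAt_map i j 1 q hi (by rwa [one_smul]) a) (contMDiffAt_const.prodMk contMDiffAt_id)

variable [FiniteDimensional 𝕜 V]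

/-- The vector bundle over `𝕜` given by the cocycle. -/
def vectorCore : VectorBundleCore 𝕜 X V ι where
  baseSet := C.baseSet
  isOpen_baseSet := C.isOpen_baseSet
  indexAt := C.indexAt
  mem_baseSet_at := C.mem_baseSet_at
  coordChange i j q := LinearMap.toContinuousLinearMap (C.map i j 1 q)
  coordChange_self i q hq a := C.map_one i q hq a
  continuousOn_coordChange i j := by
    rw [continuousOn_clm_apply]
    exact fun a q hq => (C.linSmoothAt_map_one i j hq.1 hq.2 a).continuousAt.continuousWithinAt
  coordChange_comp i j k q hq a := C.map_one_comp i j k hq.1.1 hq.1.2 hq.2 a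

/-- The element of the fibre over `q` with coordinate `a` in the trivialization `i`. -/
def point (i : ι) (q : X) (a : V) : TotalSpace V C.vectorCore.Fiber :=
  ⟨q, C.map i (C.indexAt q) 1 q a⟩

theorem localTriv_point (i j : ι) {q : X} (hi : q ∈ C.baseSet i) (hj : q ∈ C.baseSet j) (a : V) :
    C.vectorCore.localTriv j (C.point i q a) = (q, C.map i j 1 q a) :=
  Prod.ext rfl (C.map_one_comp i (C.indexAt q) j hi (C.mem_baseSet_at q) hj a)

theorem point_eq_point (i j : ι) {q : X} (hi : q ∈ C.baseSet i) (hj : q ∈ C.baseSet j) (a : V) :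
    C.point i q a = C.point j q (C.map i j 1 q a) :=
  congrArg (TotalSpace.mk q) (C.map_one_comp i j (C.indexAt q) hi hj (C.mem_baseSet_at q) a).symm

theorem point_injective (i : ι) {q : X} (hi : q ∈ C.baseSet i) :
    Function.Injective (C.point i q) := fun a b h => by
  have h1 := congrArg (fun e => (C.vectorCore.localTriv i e).2) h
  simp only [C.localTriv_point i i hi hi, C.map_one i q hi] at h1
  exact h1

theorem exists_point (i : ι) (e : TotalSpace V C.vectorCore.Fiber) (he : e.1 ∈ C.baseSet i) :
    ∃ a, C.point i e.1 a = e :=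
  ⟨C.map (C.indexAt e.1) i 1 e.1 e.2, congrArg (TotalSpace.mk e.1)
    ((C.map_one_comp _ i _ (C.mem_baseSet_at e.1) he (C.mem_baseSet_at e.1) e.2).trans
      (C.map_one _ _ (C.mem_baseSet_at e.1) _))⟩

/-- The inverse of the trivialization `i` on the fibre over `q`. -/
def fibreEquiv (i : ι) {q : X} (hi : q ∈ C.baseSet i) : V ≃ₗ[𝕜] C.vectorCore.Fiber q :=
  LinearEquiv.ofLinearMap (M₂ := C.vectorCore.Fiber q) (C.map i (C.indexAt q) 1 q)
    (C.map (C.indexAt q) i 1 q)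
    (LinearMap.ext fun a =>
      (C.map_one_comp _ _ _ (C.mem_baseSet_at q) hi (C.mem_baseSet_at q) a).trans
      (C.map_one _ q (C.mem_baseSet_at q) a))
    (LinearMap.ext fun a => (C.map_one_comp _ _ _ hi (C.mem_baseSet_at q) hi a).trans
      (C.map_one i q hi a))

/-- The trivialization `i`, as a map to the total space, is a local homeomorphism. -/
theorem map_nhds_point (i : ι) {q : X} (hi : q ∈ C.baseSet i) (a : V) :
    Filter.map (fun z : X × V => C.point i z.1 z.2) (𝓝 (q, a)) = 𝓝 (C.point i q a) :=
  (C.vectorCore.localTriv i).toOpenPartialHomeomorph.symm.map_nhds_eq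
    ((C.vectorCore.mem_localTriv_target i (q, a)).2 hi)

/-- The action of `g` on the total space, in terms of the preferred trivializations at `q` and at
`g • q`. -/
instance : MulAction G (TotalSpace V C.vectorCore.Fiber) where
  smul g e := ⟨g • e.1, C.map (C.indexAt e.1) (C.indexAt (g • e.1)) g e.1 e.2⟩
  one_smul := by
    rintro ⟨q, a⟩
    -- the points `1 • q` and `q` are equal but not definitionally so, hence the generalization to
    -- `q'`
    have h1 : ∀ q', q' = q → (⟨q', C.map (C.indexAt q) (C.indexAt q') 1 q a⟩ :
        TotalSpace V C.vectorCore.Fiber) = ⟨q, a⟩ := by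
      rintro _ rfl
      exact congrArg (TotalSpace.mk _) (C.map_one _ _ (C.mem_baseSet_at _) a)
    exact h1 _ (one_smul G q)
  mul_smul g h := by
    rintro ⟨q, a⟩
    have h1 : ∀ q', q' = g • h • q →
        (⟨q', C.map (C.indexAt q) (C.indexAt q') (g * h) q a⟩ : TotalSpace V C.vectorCore.Fiber) =
        ⟨g • h • q, C.map (C.indexAt (h • q)) (C.indexAt (g • h • q)) g (h • q)
          (C.map (C.indexAt q) (C.indexAt (h • q)) h q a)⟩ := by
      rintro _ rfl
      refine congrArg (TotalSpace.mk _) (C.map_mul _ _ _ g h q (C.mem_baseSet_at _)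
        (C.mem_baseSet_at _) ?_ a).symm
      rw [mul_smul]
      exact C.mem_baseSet_at _
    exact h1 _ (mul_smul g h q)

theorem smul_point (i j : ι) (g : G) {q : X} (hi : q ∈ C.baseSet i) (hj : g • q ∈ C.baseSet j)
    (a : V) : g • C.point i q a = C.point j (g • q) (C.map i j g q a) := by
  refine congrArg (TotalSpace.mk (g • q)) ?_
  have h1 := C.map_mul i (C.indexAt q) (C.indexAt (g • q)) g 1 q hi
    (by rw [one_smul]; exact C.mem_baseSet_at q) (by rw [mul_one]; exact C.mem_baseSet_at _) a
  have h2 := C.map_mul i j (C.indexAt (g • q)) 1 g q hi hj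
    (by rw [one_mul]; exact C.mem_baseSet_at _) a
  rw [one_smul, mul_one] at h1
  rw [one_mul] at h2
  exact h1.trans h2.symm

variable [IsScalarTower ℝ 𝕜 V]

instance (q : X) : Module ℝ (C.vectorCore.Fiber q) := inferInstanceAs (Module ℝ V)

instance (q : X) : IsScalarTower ℝ 𝕜 (C.vectorCore.Fiber q) :=
  inferInstanceAs (IsScalarTower ℝ 𝕜 V)

theorem isLinear_localTriv (i : ι) : (C.vectorCore.localTriv i).IsLinear ℝ where
  linear q _ := by
    constructor
    · intro a b
      exact map_add (C.map (C.indexAt q) i 1 q) a b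
    · intro r a
      exact ((C.map (C.indexAt q) i 1 q).restrictScalars ℝ).map_smul r a

theorem coordChangeL_eq (i j : ι) {q : X} (hi : q ∈ C.baseSet i) (hj : q ∈ C.baseSet j) :
    haveI := C.isLinear_localTriv i
    haveI := C.isLinear_localTriv j
    ((C.vectorCore.localTriv i).coordChangeL ℝ (C.vectorCore.localTriv j) q : V →L[ℝ] V) =
      (C.map i j 1 q).toRealCLM := by
  have := C.isLinear_localTriv i
  have := C.isLinear_localTriv j
  ext a
  refine (Trivialization.coordChangeL_apply' _ _ ⟨hi, hj⟩ a).trans ?_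
  exact congrArg Prod.snd (C.localTriv_point i j hi hj a)

instance : VectorBundle ℝ V C.vectorCore.Fiber where
  trivialization_linear' := by
    rintro _ ⟨i, rfl⟩
    exact C.isLinear_localTriv i
  continuousOn_coordChange' := by
    rintro _ _ ⟨i, rfl⟩ ⟨j, rfl⟩
    intro q hq
    refine ContinuousWithinAt.congr
      (C.linSmoothAt_map_one i j hq.1 hq.2).toRealCLM.continuousAt.continuousWithinAt
      (fun r hr => C.coordChangeL_eq i j hr.1 hr.2) (C.coordChangeL_eq i j hq.1 hq.2)

instance : ContMDiffVectorBundle ∞ V C.vectorCore.Fiber (𝓡 n) where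
  contMDiffOn_coordChangeL := by
    rintro _ _ ⟨i, rfl⟩ ⟨j, rfl⟩
    intro q hq
    refine ContMDiffWithinAt.congr
      (C.linSmoothAt_map_one i j hq.1 hq.2).toRealCLM.contMDiffWithinAt
      (fun r hr => C.coordChangeL_eq i j hr.1 hr.2) (C.coordChangeL_eq i j hq.1 hq.2)

section Smooth

variable {F H Y : Type*} [NormedAddCommGroup F] [NormedSpace ℝ F] [TopologicalSpace H]
  {I : ModelWithCorners ℝ F H} [TopologicalSpace Y] [ChartedSpace H Y]

theorem contMDiffAt_point (i : ι) {f : Y → X} {a : Y → V} {t : Y} (hi : f t ∈ C.baseSet i)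
    (hf : ContMDiffAt I (𝓡 n) ∞ f t) (ha : ContMDiffAt I 𝓘(ℝ, V) ∞ a t) :
    ContMDiffAt I ((𝓡 n).prod 𝓘(ℝ, V)) ∞ (fun r => C.point i (f r) (a r)) t := by
  have : MemTrivializationAtlas (C.vectorCore.localTriv i) := ⟨mem_range_self i⟩
  refine ((C.vectorCore.localTriv i).contMDiffAt_iff (IB := 𝓡 n)
    (f := fun r => C.point i (f r) (a r)) hi).2 ⟨hf, ?_⟩
  refine ha.congr_of_eventuallyEq ?_
  filter_upwards [hf.continuousAt.eventually ((C.isOpen_baseSet i).mem_nhds hi)] with r hr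
  rw [C.localTriv_point i i hr hr, C.map_one i _ hr]

end Smooth

/-- In the trivializations, the action is `(g, q, a) ↦ (g • q, map i j g q a)`. -/
theorem contMDiff_smul (hG : ContMDiff ((𝓡 d).prod (𝓡 n)) (𝓡 n) ∞ fun z : G × X => z.1 • z.2) :
    ContMDiff ((𝓡 d).prod ((𝓡 n).prod 𝓘(ℝ, V))) ((𝓡 n).prod 𝓘(ℝ, V)) ∞
      (fun z : G × TotalSpace V C.vectorCore.Fiber => z.1 • z.2) := by
  rintro ⟨g, e⟩
  let i := C.indexAt e.1
  let j := C.indexAt (g • e.1)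
  have hi : e.1 ∈ C.baseSet i := C.mem_baseSet_at _
  have hj : g • e.1 ∈ C.baseSet j := C.mem_baseSet_at _
  have : MemTrivializationAtlas (C.vectorCore.localTriv i) := ⟨mem_range_self i⟩
  have hpr : ContMDiffAt ((𝓡 d).prod ((𝓡 n).prod 𝓘(ℝ, V))) ((𝓡 d).prod (𝓡 n)) ∞
      (fun z : G × TotalSpace V C.vectorCore.Fiber => (z.1, z.2.1)) (g, e) :=
    contMDiffAt_fst.prodMk
      ((contMDiff_proj C.vectorCore.Fiber).contMDiffAt.comp (g, e) contMDiffAt_snd)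
  have hco : ContMDiffAt ((𝓡 d).prod ((𝓡 n).prod 𝓘(ℝ, V))) 𝓘(ℝ, V) ∞
      (fun z : G × TotalSpace V C.vectorCore.Fiber => (C.vectorCore.localTriv i z.2).2) (g, e) :=
    (((C.vectorCore.localTriv i).contMDiffAt_iff (IB := 𝓡 n)
      (f := fun z : G × TotalSpace V C.vectorCore.Fiber => z.2) (x₀ := (g, e)) hi).1
      contMDiffAt_snd).2
  have hmap : LinSmoothAt ((𝓡 d).prod ((𝓡 n).prod 𝓘(ℝ, V)))
      (fun z : G × TotalSpace V C.vectorCore.Fiber => C.map i j z.1 z.2.1) (g, e) := fun a =>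
    ContMDiffAt.comp (g := fun z : G × X => C.map i j z.1 z.2 a)
      (f := fun z : G × TotalSpace V C.vectorCore.Fiber => (z.1, z.2.1)) (g, e)
      (C.linSmoothAt_map i j g e.1 hi hj a) hpr
  have hsm : ContMDiffAt ((𝓡 d).prod ((𝓡 n).prod 𝓘(ℝ, V))) (𝓡 n) ∞
      (fun z : G × TotalSpace V C.vectorCore.Fiber => z.1 • z.2.1) (g, e) :=
    ContMDiffAt.comp (g := fun z : G × X => z.1 • z.2)
      (f := fun z : G × TotalSpace V C.vectorCore.Fiber => (z.1, z.2.1)) (g, e) hG.contMDiffAt hpr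
  refine (C.contMDiffAt_point j (t := (g, e))
    (f := fun z : G × TotalSpace V C.vectorCore.Fiber => z.1 • z.2.1) hj hsm
    (hmap.apply hco)).congr_of_eventuallyEq ?_
  have hpc := hpr.snd.continuousAt.eventually ((C.isOpen_baseSet i).mem_nhds hi)
  filter_upwards [hpc, hsm.continuousAt.eventually ((C.isOpen_baseSet j).mem_nhds hj)]
    with z hz hz'
  obtain ⟨a, ha⟩ := C.exists_point i z.2 hz
  have h3 : (C.vectorCore.localTriv i z.2).2 = a := by
    rw [← ha, C.localTriv_point i i hz hz, C.map_one i _ hz]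
  rw [h3, ← C.smul_point i j z.1 hz hz', ha]

/-- The `G`-vector bundle given by a cocycle. -/
def toGVectorBundle
    (hG : ContMDiff ((𝓡 d).prod (𝓡 n)) (𝓡 n) ∞ fun z : G × X => z.1 • z.2) :
    GVectorBundle (d := d) (n := n) G X 𝕜 V where
  Fiber := C.vectorCore.Fiber
  smul_linear g q := ⟨C.map (C.indexAt q) (C.indexAt (g • q)) g q, fun _ => rfl⟩
  contMDiff_smul := C.contMDiff_smul hG

end EquivariantCore

/-! ### Slice charts of orbit bundles -/

section Inverse

variable {V : Type*} [NormedAddCommGroup V] [NormedSpace ℝ V] [FiniteDimensional ℝ V]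

theorem exists_continuousLinearEquiv_of_injective {A : V →L[ℝ] V} (hA : Function.Injective A) :
    ∃ e : V ≃L[ℝ] V, (e : V →L[ℝ] V) = A :=
  ⟨(LinearEquiv.ofInjectiveEndo A.toLinearMap hA).toContinuousLinearEquiv, by
    ext a
    rfl⟩

theorem ContinuousLinearMap.inverse_apply_of_injective {A : V →L[ℝ] V} (hA : Function.Injective A)
    (a : V) : A.inverse (A a) = a := by
  obtain ⟨e, rfl⟩ := exists_continuousLinearEquiv_of_injective hA
  simp

theorem contDiffAt_inverse_of_injective {A : V →L[ℝ] V} (hA : Function.Injective A) :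
    ContDiffAt ℝ ∞ (ContinuousLinearMap.inverse : (V →L[ℝ] V) → (V →L[ℝ] V)) A := by
  have := FiniteDimensional.complete ℝ V
  obtain ⟨e, rfl⟩ := exists_continuousLinearEquiv_of_injective hA
  exact contDiffAt_map_inverse e

end Inverse

namespace GVectorBundle

open Bundle

variable {d n m : ℕ} {G : Type v} [Group G] [TopologicalSpace G]
  [ChartedSpace (EuclideanSpace ℝ (Fin d)) G]
  {X : Type u} [TopologicalSpace X] [ChartedSpace (EuclideanSpace ℝ (Fin n)) X] [MulAction G X]
  {𝕜 : Type x} [RCLike 𝕜] {V : Type w} [NormedAddCommGroup V] [NormedSpace 𝕜 V] [NormedSpace ℝ V]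
  {B : GVectorBundle (d := d) (n := n) G X 𝕜 V} [FiniteDimensional 𝕜 V]

/-- The action of a group element between two fibres, in terms of frames of these fibres. -/
theorem exists_smul_eq {g : G} {q q' : X} (hq : g • q = q') (S : V ≃ₗ[𝕜] B.Fiber q)
    (S' : V ≃ₗ[𝕜] B.Fiber q') :
    ∃ L : V ≃ₗ[𝕜] V, ∀ a, (⟨q', S' (L a)⟩ : B.Total) = g • (⟨q, S a⟩ : B.Total) := by
  subst hq
  obtain ⟨A, hA⟩ := B.smul_linear g q
  have hinj : Function.Injective (S'.symm.toLinearMap ∘ₗ A ∘ₗ S.toLinearMap) := by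
    intro a a' h
    have h1 : A (S a) = A (S a') := S'.symm.injective h
    have h2 : g • (⟨q, S a⟩ : B.Total) = g • (⟨q, S a'⟩ : B.Total) := by rw [hA, hA, h1]
    exact S.injective (TotalSpace.mk_inj.1 (MulAction.injective g h2))
  refine ⟨LinearEquiv.ofInjectiveEndo _ hinj, fun a => ?_⟩
  rw [hA]
  exact congrArg (TotalSpace.mk (g • q)) (S'.apply_symm_apply (A (S a)))

variable [IsScalarTower ℝ 𝕜 V]

/-- The coordinates of a smooth map to the total space in terms of a smooth family of frames of the
fibres are smooth. -/
theorem contMDiffAt_coord {F H Y : Type*} [NormedAddCommGroup F] [NormedSpace ℝ F]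
    [TopologicalSpace H] {I : ModelWithCorners ℝ F H} [TopologicalSpace Y] [ChartedSpace H Y]
    {s : Y → X} {S : ∀ r, V ≃ₗ[𝕜] B.Fiber (s r)} {t : Y} {a : Y → V}
    (hs : ContMDiffAt I (𝓡 n) ∞ s t)
    (hS : ∀ a, ContMDiffAt I ((𝓡 n).prod 𝓘(ℝ, V)) ∞ (fun r => (⟨s r, S r a⟩ : B.Total)) t)
    (ha : ContMDiffAt I ((𝓡 n).prod 𝓘(ℝ, V)) ∞ (fun r => (⟨s r, S r (a r)⟩ : B.Total)) t) :
    ContMDiffAt I 𝓘(ℝ, V) ∞ a t := by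
  have := finiteDimensional_real_of_rclike 𝕜 V
  -- in a trivialization, the family of frames becomes a smooth family `R` of invertible matrices
  let e := trivializationAt V B.Fiber (s t)
  have he : s t ∈ e.baseSet := mem_baseSet_trivializationAt V B.Fiber (s t)
  let R : Y → V →ₗ[𝕜] V := fun r => e.linearMapAt 𝕜 (s r) ∘ₗ (S r).toLinearMap
  have hev : ∀ᶠ r in 𝓝 t, s r ∈ e.baseSet :=
    hs.continuousAt.eventually (e.open_baseSet.mem_nhds he)
  have hRe : ∀ r, s r ∈ e.baseSet → ∀ v, R r v = (e ⟨s r, S r v⟩).2 := fun r hr v =>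
    congrFun (e.coe_linearMapAt_of_mem hr) (S r v)
  have hRinj : ∀ r, s r ∈ e.baseSet → Function.Injective (R r).toRealCLM := by
    intro r hr v v' h
    have h1 : R r v = R r v' := h
    rw [hRe r hr, hRe r hr] at h1
    exact (S r).injective ((e.linearEquivAt 𝕜 (s r) hr).injective h1)
  have hR : LinSmoothAt I R t := fun v => by
    refine ((e.contMDiffAt_iff (IB := 𝓡 n) (f := fun r => (⟨s r, S r v⟩ : B.Total)) (x₀ := t)
      (e.mem_source.2 he)).1
      (hS v)).2.congr_of_eventuallyEq ?_
    filter_upwards [hev] with r hr using hRe r hr v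
  have hN := ((e.contMDiffAt_iff (IB := 𝓡 n) (f := fun r => (⟨s r, S r (a r)⟩ : B.Total)) (x₀ := t)
    (e.mem_source.2 he)).1
    ha).2
  have hinv : ContMDiffAt I 𝓘(ℝ, V →L[ℝ] V) ∞
      (fun r => ContinuousLinearMap.inverse (R r).toRealCLM) t :=
    ContMDiffAt.comp (g := (ContinuousLinearMap.inverse : (V →L[ℝ] V) → (V →L[ℝ] V)))
      (f := fun r => (R r).toRealCLM) t
      (contDiffAt_inverse_of_injective (hRinj t he)).contMDiffAt hR.toRealCLM
  refine (hinv.clm_apply hN).congr_of_eventuallyEq ?_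
  filter_upwards [hev] with r hr
  rw [← hRe r hr, ← LinearMap.toRealCLM_apply,
    ContinuousLinearMap.inverse_apply_of_injective (hRinj r hr)]

variable [LieGroup (𝓡 d) ∞ G]

/-- Slice charts of an orbit bundle are compatible: the transition of the slices is covered by the
action of the group elements that move one slice to the other. -/
theorem IsSliceChart.compatible {c c' : VectorOrbibundleChart m 𝕜 V B.orbitProj}
    (hc : B.IsSliceChart c) (hc' : B.IsSliceChart c') : c.Compatible c' := by
  classical
  obtain ⟨s, S, hs, hS, hcs, hcS⟩ := hc
  obtain ⟨s', S', hs', hS', hcs', hcS'⟩ := hc'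
  intro y y' hyy
  rw [hcs, hcs'] at hyy
  obtain ⟨g₀, hg⟩ := Quotient.exact hyy.symm
  obtain ⟨h, b, hy, hhy, hb, hbs⟩ := hs.exists_transition hs' hg
  -- the fibre coordinates change by the action of `b z`, read in the frames `S` and `S'`
  have hex : ∀ z, ∃ L : V ≃ₗ[𝕜] V, z ∈ h.source → ∀ a,
      (⟨s' (h z), S' (h z) (L a)⟩ : B.Total) = b z • (⟨s z, S z a⟩ : B.Total) := by
    intro z
    by_cases hz : z ∈ h.source
    · obtain ⟨L, hL⟩ := exists_smul_eq (hbs z hz).symm (S z) (S' (h z))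
      exact ⟨L, fun _ => hL⟩
    · exact ⟨LinearEquiv.refl 𝕜 V, fun h => absurd h hz⟩
  choose L hL using hex
  refine ⟨h, L, fun z hz => ?_, hy, hhy, ?_, fun z hz a => ?_⟩
  · rw [hcs, hcs', hbs z hz]
    exact Quotient.sound ⟨b z, rfl⟩
  · rintro ⟨z, a⟩ ⟨hz, -⟩
    have hhz : ContMDiffAt ((𝓡 m).prod 𝓘(ℝ, V)) (𝓡 m) ∞
        (fun r : c.base.U × V => h r.1) (z, a) := (h.contMDiffAt hz).comp (z, a) contMDiffAt_fst
    have hbz : ContMDiffAt ((𝓡 m).prod 𝓘(ℝ, V)) (𝓡 d) ∞ (fun r : c.base.U × V => b r.1) (z, a) :=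
      (hb.contMDiffAt (h.open_source.mem_nhds hz)).comp (z, a) contMDiffAt_fst
    have hSh : ∀ v, ContMDiffAt ((𝓡 m).prod 𝓘(ℝ, V)) ((𝓡 n).prod 𝓘(ℝ, V)) ∞
        (fun r : c.base.U × V => (⟨s' (h r.1), S' (h r.1) v⟩ : B.Total)) (z, a) := fun v =>
      ContMDiffAt.comp (g := fun r : c'.base.U × V => (⟨s' r.1, S' r.1 r.2⟩ : B.Total))
        (f := fun r : c.base.U × V => (h r.1, v)) (z, a) hS'.contMDiffAt
        (hhz.prodMk contMDiffAt_const)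
    refine (contMDiffAt_coord (s := fun r : c.base.U × V => s' (h r.1)) (S := fun r => S' (h r.1))
      ((contMDiff_proj B.Fiber).contMDiffAt.comp (z, a) (hSh a)) hSh ?_).contMDiffWithinAt
    refine (ContMDiffAt.comp (g := fun r : G × B.Total => r.1 • r.2)
      (f := fun r : c.base.U × V => (b r.1, (⟨s r.1, S r.1 r.2⟩ : B.Total))) (z, a)
      B.contMDiff_smul.contMDiffAt (hbz.prodMk hS.contMDiffAt)).congr_of_eventuallyEq ?_
    filter_upwards [continuous_fst.continuousAt.eventually (h.open_source.mem_nhds hz)] with r hr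
    exact hL r.1 hr r.2
  · rw [hcS, hcS', hL z hz]
    exact Quotient.sound ⟨b z, rfl⟩

/-- A vector orbibundle structure of an orbit bundle whose charts are slice charts is the canonical
one. -/
theorem isOrbitBundle_of_isSliceChart {𝓞 : Orbifold m (MulAction.orbitRel.Quotient G X)}
    (𝓥 : VectorOrbibundle 𝕜 V 𝓞 B.orbitProj) (h : ∀ c ∈ 𝓥.charts, B.IsSliceChart c) :
    B.IsOrbitBundle 𝓥 := by
  refine Subset.antisymm (fun c hc c' hc' => (h c hc).compatible hc') fun c hc => ?_
  exact 𝓥.maximal c fun c' hc' => hc c' (h c' hc')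

end GVectorBundle

/-! ### Transport of vector orbibundles -/

section Transport

variable {m : ℕ} {𝕜 : Type x} [RCLike 𝕜] {V : Type w} [NormedAddCommGroup V] [NormedSpace 𝕜 V]
  [NormedSpace ℝ V] {E M E' M' : Type*} [TopologicalSpace E] [TopologicalSpace M]
  [TopologicalSpace E'] [TopologicalSpace M'] {p : E → M} {p' : E' → M'} {𝓜 : Orbifold m M}
  {Φ : E ≃ₜ E'} {φ : M ≃ₜ M'}

namespace VectorOrbibundleChart

theorem map_symm_map (c : VectorOrbibundleChart m 𝕜 V p) (h : ∀ e, p' (Φ e) = φ (p e))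
    (h' : ∀ e, p (Φ.symm e) = φ.symm (p' e)) : (c.map Φ φ h).map Φ.symm φ.symm h' = c := by
  obtain ⟨⟩ := c
  simp [VectorOrbibundleChart.map, OrbifoldChart.map, ← Function.comp_assoc]

theorem compatible_map_iff {c c' : VectorOrbibundleChart m 𝕜 V p}
    (h : ∀ e, p' (Φ e) = φ (p e)) : (c.map Φ φ h).Compatible (c'.map Φ φ h) ↔ c.Compatible c' := by
  simp [Compatible, VectorOrbibundleChart.map, OrbifoldChart.IsTransition]
  rfl

end VectorOrbibundleChart

/-- The vector orbibundle structure that makes a homeomorphism over a homeomorphism of the bases an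
isomorphism. -/
def VectorOrbibundle.transportAlong (𝓑 : VectorOrbibundle 𝕜 V 𝓜 p) (Φ : E ≃ₜ E') (φ : M ≃ₜ M')
    (h : ∀ e, p' (Φ e) = φ (p e)) (h' : ∀ e, p (Φ.symm e) = φ.symm (p' e)) :
    VectorOrbibundle 𝕜 V (𝓜.transport φ) p' where
  t2 := by
    have := 𝓑.t2
    exact Φ.symm.isEmbedding.t2Space
  continuous := by
    have h1 : p' = φ ∘ p ∘ Φ.symm := funext fun e => by simp [h']
    rw [h1]
    exact φ.continuous.comp (𝓑.continuous.comp Φ.symm.continuous)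
  charts := {c | c.map Φ.symm φ.symm h' ∈ 𝓑.charts}
  base_mem c hc := 𝓑.base_mem _ hc
  compatible c hc c' hc' :=
    (VectorOrbibundleChart.compatible_map_iff h').1 (𝓑.compatible _ hc _ hc')
  cover q := by
    obtain ⟨c, hc, y, hy⟩ := 𝓑.cover (φ.symm q)
    refine ⟨c.map Φ φ h, by rwa [mem_ofPred_eq, c.map_symm_map h h'], y, ?_⟩
    exact (congrArg φ hy).trans (φ.apply_symm_apply q)
  maximal c hc := 𝓑.maximal _ fun c' hc' => by
    rw [← c'.map_symm_map h h', VectorOrbibundleChart.compatible_map_iff]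
    exact hc _ (by rwa [mem_ofPred_eq, c'.map_symm_map h h'])

/-- A homeomorphism over a homeomorphism of the bases, as an isomorphism to the transported
structure. -/
def VectorOrbibundle.transportIso (𝓑 : VectorOrbibundle 𝕜 V 𝓜 p) (Φ : E ≃ₜ E') (φ : M ≃ₜ M')
    (h : ∀ e, p' (Φ e) = φ (p e)) (h' : ∀ e, p (Φ.symm e) = φ.symm (p' e)) :
    𝓑.Iso (𝓑.transportAlong Φ φ h h') (𝓜.transportDiffeo φ) where
  toHomeo := Φ
  proj_comm := h
  proj_comm_symm := h'
  map_mem c hc := by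
    change (c.map Φ φ h).map Φ.symm φ.symm h' ∈ 𝓑.charts
    rwa [c.map_symm_map h h']
  symm_map_mem _ hc := hc

end Transport

/-! ### Local sections of the frame bundle -/

namespace Orbifold

variable {m : ℕ} {M : Type u} [TopologicalSpace M] {𝓜 : Orbifold m M} {μ : 𝓜.Metric}

theorem ChartFrame.rotate_one {c : 𝓜.charts} (z : ChartFrame μ c) : z.rotate 1 = z :=
  ChartFrame.ext' rfl fun i => by simp [ChartFrame.rotate, Matrix.one_apply]

theorem ChartFrame.rotate_mul {c : 𝓜.charts} (z : ChartFrame μ c)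
    (g h : Matrix.orthogonalGroup (Fin m) ℝ) : z.rotate (g * h) = (z.rotate h).rotate g :=
  ChartFrame.ext' rfl fun i => by
    simp only [ChartFrame.rotate, Submonoid.coe_mul, Matrix.mul_apply, Finset.sum_smul,
      Finset.smul_sum, mul_smul]
    exact Finset.sum_comm

theorem ChartFrame.continuous_rotate (c : 𝓜.charts) :
    Continuous fun r : Matrix.orthogonalGroup (Fin m) ℝ × ChartFrame μ c => r.2.rotate r.1 := by
  refine continuous_induced_rng.2 ((continuous_point.comp continuous_snd).prodMk
    (continuous_pi fun i => continuous_finsetSum _ fun j _ => Continuous.smul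
    (f := fun a : Matrix.orthogonalGroup (Fin m) ℝ × ChartFrame μ c => a.1.1 i j)
    (g := fun a : Matrix.orthogonalGroup (Fin m) ℝ × ChartFrame μ c => a.2.1.2 j) ?_
    ((continuous_vector j).comp continuous_snd)))
  have h : Continuous fun a : Matrix.orthogonalGroup (Fin m) ℝ × ChartFrame μ c => a.1.1 :=
    continuous_subtype_val.comp continuous_fst
  exact h.matrix_elem i j

/-- A local section `sec` of the projection from the frames of a chart to the frame bundle; its
values outside `dom` do not matter. Smoothness is required of the base point only, as the frames of
a chart carry no smooth structure here. -/
structure LocalSection (μ : 𝓜.Metric) (c : 𝓜.charts) where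
  dom : Set (FrameBundle μ)
  isOpen_dom : IsOpen dom
  sec : FrameBundle μ → ChartFrame μ c
  mk_sec : ∀ q ∈ dom, FrameBundle.mk c (sec q) = q
  continuousOn_sec : ContinuousOn sec dom
  contMDiffOn_point : ContMDiffOn (𝓡 (m + orthDim m)) (𝓡 m) ∞ (fun q => (sec q).1.1) dom

/-- Local inverses of the parametrization by a frame field give local sections. -/
theorem FrameField.exists_localSection {c : 𝓜.charts} (σ : FrameField μ c)
    (p : Matrix.orthogonalGroup (Fin m) ℝ × c.1.U) :
    ∃ j : LocalSection μ c, ∀ᶠ r in 𝓝 p,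
      σ.param r ∈ j.dom ∧ j.sec (σ.param r) = σ.frameAt r := by
  obtain ⟨Φ, hΦ, hΦe⟩ := σ.isLocalDiffeomorph_param p
  refine ⟨⟨Φ.target, Φ.open_target, fun q => σ.frameAt (Φ.symm q), fun q hq => ?_, ?_, ?_⟩, ?_⟩
  · rw [← σ.param_eq_mk, hΦe (Φ.symm_apply_mem_source hq), Φ.apply_symm_apply hq]
  · exact σ.continuous_frameAt.comp_continuousOn Φ.symm.contMDiffOn.continuousOn
  · exact fun q hq => ((Φ.contMDiffAt_symm hq).snd).contMDiffWithinAt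
  · filter_upwards [Φ.open_source.mem_nhds hΦ] with r hr
    rw [hΦe hr]
    exact ⟨Φ.apply_mem_target hr, congrArg σ.frameAt (Φ.symm_apply_apply hr)⟩

theorem exists_localSection {c : 𝓜.charts} (z : ChartFrame μ c) :
    ∃ j : LocalSection μ c, FrameBundle.mk c z ∈ j.dom ∧ j.sec (FrameBundle.mk c z) = z := by
  obtain ⟨σ⟩ := nonempty_frameField μ c
  obtain ⟨j, hj⟩ := σ.exists_localSection (σ.coord z)
  have h1 := hj.self_of_nhds
  rw [σ.param_eq_mk, σ.frameAt_coord] at h1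
  exact ⟨j, h1⟩

/-- A chosen local section through a given frame. -/
def ChartFrame.localSection {c : 𝓜.charts} (z : ChartFrame μ c) : LocalSection μ c :=
  (exists_localSection z).choose

theorem ChartFrame.mk_mem_dom {c : 𝓜.charts} (z : ChartFrame μ c) :
    FrameBundle.mk c z ∈ z.localSection.dom := (exists_localSection z).choose_spec.1

theorem ChartFrame.sec_mk {c : 𝓜.charts} (z : ChartFrame μ c) :
    z.localSection.sec (FrameBundle.mk c z) = z := (exists_localSection z).choose_spec.2

end Orbifold

/-! ### The equivariant bundle over the frame bundle -/

namespace VectorOrbibundle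

open VectorOrbibundleChart Orbifold

variable {m : ℕ} {𝕜 : Type x} [RCLike 𝕜] {V : Type w} [NormedAddCommGroup V] [NormedSpace 𝕜 V]
  [NormedSpace ℝ V] {E : Type v} {M : Type u} [TopologicalSpace E] [TopologicalSpace M] {p : E → M}
  {𝓜 : Orbifold m M} {𝓑 : VectorOrbibundle 𝕜 V 𝓜 p} {μ : 𝓜.Metric}

/-- The frame bundle is covered by the domains of local sections in bundle charts. -/
theorem exists_index (𝓑 : VectorOrbibundle 𝕜 V 𝓜 p) (q : FrameBundle μ) :
    ∃ i : Σ c : 𝓑.charts, LocalSection μ (𝓑.baseChart c), q ∈ i.2.dom := by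
  obtain ⟨c, hc, y, hy⟩ := 𝓑.cover q.base
  obtain ⟨z, -, rfl⟩ := FrameBundle.exists_mk_of_base_eq (c := 𝓑.baseChart ⟨c, hc⟩) (y := y) hy.symm
  exact ⟨⟨⟨c, hc⟩, z.localSection⟩, z.mk_mem_dom⟩

variable (𝓑 μ) in
/-- The cocycle of the pullback of a vector orbibundle to the frame bundle. Its local
trivializations are given by the local sections of the frame bundle, and the fibre coordinates over
two frames are related by the transport. -/
def frameCore : EquivariantCore (d := orthDim m) (n := m + orthDim m)
    (Matrix.orthogonalGroup (Fin m) ℝ) (FrameBundle μ) 𝕜 V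
    (Σ c : 𝓑.charts, LocalSection μ (𝓑.baseChart c)) where
  baseSet i := i.2.dom
  isOpen_baseSet i := i.2.isOpen_dom
  indexAt q := (exists_index 𝓑 q).choose
  mem_baseSet_at q := (exists_index 𝓑 q).choose_spec
  map i j g q := transport ((i.2.sec q).rotate g) (j.2.sec (g • q))
  map_one i q hq a := by rw [ChartFrame.rotate_one, one_smul, transport_self]; rfl
  map_mul i j k g h q hi hj hk a := by
    have hi' := i.2.mk_sec q hi
    have hj' := j.2.mk_sec _ hj
    have hk' := k.2.mk_sec _ hk
    have h1 : FrameBundle.mk _ ((i.2.sec q).rotate h) = FrameBundle.mk _ (j.2.sec (h • q)) := by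
      rw [hj', ← FrameBundle.smul_mk, hi']
    have h2 : FrameBundle.mk _ ((j.2.sec (h • q)).rotate g) =
        FrameBundle.mk _ (k.2.sec ((g * h) • q)) := by
      rw [hk', ← FrameBundle.smul_mk, hj', mul_smul]
    have h3 : FrameBundle.mk _ (((i.2.sec q).rotate h).rotate g) =
        FrameBundle.mk _ ((j.2.sec (h • q)).rotate g) := congrArg (g • ·) h1
    rw [← transport_rotate h1 g, ← mul_smul g h q, transport_trans h3 h2, ChartFrame.rotate_mul]
  linSmoothAt_map i j g q hi hj := by
    have hact : ContMDiffAt ((𝓡 (orthDim m)).prod (𝓡 (m + orthDim m))) (𝓡 (m + orthDim m)) ∞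
        (fun z : Matrix.orthogonalGroup (Fin m) ℝ × FrameBundle μ => z.1 • z.2) (g, q) :=
      FrameBundle.contMDiff_smul.contMDiffAt
    have hidom := i.2.isOpen_dom.mem_nhds hi
    have hjdom := j.2.isOpen_dom.mem_nhds hj
    refine linSmoothAt_transport (f := fun z : Matrix.orthogonalGroup (Fin m) ℝ × FrameBundle μ =>
      (i.2.sec z.2).rotate z.1) (f' := fun z => j.2.sec (z.1 • z.2)) (t := (g, q)) ?_ ?_ ?_ ?_
    · have h1 : ContinuousAt (fun z : Matrix.orthogonalGroup (Fin m) ℝ × FrameBundle μ =>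
          i.2.sec z.2) (g, q) :=
        ContinuousAt.comp (g := i.2.sec) (f := Prod.snd) (i.2.continuousOn_sec.continuousAt hidom)
          continuousAt_snd
      exact (ChartFrame.continuous_rotate _).continuousAt.comp (continuousAt_fst.prodMk h1)
    · exact ContinuousAt.comp (g := j.2.sec)
        (f := fun z : Matrix.orthogonalGroup (Fin m) ℝ × FrameBundle μ => z.1 • z.2)
        (j.2.continuousOn_sec.continuousAt hjdom) hact.continuousAt
    · exact ContMDiffAt.comp (g := fun q => (i.2.sec q).1.1) (f := Prod.snd) (g, q)
        (i.2.contMDiffOn_point.contMDiffAt hidom) contMDiffAt_snd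
    · filter_upwards [continuousAt_snd.eventually hidom, hact.continuousAt.eventually hjdom]
        with z hz hz'
      rw [← FrameBundle.smul_mk, i.2.mk_sec _ hz, j.2.mk_sec _ hz']

theorem frameCore_map_one (i j : Σ c : 𝓑.charts, LocalSection μ (𝓑.baseChart c))
    (q : FrameBundle μ) :
    (𝓑.frameCore μ).map i j 1 q = transport (i.2.sec q) (j.2.sec q) := by
  change transport _ _ = _
  rw [ChartFrame.rotate_one, one_smul]

variable [FiniteDimensional 𝕜 V] {c c' : 𝓑.charts}

/-- The total space of the pullback of a vector orbibundle to the frame bundle. -/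
abbrev FrameTotal (𝓑 : VectorOrbibundle 𝕜 V 𝓜 p) (μ : 𝓜.Metric) :=
  Bundle.TotalSpace V (𝓑.frameCore μ).vectorCore.Fiber

/-- The element of the pullback bundle given by a frame in a bundle chart and a vector. It is
defined by the chosen local section through the frame, but any other one gives the same element. -/
def framePoint (z : ChartFrame μ (𝓑.baseChart c)) (a : V) : FrameTotal 𝓑 μ :=
  (𝓑.frameCore μ).point ⟨c, z.localSection⟩ (FrameBundle.mk _ z) a

theorem framePoint_eq_point (i : Σ c : 𝓑.charts, LocalSection μ (𝓑.baseChart c))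
    {z : ChartFrame μ (𝓑.baseChart c)} (hi : FrameBundle.mk _ z ∈ i.2.dom) (a : V) :
    framePoint z a = (𝓑.frameCore μ).point i (FrameBundle.mk _ z)
      (transport z (i.2.sec (FrameBundle.mk _ z)) a) := by
  refine ((𝓑.frameCore μ).point_eq_point ⟨c, z.localSection⟩ i z.mk_mem_dom hi a).trans ?_
  rw [frameCore_map_one, ChartFrame.sec_mk]

theorem smul_framePoint (g : Matrix.orthogonalGroup (Fin m) ℝ) (z : ChartFrame μ (𝓑.baseChart c))
    (a : V) : g • framePoint z a = framePoint (z.rotate g) a := by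
  refine ((𝓑.frameCore μ).smul_point ⟨c, z.localSection⟩ ⟨c, (z.rotate g).localSection⟩ g
    z.mk_mem_dom (z.rotate g).mk_mem_dom a).trans ?_
  refine congrArg ((𝓑.frameCore μ).point _ _) ?_
  change transport ((z.localSection.sec _).rotate g) ((z.rotate g).localSection.sec (g • _)) a = a
  rw [FrameBundle.smul_mk, ChartFrame.sec_mk, ChartFrame.sec_mk, transport_self]
  rfl

/-- The pullback bundle consists of the pairs of a frame and a vector, up to transport. -/
theorem framePoint_eq_iff {z : ChartFrame μ (𝓑.baseChart c)} {z' : ChartFrame μ (𝓑.baseChart c')}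
    {a a' : V} : framePoint z a = framePoint z' a' ↔
      FrameBundle.mk _ z = FrameBundle.mk _ z' ∧ transport z z' a = a' := by
  have key : ∀ h : FrameBundle.mk _ z = FrameBundle.mk _ z',
      framePoint z a = framePoint z' (transport z z' a) := by
    intro h
    rw [framePoint_eq_point ⟨c', z'.localSection⟩ (by rw [h]; exact z'.mk_mem_dom) a, h,
      ChartFrame.sec_mk]
    rfl
  constructor
  · intro h
    have h1 : FrameBundle.mk _ z = FrameBundle.mk _ z' := congrArg Bundle.TotalSpace.proj h
    refine ⟨h1, ?_⟩
    rw [key h1] at h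
    exact (𝓑.frameCore μ).point_injective _ z'.mk_mem_dom h
  · rintro ⟨h, rfl⟩
    exact key h

theorem exists_framePoint (e : FrameTotal 𝓑 μ) :
    ∃ (c : 𝓑.charts) (z : ChartFrame μ (𝓑.baseChart c)) (a : V), framePoint z a = e := by
  obtain ⟨i, hi⟩ := exists_index 𝓑 e.1
  obtain ⟨a, ha⟩ := (𝓑.frameCore μ).exists_point i e hi
  refine ⟨i.1, i.2.sec e.1, a, ?_⟩
  have h1 := i.2.mk_sec e.1 hi
  rw [framePoint_eq_point i (by rw [h1]; exact hi), h1, transport_self]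
  exact ha

/-- Along a frame field, `framePoint` is locally given by a single trivialization. -/
theorem eventually_framePoint_eq (σ : FrameField μ (𝓑.baseChart c))
    (r : Matrix.orthogonalGroup (Fin m) ℝ × (𝓑.baseChart c).1.U) :
    ∃ i, σ.param r ∈ (𝓑.frameCore μ).baseSet i ∧ ∀ᶠ r' in 𝓝 r, ∀ a,
      framePoint (σ.frameAt r') a = (𝓑.frameCore μ).point i (σ.param r') a := by
  obtain ⟨j, hj⟩ := σ.exists_localSection r
  refine ⟨⟨c, j⟩, hj.self_of_nhds.1, ?_⟩
  filter_upwards [hj] with r' hr' a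
  have h1 := framePoint_eq_point (𝓑 := 𝓑) (z := σ.frameAt r') ⟨c, j⟩ hr'.1 a
  rw [← σ.param_eq_mk] at h1
  rw [h1, hr'.2, transport_self]
  rfl

theorem isOpenMap_framePoint (σ : FrameField μ (𝓑.baseChart c)) :
    IsOpenMap fun t : (Matrix.orthogonalGroup (Fin m) ℝ × (𝓑.baseChart c).1.U) × V =>
      framePoint (σ.frameAt t.1) t.2 := by
  refine isOpenMap_iff_nhds_le.2 ?_
  rintro ⟨r, a⟩
  obtain ⟨i, hi, hev⟩ := eventually_framePoint_eq σ r
  have h1 : (fun t : (Matrix.orthogonalGroup (Fin m) ℝ × (𝓑.baseChart c).1.U) × V =>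
      framePoint (σ.frameAt t.1) t.2) =ᶠ[𝓝 (r, a)]
      (fun z : FrameBundle μ × V => (𝓑.frameCore μ).point i z.1 z.2) ∘ Prod.map σ.param id := by
    filter_upwards [continuousAt_fst.eventually hev] with t ht
    exact ht t.2
  rw [Filter.map_congr h1, ← Filter.map_map, hev.self_of_nhds a,
    ← (𝓑.frameCore μ).map_nhds_point i hi a]
  exact Filter.map_mono ((σ.isOpenMap_param.prodMap IsOpenMap.id).nhds_le (r, a))

theorem contMDiff_framePoint [IsScalarTower ℝ 𝕜 V] (σ : FrameField μ (𝓑.baseChart c)) :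
    ContMDiff ((𝓡 m).prod 𝓘(ℝ, V)) ((𝓡 (m + orthDim m)).prod 𝓘(ℝ, V)) ∞
      (fun t : (𝓑.baseChart c).1.U × V => framePoint (σ.frame t.1) t.2) := by
  rintro ⟨y, a⟩
  obtain ⟨i, hi, hev⟩ := eventually_framePoint_eq σ (1, y)
  have h1 : ContMDiffAt ((𝓡 m).prod 𝓘(ℝ, V)) ((𝓡 (orthDim m)).prod (𝓡 m)) ∞
      (fun t : (𝓑.baseChart c).1.U × V =>
        ((1 : Matrix.orthogonalGroup (Fin m) ℝ), t.1)) (y, a) :=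
    contMDiffAt_const.prodMk contMDiffAt_fst
  have h2 : ContMDiffAt ((𝓡 m).prod 𝓘(ℝ, V)) (𝓡 (m + orthDim m)) ∞
      (fun t : (𝓑.baseChart c).1.U × V => σ.param (1, t.1)) (y, a) :=
    σ.isLocalDiffeomorph_param.contMDiff.contMDiffAt.comp (y, a) h1
  refine ((𝓑.frameCore μ).contMDiffAt_point i (t := (y, a))
    (f := fun t : (𝓑.baseChart c).1.U × V => σ.param (1, t.1)) hi h2
    contMDiffAt_snd).congr_of_eventuallyEq ?_
  filter_upwards [h1.continuousAt.eventually hev] with t ht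
  rw [← ht t.2]
  exact congrArg (fun z => framePoint z t.2) (ChartFrame.rotate_one _).symm

/-- The total space of a vector orbibundle is the space of orbits of its pullback to the frame
bundle. -/
theorem exists_homeomorph_orbits [IsScalarTower ℝ 𝕜 V] (𝓑 : VectorOrbibundle 𝕜 V 𝓜 p)
    (μ : 𝓜.Metric) :
    ∃ Φ : E ≃ₜ MulAction.orbitRel.Quotient (Matrix.orthogonalGroup (Fin m) ℝ) (FrameTotal 𝓑 μ),
      ∀ (c : 𝓑.charts) (z : ChartFrame μ (𝓑.baseChart c)) (a : V),
        Φ (c.1.totalMap (z.1.1, a)) = Quotient.mk _ (framePoint z a) := by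
  let σ : ∀ c : 𝓑.charts, FrameField μ (𝓑.baseChart c) := fun c => (nonempty_frameField μ _).some
  -- both spaces are quotients of the disjoint union of the spaces `Ũ × V`, by the same relation
  let P : (Σ c : 𝓑.charts, c.1.base.U × V) → E := fun t => t.1.1.totalMap t.2
  let Q : (Σ c : 𝓑.charts, c.1.base.U × V) →
      MulAction.orbitRel.Quotient (Matrix.orthogonalGroup (Fin m) ℝ) (FrameTotal 𝓑 μ) :=
    fun t => Quotient.mk _ (framePoint ((σ t.1).frame t.2.1) t.2.2)
  have : ContinuousConstSMul (Matrix.orthogonalGroup (Fin m) ℝ) (FrameTotal 𝓑 μ) :=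
    ⟨fun g => ((𝓑.frameCore μ).contMDiff_smul FrameBundle.contMDiff_smul).continuous.comp
      (Continuous.prodMk_right g)⟩
  -- every frame is a rotation of the frame given by the frame field
  have hrot : ∀ (c : 𝓑.charts) (z : ChartFrame μ (𝓑.baseChart c)),
      ((σ c).frame z.1.1).rotate ((σ c).coord z).1 = z := fun c z => (σ c).frameAt_coord z
  have hQ : ∀ (c : 𝓑.charts) (z : ChartFrame μ (𝓑.baseChart c)) (a : V),
      Q ⟨c, z.1.1, a⟩ = Quotient.mk _ (framePoint z a) := by
    intro c z a
    have h1 := smul_framePoint ((σ c).coord z).1 ((σ c).frame z.1.1) a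
    rw [hrot] at h1
    exact (Quotient.sound (s := MulAction.orbitRel _ _) ⟨_, h1⟩).symm
  have hPq : Topology.IsQuotientMap P := by
    refine IsOpenMap.isQuotientMap (isOpenMap_sigma.2 fun c => c.1.isOpenMap_totalMap)
      (continuous_sigma fun c => c.1.continuous_totalMap) fun e => ?_
    obtain ⟨c, hc, hq⟩ := 𝓑.cover (p e)
    have h1 : e ∈ range c.totalMap := by
      rw [c.range_totalMap]
      exact hq
    obtain ⟨t, ht⟩ := h1
    exact ⟨⟨⟨c, hc⟩, t⟩, ht⟩
  have hQq : Topology.IsQuotientMap Q := by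
    refine IsOpenMap.isQuotientMap (isOpenMap_sigma.2 fun c O hO => ?_)
      (continuous_sigma fun c =>
        continuous_quotient_mk'.comp (contMDiff_framePoint (σ c)).continuous)
      fun e => ?_
    -- the image of a set under `Q` is also the image in the orbit space of its preimage in
    -- `(O(m) × Ũ) × V`, where `framePoint` is open
    · have h1 : (fun t : c.1.base.U × V => Q ⟨c, t⟩) '' O = Quotient.mk _ ''
          ((fun t : (Matrix.orthogonalGroup (Fin m) ℝ × (𝓑.baseChart c).1.U) × V =>
            framePoint ((σ c).frameAt t.1) t.2) '' ((fun t => (t.1.2, t.2)) ⁻¹' O)) := by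
        ext e
        constructor
        · rintro ⟨t, ht, rfl⟩
          exact ⟨_, ⟨((1, t.1), t.2), ht, rfl⟩, (hQ c ((σ c).frameAt (1, t.1)) t.2).symm⟩
        · rintro ⟨_, ⟨t, ht, rfl⟩, rfl⟩
          exact ⟨_, ht, hQ c ((σ c).frameAt t.1) t.2⟩
      change IsOpen ((fun t : c.1.base.U × V => Q ⟨c, t⟩) '' O)
      rw [h1]
      refine isOpenMap_quotient_mk'_mul _ (isOpenMap_framePoint (σ c) _ (hO.preimage ?_))
      exact (continuous_snd.comp continuous_fst).prodMk continuous_snd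
    · obtain ⟨e, rfl⟩ := Quotient.exists_rep e
      obtain ⟨c, z, a, rfl⟩ := exists_framePoint e
      exact ⟨⟨c, z.1.1, a⟩, hQ c z a⟩
  obtain ⟨Φ, hΦ⟩ := exists_homeomorph_of_isQuotientMap hPq hQq (by
    rintro ⟨c, y, a⟩ ⟨c', y', a'⟩
    constructor
    · intro h
      obtain ⟨z', hz, h1, rfl⟩ := exists_frame_of_totalMap_eq (c' := c')
        (z := (σ c).frame y) (y' := y') h
      subst hz
      rw [hQ c' z']
      exact congrArg _ (framePoint_eq_iff.2 ⟨h1, rfl⟩)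
    · intro h
      obtain ⟨g, hg⟩ := Quotient.exact h
      dsimp only at hg
      rw [smul_framePoint] at hg
      obtain ⟨h1, rfl⟩ := framePoint_eq_iff.1 hg
      exact totalMap_transport h1 a')
  exact ⟨Φ, fun c z a => (hΦ ⟨c, z.1.1, a⟩).trans (hQ c z a)⟩

/-- Every vector orbibundle is the bundle of orbits of an equivariant bundle over the frame
bundle. -/
theorem exists_orbitBundle [IsScalarTower ℝ 𝕜 V] (𝓑 : VectorOrbibundle 𝕜 V 𝓜 p)
    {φ : M ≃ₜ MulAction.orbitRel.Quotient (Matrix.orthogonalGroup (Fin m) ℝ) (FrameBundle μ)}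
    (hφ : ∀ q : FrameBundle μ, φ q.base = Quotient.mk _ q) :
    ∃ (B : GVectorBundle (d := orthDim m) (n := m + orthDim m)
        (Matrix.orthogonalGroup (Fin m) ℝ) (FrameBundle μ) 𝕜 V)
      (𝓥 : VectorOrbibundle 𝕜 V (𝓜.transport φ) B.orbitProj),
      B.IsOrbitBundle 𝓥 ∧ Nonempty (𝓑.Iso 𝓥 (𝓜.transportDiffeo φ)) := by
  let B := (𝓑.frameCore μ).toGVectorBundle FrameBundle.contMDiff_smul
  obtain ⟨Φ, hΦ⟩ := 𝓑.exists_homeomorph_orbits μ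
  have hp : ∀ e, B.orbitProj (Φ e) = φ (p e) := by
    intro e
    obtain ⟨c, hc, hq⟩ := 𝓑.cover (p e)
    have h1 : e ∈ range c.totalMap := by
      rw [c.range_totalMap]
      exact hq
    obtain ⟨⟨y, a⟩, rfl⟩ := h1
    obtain ⟨σ⟩ := nonempty_frameField μ (𝓑.baseChart ⟨c, hc⟩)
    have h2 := hΦ ⟨c, hc⟩ (σ.frame y) a
    have h3 := hφ (FrameBundle.mk _ (σ.frame y))
    refine (congrArg B.orbitProj h2).trans ?_
    rw [c.proj_totalMap]
    exact h3.symm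
  have hp' : ∀ e, p (Φ.symm e) = φ.symm (B.orbitProj e) := fun e => by
    rw [φ.eq_symm_apply, ← hp, Φ.apply_symm_apply]
  -- carry the atlas of `E` over to the orbit space; its charts are slice charts by means of frame
  -- fields
  refine ⟨B, 𝓑.transportAlong Φ φ hp hp', B.isOrbitBundle_of_isSliceChart _ fun c hc => ?_,
    ⟨𝓑.transportIso Φ φ hp hp'⟩⟩
  let c₁ : 𝓑.charts := ⟨c.map Φ.symm φ.symm hp', hc⟩
  obtain ⟨σ⟩ := nonempty_frameField μ (𝓑.baseChart c₁)
  refine ⟨fun y => FrameBundle.mk _ (σ.frame y), fun y =>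
    (𝓑.frameCore μ).fibreEquiv ⟨c₁, (σ.frame y).localSection⟩ (σ.frame y).mk_mem_dom,
    σ.isSlice, contMDiff_framePoint σ, fun y => ?_, fun y a => ?_⟩
  · rw [← hφ]
    exact (φ.apply_symm_apply (c.base.proj y)).symm
  · have h1 := hΦ c₁ (σ.frame y) a
    exact ((Φ.apply_symm_apply (c.totalMap (y, a))).symm.trans h1)

end VectorOrbibundle

end

theorem mainTheorem6 {m : ℕ} {M : Type u} [TopologicalSpace M] [ParacompactSpace M]
    (𝓜 : Orbifold m M) :
    Nonempty 𝓜.Metric ∧ ∀ μ : 𝓜.Metric,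
      CompactSpace (Matrix.orthogonalGroup (Fin m) ℝ) ∧
      -- the Lie group structure of `O(m)` and the smooth structure of `F(M)`
      ∃ (d : ℕ) (_ : ChartedSpace (EuclideanSpace ℝ (Fin d)) (Matrix.orthogonalGroup (Fin m) ℝ))
        (_ : LieGroup (𝓡 d) ∞ (Matrix.orthogonalGroup (Fin m) ℝ))
        (_ : ChartedSpace (EuclideanSpace ℝ (Fin (m + d))) (Orbifold.FrameBundle μ))
        (_ : IsManifold (𝓡 (m + d)) ∞ (Orbifold.FrameBundle μ)),
        -- for every smooth orthonormal frame field `σ` of a chart, the map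
        -- `O(m) × Ũ ≅ F(Ũ) → F(M)` that it gives is a local diffeomorphism
        (∀ (c : 𝓜.charts) (σ : c.1.U → Fin m → EuclideanSpace ℝ (Fin m))
          (hσ : ∀ y i j, μ.inner c y (σ y i) (σ y j) = if i = j then 1 else 0),
          ContMDiff (𝓡 m) 𝓘(ℝ, Fin m → EuclideanSpace ℝ (Fin m)) ∞ σ →
          IsSlice (d := d) (n := m + d) (G := Matrix.orthogonalGroup (Fin m) ℝ)
            (fun y => Orbifold.FrameBundle.mk (μ := μ) c ⟨(y, σ y), hσ y⟩)) ∧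
        T2Space (Orbifold.FrameBundle μ) ∧
        ParacompactSpace (Orbifold.FrameBundle μ) ∧
        (SecondCountableTopology M → SecondCountableTopology (Orbifold.FrameBundle μ)) ∧
        -- `O(m)` acts smoothly and with finite isotropy groups
        ContMDiff ((𝓡 d).prod (𝓡 (m + d))) (𝓡 (m + d)) ∞
          (fun z : Matrix.orthogonalGroup (Fin m) ℝ × Orbifold.FrameBundle μ => z.1 • z.2) ∧
        (∀ z : Orbifold.FrameBundle μ,
          Finite (MulAction.stabilizer (Matrix.orthogonalGroup (Fin m) ℝ) z)) ∧
        -- `M` is diffeomorphic to the orbifold of `O(m)`-orbits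
        ∃ (𝓞 : Orbifold m (MulAction.orbitRel.Quotient (Matrix.orthogonalGroup (Fin m) ℝ)
            (Orbifold.FrameBundle μ))) (φ : 𝓜.Diffeo 𝓞),
          𝓞.IsOrbitSpace (d := d) (n := m + d) ∧
          (∀ z : Orbifold.FrameBundle μ, φ.toHomeo z.base = Quotient.mk _ z) ∧
          -- every vector orbibundle on `M` is isomorphic to one of `O(m)`-orbits
          ∀ (𝕜 : Type x) [RCLike 𝕜] (V : Type w) [NormedAddCommGroup V] [NormedSpace 𝕜 V]
            [NormedSpace ℝ V] [IsScalarTower ℝ 𝕜 V] [FiniteDimensional 𝕜 V]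
            (E : Type v) [TopologicalSpace E] (p : E → M) (𝓑 : VectorOrbibundle 𝕜 V 𝓜 p),
            ∃ (B : GVectorBundle (d := d) (n := m + d) (Matrix.orthogonalGroup (Fin m) ℝ)
                (Orbifold.FrameBundle μ) 𝕜 V)
              (𝓥 : VectorOrbibundle 𝕜 V 𝓞 B.orbitProj),
              B.IsOrbitBundle 𝓥 ∧ Nonempty (𝓑.Iso 𝓥 φ) := by
  refine ⟨𝓜.nonempty_metric, fun μ => ⟨inferInstance, orthDim m, inferInstance, inferInstance,
    inferInstance, inferInstance, fun c σ hσ hs => Orbifold.FrameField.isSlice ⟨σ, hσ, hs⟩,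
    Orbifold.FrameBundle.t2Space μ, Orbifold.FrameBundle.paracompactSpace μ,
    fun _ => Orbifold.FrameBundle.secondCountableTopology μ, Orbifold.FrameBundle.contMDiff_smul,
    Orbifold.FrameBundle.finite_stabilizer, ?_⟩⟩
  obtain ⟨φ, hφ⟩ := Orbifold.FrameBundle.exists_homeomorph_orbits μ
  exact ⟨𝓜.transport φ, 𝓜.transportDiffeo φ, Orbifold.isOrbitSpace_of_isSliceChart _
    fun c hc => Orbifold.isSliceChart_of_mem_transport hφ hc, hφ,
    fun 𝕜 _ V _ _ _ _ _ E _ p 𝓑 => 𝓑.exists_orbitBundle hφ⟩
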